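/- Let $\varphi_0=(e^{12}+e^{34}+e^{56})\wedge e^7+e^{135}-e^{146}-e^{236}-e^{245}$ on $\mathbb R^7$, with cross product $\langle u\times v,w\rangle=\varphi_0(u,v,w)$, and let $G_2\subset GL(7,\mathbb R)$ be the stabiliser of $\varphi_0$. Let $Y$ be a smooth 7-manifold (Hausdorff, second countable, possibly with boundary) with a $G_2$ structure $\varphi$, that is, a 3-form that equals $\varphi_0$ in suitable continuous local trivialisations of $TY$ (called adapted); let $g_\varphi$ and $\times_\varphi$ be the induced metric and cross product. An almost contact metric 3-structure (ACM3S) on $(Y,g_\varphi)$ consists of continuous endomorphisms $J^\alpha$ of $TY$, vector fields $R^\alpha$ of unit length and one-forms $\sigma^\alpha$, $\alpha=1,2,3$, with $$(J^\alpha)^2=-1+R^\alpha\otimes\sigma^\alpha,\qquad \sigma^\alpha(R^\alpha)=1,\qquad g_\varphi(J^\alpha u,J^\alpha v)=g_\varphi(u,v)-\sigma^\alpha(u)\sigma^\alpha(v),$$ and, for every cyclic permutation $(\alpha,\beta,\gamma)$ of $(1,2,3)$, $$J^\gamma=J^\alpha J^\beta-R^\alpha\otimes\sigma^\beta=-J^\beta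 J^\alpha+R^\beta\otimes\sigma^\alpha,\quad R^\gamma=J^\alpha R^\beta=-J^\beta R^\alpha,\quad \sigma^\gamma=\sigma^\alpha\circ J^\beta=-\sigma^\beta\circ J^\alpha,\quad \sigma^\alpha(R^\beta)=\sigma^\beta(R^\alpha)=0 .$$ It is compatible with $\varphi$ if $J^\alpha u=R^\alpha\times_\varphi u$ for $\alpha=1,2$. Let $\mathcal V_2(TY)\to Y$ be the bundle of $g_\varphi$-orthonormal pairs of tangent vectors, and $\mathcal G(\varphi)\to Y$ the bundle of associative 3-planes (3-dimensional subspaces of $T_xY$ closed under $\times_\varphi$), with the quotient topology under $(u,v)\mapsto\operatorname{span}\{u,v,u\times_\varphi v\}$. Let $V_2(\mathbb R^7)$ and $G(\varphi_0)$ be the corresponding spaces for $(\mathbb R^7,\varphi_0)$. Spaces $\Gamma$ of continuous sections and $\mathrm{Maps}$ of continuous maps carry the compact-open topology. Then: 1. Assigning to an ACM3S its pair $(R^1,R^2)$ is a bijection from the ACM3Ss compatible with $\varphi$ onto $\Gamma(Y,\mathcal V_2(TY))$, and $R^3=R^1\times_\varphi R^2$. 2. $\mathcal V_2(TY)$ and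 $\mathcal G(\varphi)$ are locally trivial over $Y$ with fibres $V_2(\mathbb R^7)$ and $G(\varphi_0)$; each adapted local trivialisation of $TY$ induces local trivialisations of them. The group $G_2$ acts transitively on $V_2(\mathbb R^7)$ and on $G(\varphi_0)$; the stabilisers are isomorphic, as topological groups, to $SU(2)$ and $SO(4)$ respectively, and the orbit maps induce homeomorphisms $G_2/SU(2)\cong V_2(\mathbb R^7)$ and $G_2/SO(4)\cong G(\varphi_0)$. 3. Let $\mathscr S\subset\Gamma(Y,\mathcal G(\varphi))$ be the subspace of those associative rank-3 subbundles of $TY$ that are trivial vector bundles. It is a union of path components of $\Gamma(Y,\mathcal G(\varphi))$. The fibrewise span $p:\Gamma(Y,\mathcal V_2(TY))\to\mathscr S$, $(R^1,R^2)\mapsto\operatorname{span}\{R^1,R^2,R^1\times_\varphi R^2\}$, is well defined, continuous and surjective. With $R^3=R^1\times_\varphi R^2$, the formula $(\Theta\cdot R)^\alpha=\sum_\beta\Theta^\alpha{}_\beta R^\beta$ defines for each $\Theta\in\mathrm{Maps}(Y,SO(3))$ and each $R$ a unique section $\Theta\cdot R$ of $\mathcal V_2(TY)$, and this makes each fibre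 of $p$ a free and transitive $\mathrm{Maps}(Y,SO(3))$-orbit. 4. Suppose that $Y$ is compact or, more generally, that the identity of $Y$ is homotopic to a map $Y\to Y$ with image in a compact subset. Then $p$ is a locally trivial fibre bundle with fibre $\mathrm{Maps}(Y,SO(3))$: $$\mathrm{Maps}(Y,SO(3))\longrightarrow\Gamma(Y,\mathcal V_2(TY))\stackrel{p}{\longrightarrow}\mathscr S\subset\Gamma(Y,\mathcal G(\varphi)).$$ -/

import Mathlib

open scoped Manifold ContDiff Topology
open Bundle

noncomputable section

/-- Euclidean seven-space `ℝ⁷`. -/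
abbrev E7 : Type := EuclideanSpace ℝ (Fin 7)

/-- The elementary three-form `e^{ijk} = e^i ∧ e^j ∧ e^k` on `ℝ⁷` (indices start at `0`). -/
def e3 (i j k : Fin 7) (u v w : E7) : ℝ :=
  u i * (v j * w k - v k * w j) - u j * (v i * w k - v k * w i) + u k * (v i * w j - v j * w i)

/-- The standard `G₂` form
`φ₀ = (e^{12} + e^{34} + e^{56}) ∧ e^7 + e^{135} - e^{146} - e^{236} - e^{245}`. -/
def stdForm (u v w : E7) : ℝ :=
  e3 0 1 6 u v w + e3 2 3 6 u v w + e3 4 5 6 u v w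
    + e3 0 2 4 u v w - e3 0 3 5 u v w - e3 1 2 5 u v w - e3 1 3 4 u v w

/-- The cross product on `ℝ⁷`: the vector with `⟨u × v, w⟩ = φ₀(u, v, w)`. -/
def stdCross (u v : E7) : E7 :=
  WithLp.toLp 2 (fun k => stdForm u v (EuclideanSpace.single k 1))

theorem stdCross_apply (u v : E7) (k : Fin 7) : stdCross u v k =
    ![u 1 * v 6 - u 6 * v 1 + (u 2 * v 4 - u 4 * v 2) - (u 3 * v 5 - u 5 * v 3),
      u 6 * v 0 - u 0 * v 6 - (u 2 * v 5 - u 5 * v 2) - (u 3 * v 4 - u 4 * v 3),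
      u 3 * v 6 - u 6 * v 3 - (u 0 * v 4 - u 4 * v 0) + (u 1 * v 5 - u 5 * v 1),
      u 6 * v 2 - u 2 * v 6 + (u 0 * v 5 - u 5 * v 0) + (u 1 * v 4 - u 4 * v 1),
      u 5 * v 6 - u 6 * v 5 + (u 0 * v 2 - u 2 * v 0) - (u 1 * v 3 - u 3 * v 1),
      u 6 * v 4 - u 4 * v 6 - (u 0 * v 3 - u 3 * v 0) - (u 1 * v 2 - u 2 * v 1),
      u 0 * v 1 - u 1 * v 0 + (u 2 * v 3 - u 3 * v 2) + (u 4 * v 5 - u 5 * v 4)] k := by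
  fin_cases k <;> simp [stdCross, stdForm, e3] <;> ring

theorem inner_E7 (u v : E7) : inner ℝ u v =
    u 0 * v 0 + u 1 * v 1 + u 2 * v 2 + u 3 * v 3 + u 4 * v 4 + u 5 * v 5 + u 6 * v 6 := by
  simp only [PiLp.inner_apply, RCLike.inner_apply, conj_trivial, Fin.sum_univ_seven]
  ring

theorem inner_stdCross (u v w : E7) : inner ℝ (stdCross u v) w = stdForm u v w := by
  simp only [inner_E7, stdCross_apply, stdForm, e3]
  simp
  ring

theorem stdCross_stdCross (u v : E7) :
    stdCross u (stdCross u v) = (inner ℝ u v : ℝ) • u - (inner ℝ u u : ℝ) • v := by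
  ext k
  rw [PiLp.sub_apply, PiLp.smul_apply, PiLp.smul_apply, inner_E7, inner_E7, stdCross_apply]
  simp only [stdCross_apply]
  fin_cases k <;> simp <;> ring

theorem stdForm_swap (u v w : E7) : stdForm v u w = -stdForm u v w := by
  simp only [stdForm, e3]; ring

theorem stdForm_cyc (u v w : E7) : stdForm u v w = stdForm v w u := by
  simp only [stdForm, e3]; ring

theorem stdForm_self (u w : E7) : stdForm u u w = 0 := by
  simp only [stdForm, e3]; ring

theorem stdCross_swap (u v : E7) : stdCross v u = -stdCross u v := by
  ext k; simp [stdCross, stdForm_swap u v]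

/-- The cross product as a bilinear map. -/
def stdCrossₗ : E7 →ₗ[ℝ] E7 →ₗ[ℝ] E7 :=
  LinearMap.mk₂ ℝ stdCross
    (by intro a b c; ext k; simp only [stdCross, stdForm, e3, PiLp.add_apply]; ring)
    (by intro r a b; ext k; simp only [stdCross, stdForm, e3, PiLp.smul_apply, smul_eq_mul]; ring)
    (by intro a b c; ext k; simp only [stdCross, stdForm, e3, PiLp.add_apply]; ring)
    (by intro r a b; ext k; simp only [stdCross, stdForm, e3, PiLp.smul_apply, smul_eq_mul]; ring)

/-- The group `G₂` of linear automorphisms of `ℝ⁷` that preserve `φ₀`, a topological group as a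
subgroup of the general linear group. -/
def G2 : Subgroup (E7 →L[ℝ] E7)ˣ where
  carrier := {A | ∀ u v w, stdForm ((A : E7 →L[ℝ] E7) u) ((A : E7 →L[ℝ] E7) v)
    ((A : E7 →L[ℝ] E7) w) = stdForm u v w}
  mul_mem' := by
    intro A B hA hB u v w
    simp only [Set.mem_ofPred_eq] at hA hB
    simp [hA, hB]
  one_mem' := by intro u v w; simp
  inv_mem' := by
    intro A hA u v w
    simp only [Set.mem_ofPred_eq] at hA
    have h : ∀ x : E7, (A : E7 →L[ℝ] E7) (((A⁻¹ : (E7 →L[ℝ] E7)ˣ) : E7 →L[ℝ] E7) x) = x := fun x => by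
      rw [← mul_apply_eq_comp, Units.mul_inv]; rfl
    rw [← hA, h, h, h]

/-- The linear map underlying an element of `G₂`. -/
def G2.toLin (A : G2) : E7 →ₗ[ℝ] E7 := ((A : (E7 →L[ℝ] E7)ˣ) : E7 →L[ℝ] E7)

/-- The Stiefel manifold `V₂(ℝ⁷)` of orthonormal pairs. -/
abbrev StdStiefel : Type :=
  {p : E7 × E7 // inner ℝ p.1 p.1 = 1 ∧ inner ℝ p.2 p.2 = 1 ∧ inner ℝ p.1 p.2 = 0}

/-- The stabiliser in `G₂` of an orthonormal pair. -/
def stabPair (p : StdStiefel) : Subgroup G2 where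
  carrier := {A | G2.toLin A p.1.1 = p.1.1 ∧ G2.toLin A p.1.2 = p.1.2}
  mul_mem' := by
    rintro A B ⟨hA, hA'⟩ ⟨hB, hB'⟩
    simp only [G2.toLin, ContinuousLinearMap.coe_coe] at hA hA' hB hB'
    exact ⟨by simp [G2.toLin, hA, hB], by simp [G2.toLin, hA', hB']⟩
  one_mem' := by simp [G2.toLin]
  inv_mem' := by
    rintro A ⟨hA, hA'⟩
    simp only [G2.toLin, ContinuousLinearMap.coe_coe] at hA hA'
    have h : ∀ x : E7, ((A.1⁻¹ : (E7 →L[ℝ] E7)ˣ) : E7 →L[ℝ] E7) ((A.1 : E7 →L[ℝ] E7) x) = x :=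
      fun x => by rw [← mul_apply_eq_comp, Units.inv_mul]; rfl
    constructor
    · conv_lhs => rw [← hA]
      exact h _
    · conv_lhs => rw [← hA']
      exact h _

/-- A three-plane in `ℝ⁷` is associative when it is closed under the cross product, that is, when it
is a copy of the imaginary quaternions. `StdAssoc` is the associative Grassmannian `G(φ₀)`. -/
def StdAssoc : Type :=
  {T : Submodule ℝ E7 // Module.finrank ℝ T = 3 ∧ ∀ u ∈ T, ∀ v ∈ T, stdCross u v ∈ T}

/-- The stabiliser in `G₂` of an associative three-plane. -/
def stabPlane (T : StdAssoc) : Subgroup G2 where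
  carrier := {A | T.1.map (G2.toLin A) = T.1}
  mul_mem' := by
    intro A B hA hB
    have h : G2.toLin (A * B) = G2.toLin A ∘ₗ G2.toLin B := rfl
    simp only [Set.mem_ofPred_eq] at hA hB ⊢
    rw [h, Submodule.map_comp, hB, hA]
  one_mem' := by
    have h : G2.toLin 1 = LinearMap.id := rfl
    simp only [Set.mem_ofPred_eq]
    rw [h, Submodule.map_id]
  inv_mem' := by
    intro A hA
    have h : G2.toLin A⁻¹ ∘ₗ G2.toLin A = LinearMap.id := by
      ext1 x
      change (((A.1⁻¹ : (E7 →L[ℝ] E7)ˣ) : E7 →L[ℝ] E7) * (A.1 : E7 →L[ℝ] E7)) x = x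
      rw [Units.inv_mul]; rfl
    simp only [Set.mem_ofPred_eq] at hA ⊢
    conv_lhs => rw [← hA]
    rw [← Submodule.map_comp, h, Submodule.map_id]

theorem stdSpan_assoc (u v : E7) (hu : inner ℝ u u = 1) (hv : inner ℝ v v = 1)
    (huv : inner ℝ u v = 0) :
    Module.finrank ℝ (Submodule.span ℝ {u, v, stdCross u v}) = 3 ∧
      ∀ a ∈ Submodule.span ℝ {u, v, stdCross u v}, ∀ b ∈ Submodule.span ℝ {u, v, stdCross u v},
        stdCross a b ∈ Submodule.span ℝ {u, v, stdCross u v} := by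
  have h1 : stdCross u (stdCross u v) = -v := by
    rw [stdCross_stdCross, hu, huv]; simp
  have h2 : stdCross v (stdCross u v) = u := by
    rw [stdCross_swap v u]
    have := stdCross_stdCross v u
    rw [real_inner_comm, huv, hv] at this
    have hn : stdCross v (-stdCross v u) = -stdCross v (stdCross v u) := by
      simpa [stdCrossₗ] using (stdCrossₗ v).map_neg (stdCross v u)
    rw [hn, this]; simp
  have h0 : ∀ x : E7, stdCross x x = 0 := by
    intro x; ext k; simp [stdCross, stdForm_self]
  have huc : inner ℝ u (stdCross u v) = 0 := by
    rw [real_inner_comm, inner_stdCross, stdForm_cyc, stdForm_cyc, stdForm_self]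
  have hvc : inner ℝ v (stdCross u v) = 0 := by
    rw [real_inner_comm, inner_stdCross, stdForm_cyc, stdForm_self]
  have hcc : inner ℝ (stdCross u v) (stdCross u v) = 1 := by
    rw [inner_stdCross, stdForm_cyc, ← inner_stdCross, h2, hu]
  constructor
  · have ho : Orthonormal ℝ ![u, v, stdCross u v] := by
      rw [orthonormal_iff_ite]
      intro i j
      fin_cases i <;> fin_cases j <;>
        simp [-inner_self_eq_norm_sq_to_K, hu, hv, huv, huc, hvc, hcc, real_inner_comm u v,
          real_inner_comm u (stdCross u v), real_inner_comm v (stdCross u v)]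
    have := finrank_span_eq_card ho.linearIndependent
    rw [Matrix.range_cons, Matrix.range_cons, Matrix.range_cons, Matrix.range_empty,
      Set.union_empty, Set.singleton_union, Set.singleton_union, Fintype.card_fin] at this
    exact this
  · set T := Submodule.span ℝ {u, v, stdCross u v} with hT
    have mu : u ∈ T := Submodule.subset_span (by simp)
    have mv : v ∈ T := Submodule.subset_span (by simp)
    have mc : stdCross u v ∈ T := Submodule.subset_span (by simp)
    intro a ha b hb
    have key : ∀ a ∈ ({u, v, stdCross u v} : Set E7), ∀ b ∈ ({u, v, stdCross u v} : Set E7),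
        stdCrossₗ a b ∈ T := by
      intro a ha b hb
      simp only [Set.mem_insert_iff, Set.mem_singleton_iff] at ha hb
      change stdCross a b ∈ T
      rcases ha with rfl | rfl | rfl <;> rcases hb with rfl | rfl | rfl
      · rw [h0]; exact T.zero_mem
      · exact mc
      · rw [h1]; exact T.neg_mem mv
      · rw [stdCross_swap]; exact T.neg_mem mc
      · rw [h0]; exact T.zero_mem
      · rw [h2]; exact mu
      · rw [stdCross_swap, h1, neg_neg]; exact mv
      · rw [stdCross_swap, h2]; exact T.neg_mem mu
      · rw [h0]; exact T.zero_mem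
    have : stdCrossₗ a b ∈ T := by
      rw [hT] at ha hb
      induction ha, hb using Submodule.span_induction₂ with
      | mem_mem x y hx hy => exact key x hx y hy
      | zero_left y hy => simp
      | zero_right x hx => simp
      | add_left x y z _ _ _ h h' => simpa using T.add_mem h h'
      | add_right x y z _ _ _ h h' => simpa using T.add_mem h h'
      | smul_left r x y _ _ h => simpa using T.smul_mem r h
      | smul_right r x y _ _ h => simpa using T.smul_mem r h
    exact this

/-- The map `V₂(ℝ⁷) → G(φ₀)`, `(u, v) ↦ span {u, v, u × v}`. -/
def StdStiefel.span (p : StdStiefel) : StdAssoc :=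
  ⟨Submodule.span ℝ {p.1.1, p.1.2, stdCross p.1.1 p.1.2},
    stdSpan_assoc _ _ p.2.1 p.2.2.1 p.2.2.2⟩

/-- The Grassmannian carries the quotient topology of the Stiefel manifold. -/
instance : TopologicalSpace StdAssoc :=
  TopologicalSpace.coinduced StdStiefel.span inferInstance

section Manifold

variable {H : Type*} [TopologicalSpace H] (I : ModelWithCorners ℝ E7 H)
  (Y : Type*) [TopologicalSpace Y] [ChartedSpace H Y] [IsManifold I 1 Y]

/-- A `G₂` structure on a seven-manifold: a three-form such that around every point there is a
(continuous, linear) local trivialisation of the tangent bundle in which the form is the standard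
form `φ₀`. -/
structure G2Structure where
  form : ∀ x : Y, TangentSpace I x [⋀^Fin 3]→ₗ[ℝ] ℝ
  exists_adapted : ∀ x : Y, ∃ e : Trivialization E7 (TotalSpace.proj : TangentBundle I Y → Y),
    e.IsLinear ℝ ∧ x ∈ e.baseSet ∧ ∀ y ∈ e.baseSet, ∀ u v w : TangentSpace I y,
      form y ![u, v, w] = stdForm (e ⟨y, u⟩).2 (e ⟨y, v⟩).2 (e ⟨y, w⟩).2

variable {I} {Y}

namespace G2Structure

variable (φ : G2Structure I Y)

/-- A local trivialisation of the tangent bundle is adapted when it is linear and carries `φ` to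
the standard form. -/
def IsAdapted (e : Trivialization E7 (TotalSpace.proj : TangentBundle I Y → Y)) : Prop :=
  e.IsLinear ℝ ∧ ∀ y ∈ e.baseSet, ∀ u v w : TangentSpace I y,
      φ.form y ![u, v, w] = stdForm (e ⟨y, u⟩).2 (e ⟨y, v⟩).2 (e ⟨y, w⟩).2

theorem exists_coframe (x : Y) : ∃ f : TangentSpace I x ≃ₗ[ℝ] E7,
    ∀ u v w, φ.form x ![u, v, w] = stdForm (f u) (f v) (f w) := by
  obtain ⟨e, he, hx, h⟩ := φ.exists_adapted x
  exact ⟨e.linearEquivAt ℝ x hx, fun u v w => h x hx u v w⟩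

/-- An identification of `T_x Y` with `ℝ⁷` that carries `φ_x` to `φ₀`. -/
def coframe (x : Y) : TangentSpace I x ≃ₗ[ℝ] E7 := (φ.exists_coframe x).choose

theorem coframe_spec (x : Y) (u v w : TangentSpace I x) :
    φ.form x ![u, v, w] = stdForm (φ.coframe x u) (φ.coframe x v) (φ.coframe x w) :=
  (φ.exists_coframe x).choose_spec u v w

/-- The metric `g_φ`, for which adapted frames are orthonormal. It depends on `φ` alone, not on the
adapted frame, because the linear maps that preserve `φ₀` are orthogonal. -/
def metric (x : Y) (u v : TangentSpace I x) : ℝ := inner ℝ (φ.coframe x u) (φ.coframe x v)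

/-- The cross product `×_φ`, determined by `g_φ(u × v, w) = φ(u, v, w)`. -/
def cross {x : Y} (u v : TangentSpace I x) : TangentSpace I x :=
  (φ.coframe x).symm (stdCross (φ.coframe x u) (φ.coframe x v))

theorem metric_cross (x : Y) (u v w : TangentSpace I x) :
    φ.metric x (φ.cross u v) w = φ.form x ![u, v, w] := by
  simp [metric, cross, inner_stdCross, coframe_spec]

/-- The total space of the bundle `𝒱₂(TY)`: a point of `Y` with an orthonormal pair of tangent
vectors at that point. -/
structure Stiefel where
  pt : Y
  fst : TangentSpace I pt
  snd : TangentSpace I pt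
  fst_unit : φ.metric pt fst fst = 1
  snd_unit : φ.metric pt snd snd = 1
  orth : φ.metric pt fst snd = 0

/-- `𝒱₂(TY)` is topologised as a subspace of `TY × TY`. -/
instance : TopologicalSpace φ.Stiefel :=
  TopologicalSpace.induced
    (fun q => ((⟨q.pt, q.fst⟩ : TangentBundle I Y), (⟨q.pt, q.snd⟩ : TangentBundle I Y)))
    inferInstance

/-- The three-frame `(R¹, R², R¹ ×_φ R²)` of an orthonormal pair. -/
def Stiefel.frame {φ : G2Structure I Y} (q : φ.Stiefel) : Fin 3 → TangentSpace I q.pt :=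
  ![q.fst, q.snd, φ.cross q.fst q.snd]

/-- The total space of the bundle `𝒢(φ)`: a point of `Y` with an associative three-plane in the
tangent space at that point. -/
structure Assoc where
  pt : Y
  plane : Submodule ℝ (TangentSpace I pt)
  finrank_eq : Module.finrank ℝ plane = 3
  cross_mem : ∀ u ∈ plane, ∀ v ∈ plane, φ.cross u v ∈ plane

theorem span_frame {φ : G2Structure I Y} (q : φ.Stiefel) :
    Submodule.span ℝ (Set.range q.frame) =
      (Submodule.span ℝ {φ.coframe q.pt q.fst, φ.coframe q.pt q.snd,
        stdCross (φ.coframe q.pt q.fst) (φ.coframe q.pt q.snd)}).map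
        ((φ.coframe q.pt).symm : E7 →ₗ[ℝ] TangentSpace I q.pt) := by
  rw [Submodule.map_span]
  congr 1
  rw [Stiefel.frame, Matrix.range_cons, Matrix.range_cons, Matrix.range_cons, Matrix.range_empty,
    Set.union_empty, Set.singleton_union, Set.singleton_union, Set.image_insert_eq,
    Set.image_insert_eq, Set.image_singleton]
  simp [cross]

/-- The fibrewise span `𝒱₂(TY) → 𝒢(φ)`. -/
def Stiefel.span {φ : G2Structure I Y} (q : φ.Stiefel) : φ.Assoc where
  pt := q.pt
  plane := Submodule.span ℝ (Set.range q.frame)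
  finrank_eq := by
    rw [span_frame, LinearEquiv.finrank_map_eq]
    exact (stdSpan_assoc _ _ q.fst_unit q.snd_unit q.orth).1
  cross_mem := by
    rw [span_frame]
    rintro _ ⟨a, ha, rfl⟩ _ ⟨b, hb, rfl⟩
    refine ⟨stdCross a b, (stdSpan_assoc _ _ q.fst_unit q.snd_unit q.orth).2 a ha b hb, ?_⟩
    simp [cross]

/-- `𝒢(φ)` carries the quotient topology of `𝒱₂(TY)` under the fibrewise span. -/
instance : TopologicalSpace φ.Assoc :=
  TopologicalSpace.coinduced Stiefel.span inferInstance

/-- The space `Γ(Y, 𝒱₂(TY))` of continuous sections with the compact-open topology. -/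
abbrev StiefelSection : Type _ := {s : C(Y, φ.Stiefel) // ∀ x, (s x).pt = x}

/-- The space `Γ(Y, 𝒢(φ))` of continuous sections with the compact-open topology. -/
abbrev AssocSection : Type _ := {s : C(Y, φ.Assoc) // ∀ x, (s x).pt = x}

/-- The vector fields `R¹, R², R³ = R¹ ×_φ R²` of a section of `𝒱₂(TY)`. -/
def frameField {φ : G2Structure I Y} (s : φ.StiefelSection) (α : Fin 3) (x : Y) :
    TangentSpace I x :=
  s.2 x ▸ (s.1 x).frame α

/-- The rank three subbundle of `TY` given by a section of `𝒢(φ)` is trivial: there are three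
continuous vector fields that span it (hence are a basis of it) at every point. -/
def IsTrivialBundle {φ : G2Structure I Y} (s : φ.AssocSection) : Prop :=
  ∃ X : Fin 3 → ∀ x : Y, TangentSpace I x,
    (∀ i, Continuous fun x => (⟨x, X i x⟩ : TangentBundle I Y)) ∧
    ∀ x, Submodule.span ℝ (Set.range fun i => X i (s.1 x).pt) = (s.1 x).plane

/-- The space of trivial associative rank three subbundles of `TY`. -/
abbrev TrivialSection : Type _ := {s : φ.AssocSection // IsTrivialBundle s}

/-- An almost contact metric three-structure `(J^α, R^α, σ^α)`, `α = 1, 2, 3` (here `0, 1, 2`), on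
`(Y, g_φ)` that is compatible with `φ`: the first two almost contact structures are the ones that
`φ` induces on the unit vector fields `R¹, R²`, namely `J^α u = R^α ×_φ u`. The index triples
`(α, α + 1, α + 2)` in `Fin 3` are the cyclic permutations of `(0, 1, 2)`. (The three structures are
automatically distinct, as `σ^α(R^β) = 0` for `α ≠ β`.) -/
@[ext]
structure ACM3S where
  J : Fin 3 → ∀ x : Y, TangentSpace I x →ₗ[ℝ] TangentSpace I x
  R : Fin 3 → ∀ x : Y, TangentSpace I x
  σ : Fin 3 → ∀ x : Y, TangentSpace I x →ₗ[ℝ] ℝ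
  continuous_J : ∀ α, Continuous fun p : TangentBundle I Y =>
    (⟨p.proj, J α p.proj p.snd⟩ : TangentBundle I Y)
  continuous_R : ∀ α, Continuous fun x => (⟨x, R α x⟩ : TangentBundle I Y)
  continuous_σ : ∀ α, Continuous fun p : TangentBundle I Y => σ α p.proj p.snd
  J_J : ∀ α x u, J α x (J α x u) = -u + σ α x u • R α x
  σ_R_self : ∀ α x, σ α x (R α x) = 1
  R_unit : ∀ α x, φ.metric x (R α x) (R α x) = 1
  metric_J : ∀ α x u v,
    φ.metric x (J α x u) (J α x v) = φ.metric x u v - σ α x u * σ α x v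
  J_mul : ∀ α x u, J (α + 2) x u = J α x (J (α + 1) x u) - σ (α + 1) x u • R α x
  J_mul' : ∀ α x u, J (α + 2) x u = -J (α + 1) x (J α x u) + σ α x u • R (α + 1) x
  R_eq : ∀ α x, R (α + 2) x = J α x (R (α + 1) x)
  R_eq' : ∀ α x, R (α + 2) x = -J (α + 1) x (R α x)
  σ_eq : ∀ α x u, σ (α + 2) x u = σ α x (J (α + 1) x u)
  σ_eq' : ∀ α x u, σ (α + 2) x u = -σ (α + 1) x (J α x u)
  σ_R : ∀ α x, σ α x (R (α + 1) x) = 0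
  σ_R' : ∀ α x, σ (α + 1) x (R α x) = 0
  compatible₀ : ∀ x u, J 0 x u = φ.cross (R 0 x) u
  compatible₁ : ∀ x u, J 1 x u = φ.cross (R 1 x) u

end G2Structure

end Manifold

end

/-!
The theorem rests on the algebra of the cross product of `ℝ⁷` and on one gluing construction.

*Algebra.* The basic identity is `u × (u × v) = ⟨u, v⟩ u - |u|² v`. A linear map `A` that preserves
`φ₀` is orthogonal (`inner_map_of_map_stdForm`): the cross product of the metric pulled back by `A`
is `(AᵀA)⁻¹ (u × v)`, so the eigenvalues `l, m` of `AᵀA` at orthonormal eigenvectors `u, v` yield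
the eigenvalue `(l m)⁻¹` at `u × v`, and comparing enough products makes all eigenvalues equal to
one. Hence `G₂` is compact and preserves `×`, and metric and cross product of a `G₂` structure do
not depend on the choice of adapted coframes. An orthonormal triple `u, v, x` with `x ⊥ u × v`
generates a frame with the multiplication table of the standard basis
(`ofFrame_adaptedFrame_stdCross`), so that `G₂` acts simply transitively on such triples
(`G2.exists_toLin_eq`, `G2.ext_of_stdBasis`). Transitivity on `V₂(ℝ⁷)` and `G(φ₀)` follows, and
orbit maps of a compact group are quotient maps. The stabiliser of a pair is identified with
`SU(2)` by the image of a third vector `x`, and the stabiliser of an associative plane with `SO(4)`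
by its action on the orthogonal complement; that action has determinant one since the Pfaffian of
`φ₀(t, ·, ·)` on the complement is `|t|²` (`stdForm_pfaffian`).

*Structures and pairs.* For `R¹, R²` orthonormal, the identities of an almost contact metric
3-structure are `G₂`-invariant, so that they need only be checked for `(e₀, e₁)`
(`StdStiefel.induction_basePair`); conversely the metric identity makes `σ^α` dual to `R^α`, and
everything is determined by `R¹, R²`.

*Fibration.* The fibres of the span `𝒱₂(TY) → 𝒢(φ)` are free orbits of `SO(3)`. A partition of
unity glues the matrices of inner products of two frames, in adapted trivialisations, to a
continuous matrix `M(q, q')` for orthonormal pairs over any two points of `Y`. It is equivariant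
for the rotations of `q` and `q'`, and a positive multiple of `1` if `q = q'` (`exists_gram`).
Where `M(q, q')` has positive determinant, its Gram–Schmidt rotation moves `q'` within its plane to
a frame that depends continuously on `q`, `q'` and equals `q` if `q = q'`. This transports frames
from a plane to all nearby planes, at the same or at other points (`exists_transport`), and in
small steps it lifts homotopies (`exists_lift_of_transport`). Lifting along a path of sections
shows that triviality is constant on path components. A section near `s` over a compact set `K` is
lifted after composition with a map `f : Y → K` by transport from a frame of `s`, and then along
the homotopy from `f` to the identity; this is a local section of `p` (`exists_local_section`),
which the action of `Maps(Y, SO(3))` turns into a local trivialisation (`exists_trivialization`).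
-/

noncomputable section

/-! ### The cross product on `ℝ⁷` -/

theorem stdCross_add_left (a b c : E7) : stdCross (a + b) c = stdCross a c + stdCross b c :=
  LinearMap.map_add₂ stdCrossₗ a b c

theorem stdCross_add_right (a b c : E7) : stdCross a (b + c) = stdCross a b + stdCross a c :=
  map_add (stdCrossₗ a) b c

theorem stdCross_smul_left (r : ℝ) (a b : E7) : stdCross (r • a) b = r • stdCross a b :=
  LinearMap.map_smul₂ stdCrossₗ r a b

theorem stdCross_smul_right (r : ℝ) (a b : E7) : stdCross a (r • b) = r • stdCross a b :=
  map_smul (stdCrossₗ a) r b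

theorem stdCross_neg_left (a b : E7) : stdCross (-a) b = -stdCross a b :=
  LinearMap.map_neg₂ stdCrossₗ a b

theorem stdCross_neg_right (a b : E7) : stdCross a (-b) = -stdCross a b :=
  map_neg (stdCrossₗ a) b

theorem stdCross_zero_left (a : E7) : stdCross 0 a = 0 := LinearMap.map_zero₂ stdCrossₗ a

theorem stdCross_self (a : E7) : stdCross a a = 0 := by
  ext k; simp [stdCross, stdForm_self]

theorem inner_stdCross_left (u v : E7) : inner ℝ u (stdCross u v) = 0 := by
  rw [real_inner_comm, inner_stdCross, stdForm_cyc, stdForm_cyc, stdForm_self]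

theorem inner_stdCross_right (u v : E7) : inner ℝ v (stdCross u v) = 0 := by
  rw [real_inner_comm, inner_stdCross, stdForm_cyc, stdForm_self]

/-- The polarised form of the identity `u × (u × v) = ⟨u, v⟩ u - |u|² v`. -/
theorem stdCross_stdCross_add (u v w : E7) :
    stdCross u (stdCross v w) + stdCross v (stdCross u w) =
      (inner ℝ v w : ℝ) • u + (inner ℝ u w : ℝ) • v - (2 * inner ℝ u v : ℝ) • w := by
  have h := stdCross_stdCross (u + v) w
  rw [stdCross_add_left u v w, stdCross_add_right, stdCross_add_left, stdCross_add_left,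
    stdCross_stdCross u w, stdCross_stdCross v w, inner_add_left, inner_add_left, inner_add_right,
    inner_add_right, real_inner_comm u v] at h
  have := sub_eq_zero.mpr h
  rw [← sub_eq_zero, ← this]
  module

theorem inner_stdCross_stdCross (u v w : E7) :
    inner ℝ (stdCross u v) (stdCross u w) =
      (inner ℝ u u : ℝ) * inner ℝ v w - inner ℝ u v * inner ℝ u w := by
  rw [inner_stdCross, stdForm_cyc, stdForm_cyc, stdForm_swap, ← inner_stdCross, stdCross_stdCross,
    inner_sub_left, inner_smul_left, inner_smul_left]
  rw [conj_trivial, conj_trivial, real_inner_comm v w]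
  ring

/-- For an orthogonal triple, `u ×` anticommutes with `v ×` on the third vector. -/
theorem stdCross_anticomm {u v x : E7} (huv : inner ℝ u v = 0) (hux : inner ℝ u x = 0)
    (hvx : inner ℝ v x = 0) :
    stdCross u (stdCross v x) = -stdCross v (stdCross u x) := by
  have := stdCross_stdCross_add u v x
  rw [huv, hux, hvx] at this
  simpa [add_eq_zero_iff_eq_neg] using this

/-- For an orthogonal triple, `u × (v × x) = -(u × v) × x`. -/
theorem stdCross_assoc_neg {u v x : E7} (huv : inner ℝ u v = 0) (hux : inner ℝ u x = 0)
    (hvx : inner ℝ v x = 0) :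
    stdCross u (stdCross v x) = -stdCross (stdCross u v) x := by
  rw [stdCross_swap x (stdCross u v), neg_neg, stdCross_anticomm (u := x) (by rwa [real_inner_comm])
    (by rwa [real_inner_comm]) huv, stdCross_swap v x, stdCross_neg_right, neg_neg]

/-! ### Linear maps that preserve the cross product -/

/-- A nonzero linear map that preserves the cross product is injective, since the square of the
cross product map recovers the metric. -/
theorem injective_of_map_stdCross {F : E7 →ₗ[ℝ] E7} (hF : ∀ a b, F (stdCross a b) =
    stdCross (F a) (F b)) (h0 : F ≠ 0) : Function.Injective F := by
  rw [← LinearMap.ker_eq_bot, LinearMap.ker_eq_bot']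
  intro a ha
  by_contra hne
  apply h0
  ext1 b
  have h1 : F (stdCross a (stdCross a b)) = 0 := by rw [hF, ha, stdCross_zero_left]
  rw [stdCross_stdCross, map_sub, map_smul, map_smul, ha, smul_zero, zero_sub, neg_eq_zero,
    smul_eq_zero] at h1
  exact h1.resolve_left (by simpa using hne)

theorem exists_ne_zero_inner_eq_zero {a : E7} (ha : a ≠ 0) :
    ∃ b : E7, b ≠ 0 ∧ inner ℝ a b = (0 : ℝ) := by
  have : (ℝ ∙ a)ᗮ ≠ ⊥ := by
    intro h
    have h2 := Submodule.finrank_add_finrank_orthogonal (ℝ ∙ a)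
    rw [h, finrank_bot, finrank_span_singleton ha] at h2
    simp at h2
  obtain ⟨b, hb, hb0⟩ := Submodule.exists_mem_ne_zero_of_ne_bot this
  exact ⟨b, hb0, Submodule.mem_orthogonal_singleton_iff_inner_right.mp hb⟩

/-- A nonzero linear map that preserves the cross product is an isometry: apply it to
`a × (a × b) = -|a|² b` for some nonzero `b ⊥ a`. -/
theorem inner_self_of_map_stdCross {F : E7 →ₗ[ℝ] E7} (hF : ∀ a b, F (stdCross a b) =
    stdCross (F a) (F b)) (h0 : F ≠ 0) (a : E7) : inner ℝ (F a) (F a) = inner ℝ a a := by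
  by_cases ha : a = 0
  · simp [ha]
  have hinj := injective_of_map_stdCross hF h0
  obtain ⟨b, hb, hab⟩ := exists_ne_zero_inner_eq_zero ha
  have h1 := hF a (stdCross a b)
  rw [hF a b, stdCross_stdCross, stdCross_stdCross, map_sub, map_smul, map_smul, hab] at h1
  have h2 : F ((inner ℝ (F a) (F b) : ℝ) • a
      + (inner ℝ a a - inner ℝ (F a) (F a) : ℝ) • b) = 0 := by
    rw [map_add, map_smul, map_smul, sub_smul]
    rw [zero_smul, zero_sub] at h1
    rw [add_sub_left_comm, ← sub_neg_eq_add, ← h1]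
    abel
  have h3 := (map_eq_zero_iff F hinj).mp h2
  have h4 := congrArg (inner ℝ b) h3
  rw [inner_add_right, inner_smul_right, inner_smul_right, real_inner_comm a b, hab, mul_zero,
    zero_add, inner_zero_right, mul_eq_zero] at h4
  have := h4.resolve_right (by simpa using hb)
  linarith

/-- Polarisation. -/
theorem inner_map_of_inner_self {F : E7 →ₗ[ℝ] E7}
    (h : ∀ a, (inner ℝ (F a) (F a) : ℝ) = inner ℝ a a) (a b : E7) :
    (inner ℝ (F a) (F b) : ℝ) = inner ℝ a b := by
  have h1 := h (a + b)
  rw [map_add, inner_add_left, inner_add_left, inner_add_right, inner_add_right, inner_add_right,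
    inner_add_right, h, h, real_inner_comm (F a) (F b), real_inner_comm a b] at h1
  linarith

theorem stdForm_map_of_map_stdCross {F : E7 →ₗ[ℝ] E7} (hF : ∀ a b, F (stdCross a b) =
    stdCross (F a) (F b)) (h0 : F ≠ 0) (a b c : E7) :
    stdForm (F a) (F b) (F c) = stdForm a b c := by
  rw [← inner_stdCross, ← hF, inner_map_of_inner_self (inner_self_of_map_stdCross hF h0),
    inner_stdCross]

/-! ### Linear maps that preserve `φ₀` are orthogonal -/

/-- The three-form `φ₀` is nondegenerate. -/
theorem eq_zero_of_forall_stdForm {u : E7} (h : ∀ v w, stdForm u v w = 0) : u = 0 := by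
  by_contra hu
  obtain ⟨b, hb, hab⟩ := exists_ne_zero_inner_eq_zero hu
  have h1 := inner_stdCross_stdCross u b b
  rw [inner_stdCross, h, hab] at h1
  simp at h1
  tauto

theorem injective_of_map_stdForm {A : E7 →ₗ[ℝ] E7}
    (hA : ∀ u v w, stdForm (A u) (A v) (A w) = stdForm u v w) : Function.Injective A := by
  rw [← LinearMap.ker_eq_bot, LinearMap.ker_eq_bot']
  intro u hu
  refine eq_zero_of_forall_stdForm fun v w => ?_
  rw [← hA, hu, ← inner_stdCross, stdCross_zero_left, inner_zero_left]

/-- A symmetric operator has a unit eigenvector in the orthogonal complement of any proper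
invariant subspace. -/
theorem LinearMap.IsSymmetric.exists_eigenvector_orthogonal {S : E7 →ₗ[ℝ] E7}
    (hS : S.IsSymmetric) (U : Submodule ℝ E7) (hU : ∀ u ∈ U, S u ∈ U) (hne : U ≠ ⊤) :
    ∃ x ∈ Uᗮ, inner ℝ x x = (1 : ℝ) ∧ ∃ c : ℝ, S x = c • x := by
  have hinv : ∀ v ∈ Uᗮ, S v ∈ Uᗮ := by
    intro v hv u hu
    rw [← hS]
    exact hv _ (hU u hu)
  have : Nontrivial Uᗮ := by
    rw [Submodule.nontrivial_iff_ne_bot, Ne, Submodule.orthogonal_eq_bot_iff]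
    exact hne
  have heig := (hS.restrict_invariant hinv).hasEigenvalue_iSup_of_finiteDimensional
  obtain ⟨x, hx⟩ := heig.exists_hasEigenvector
  set c : ℝ := _
  have hSx : S x = (c : ℝ) • (x : E7) := congrArg Subtype.val hx.apply_eq_smul
  have hx0 : (x : E7) ≠ 0 := fun h => hx.2 (Subtype.ext h)
  refine ⟨‖(x : E7)‖⁻¹ • (x : E7), Uᗮ.smul_mem _ x.2, ?_, c, ?_⟩
  · rw [real_inner_self_eq_norm_sq, norm_smul, norm_inv, norm_norm,
      inv_mul_cancel₀ (norm_ne_zero_iff.mpr hx0), one_pow]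
  · rw [map_smul, hSx, smul_comm]

/-- If `A` preserves `φ₀` and `u`, `v` are orthonormal eigenvectors of `AᵀA` with eigenvalues `l`,
`m`, then `u × v` is an eigenvector with eigenvalue `(l m)⁻¹`: the cross product of the pulled back
metric is `(AᵀA)⁻¹ (u × v)`, and it satisfies the same quadratic identity. -/
theorem adjoint_comp_self_stdCross {A : E7 →ₗ[ℝ] E7}
    (hA : ∀ u v w, stdForm (A u) (A v) (A w) = stdForm u v w) {u v : E7} {l m : ℝ}
    (hu : inner ℝ u u = (1 : ℝ)) (huv : inner ℝ u v = (0 : ℝ))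
    (hSu : (LinearMap.adjoint A ∘ₗ A) u = l • u) (hSv : (LinearMap.adjoint A ∘ₗ A) v = m • v) :
    (l * m) • (LinearMap.adjoint A ∘ₗ A) (stdCross u v) = stdCross u v := by
  set S := LinearMap.adjoint A ∘ₗ A with hS
  have hinj := injective_of_map_stdForm hA
  have hsurj : Function.Surjective A := LinearMap.injective_iff_surjective.mp hinj
  have hSi : ∀ a b, (inner ℝ (S a) b : ℝ) = inner ℝ (A a) (A b) := fun a b => by
    rw [hS, LinearMap.comp_apply, LinearMap.adjoint_inner_left]
  -- the preimage `c` of `A a × A b` is the cross product of `a` and `b` for the pulled back metric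
  have hc : ∀ a b, ∃ c, A c = stdCross (A a) (A b) ∧ S c = stdCross a b := by
    intro a b
    obtain ⟨c, hc⟩ := hsurj (stdCross (A a) (A b))
    refine ⟨c, hc, ext_inner_right ℝ fun w => ?_⟩
    rw [hSi, hc, inner_stdCross, hA, inner_stdCross]
  obtain ⟨z, hz, hSz⟩ := hc u v
  obtain ⟨y, hy, hSy⟩ := hc u z
  have h1 : y = -(l • v) := by
    apply hinj
    rw [hy, hz, stdCross_stdCross, ← hSi, ← hSi, hSu, inner_smul_left, inner_smul_left, hu, huv]
    simp
  rw [h1, map_neg, map_smul, hSv, smul_smul] at hSy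
  have hl : l ≠ 0 := by
    rintro rfl
    have h2 : (inner ℝ (S u) u : ℝ) = 0 := by rw [hSu]; simp
    rw [hSi, inner_self_eq_zero, map_eq_zero_iff A hinj] at h2
    simp [h2] at hu
  have huz : (inner ℝ u z : ℝ) = 0 := by
    have h2 : (inner ℝ (S u) z : ℝ) = inner ℝ u (S z) := by
      rw [hSi, real_inner_comm (S z) u, hSi, real_inner_comm]
    rw [hSu, hSz, inner_smul_left, inner_stdCross_left] at h2
    simpa [hl] using h2
  have h3 := stdCross_stdCross u z
  rw [huz, hu, ← hSy, stdCross_neg_right, stdCross_smul_right, zero_smul, one_smul, zero_sub,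
    neg_inj] at h3
  rw [← map_smul, h3, hSz]

/-- Every eigenvalue of `AᵀA` is `1` when `A` preserves `φ₀`. A unit eigenvector `u` is completed
to orthonormal eigenvectors `u, v, u × v, x` with eigenvalues `l, m, (l m)⁻¹, r`. Then `(u × v) ×
x` is an eigenvector, and so are `v × x` and `u × x`; computing these eigenvalues in several ways
forces `l = m = r` and `l⁶ = 1`. -/
theorem eigenvalue_adjoint_comp_self {A : E7 →ₗ[ℝ] E7}
    (hA : ∀ u v w, stdForm (A u) (A v) (A w) = stdForm u v w) {u : E7} {l : ℝ}
    (hu : inner ℝ u u = (1 : ℝ)) (hSu : (LinearMap.adjoint A ∘ₗ A) u = l • u) : l = 1 := by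
  have hsym : (LinearMap.adjoint A ∘ₗ A).IsSymmetric := fun a b => by
    rw [LinearMap.comp_apply, LinearMap.adjoint_inner_left, LinearMap.comp_apply,
      LinearMap.adjoint_inner_right]
  have hprod {u v : E7} {l m : ℝ} :=
    adjoint_comp_self_stdCross hA (u := u) (v := v) (l := l) (m := m)
  set S := LinearMap.adjoint A ∘ₗ A with hS
  have hinj := injective_of_map_stdForm hA
  have hpos : ∀ {u : E7} {l : ℝ}, inner ℝ u u = (1 : ℝ) → S u = l • u → 0 < l := by
    intro u l hu hSu
    have h1 : (inner ℝ (S u) u : ℝ) = inner ℝ (A u) (A u) := by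
      rw [hS, LinearMap.comp_apply, LinearMap.adjoint_inner_left]
    rw [hSu, inner_smul_left, hu] at h1
    have h2 : A u ≠ 0 := by
      rw [Ne, map_eq_zero_iff A hinj]
      rintro rfl
      simp at hu
    have := real_inner_self_pos.mpr h2
    simp at h1
    linarith [real_inner_self_eq_norm_sq (A u)]
  have hval : ∀ {u : E7} {l c : ℝ}, inner ℝ u u = (1 : ℝ) → S u = l • u → c • S u = u →
      c * l = 1 := by
    intro u l c hu hSu h
    rw [hSu, smul_smul] at h
    have h2 := congrArg (fun x => (inner ℝ x u : ℝ)) h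
    simpa [-inner_self_eq_norm_sq_to_K, inner_smul_left, hu] using h2
  have hne : ∀ l : List E7, l.length < 7 → Submodule.span ℝ {x | x ∈ l} ≠ ⊤ := by
    intro l hl h
    have h1 := finrank_span_finset_le_card (R := ℝ) l.toFinset
    rw [List.coe_toFinset, Set.finrank, h, finrank_top] at h1
    have h2 := l.toFinset_card_le
    simp at h1
    omega
  obtain ⟨v, hv, hvv, m, hSv⟩ := hsym.exists_eigenvector_orthogonal (Submodule.span ℝ {x | x ∈ [u]})
    (by
      intro a ha
      simp only [List.mem_singleton, Set.ofPred_eq_eq_singleton, Submodule.mem_span_singleton] at ha ⊢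
      obtain ⟨r, rfl⟩ := ha
      exact ⟨r * l, by rw [map_smul, hSu, smul_smul]⟩) (hne _ (by simp))
  have huv : (inner ℝ u v : ℝ) = 0 := hv u (Submodule.subset_span (by simp))
  set w := stdCross u v with hw
  have hww : (inner ℝ w w : ℝ) = 1 := by rw [hw, inner_stdCross_stdCross, hu, hvv, huv]; simp
  have hlpos := hpos hu hSu
  have hmpos := hpos hvv hSv
  have hSw : S w = (l * m)⁻¹ • w := by
    rw [eq_inv_smul_iff₀ (by positivity), hprod hu huv hSu hSv]
  obtain ⟨x, hx, hxx, r, hSx⟩ := hsym.exists_eigenvector_orthogonal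
    (Submodule.span ℝ {x | x ∈ [u, v, w]})
    (by
      intro a ha
      induction ha using Submodule.span_induction with
      | mem y hy =>
        simp only [List.mem_cons, List.not_mem_nil, or_false, Set.mem_ofPred_eq] at hy
        rcases hy with rfl | rfl | rfl
        · rw [hSu]; exact Submodule.smul_mem _ _ (Submodule.subset_span (by simp))
        · rw [hSv]; exact Submodule.smul_mem _ _ (Submodule.subset_span (by simp))
        · rw [hSw]; exact Submodule.smul_mem _ _ (Submodule.subset_span (by simp))
      | zero => simp
      | add y z _ _ h1 h2 => rw [map_add]; exact Submodule.add_mem _ h1 h2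
      | smul c y _ h1 => rw [map_smul]; exact Submodule.smul_mem _ _ h1) (hne _ (by simp))
  have hux : (inner ℝ u x : ℝ) = 0 := hx u (Submodule.subset_span (by simp))
  have hvx : (inner ℝ v x : ℝ) = 0 := hx v (Submodule.subset_span (by simp))
  have hwx : (inner ℝ w x : ℝ) = 0 := hx w (Submodule.subset_span (by simp))
  have hrpos := hpos hxx hSx
  have hSv' : S (stdCross v x) = (m * r)⁻¹ • stdCross v x := by
    rw [eq_inv_smul_iff₀ (by positivity), hprod hvv hvx hSv hSx]
  have hSu' : S (stdCross u x) = (l * r)⁻¹ • stdCross u x := by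
    rw [eq_inv_smul_iff₀ (by positivity), hprod hu hux hSu hSx]
  have hSw' : S (stdCross w x) = ((l * m)⁻¹ * r)⁻¹ • stdCross w x := by
    rw [eq_inv_smul_iff₀ (by positivity), hprod hww hwx hSw hSx]
  -- as `u × (v × x) = -w × x`, `v × (u × x) = w × x` and `w × (u × x) = -v × x`, the eigenvalues of
  -- `w × x` and `v × x` can be computed in more than one way, and the results must agree
  have hwxu : stdCross u (stdCross v x) = -stdCross w x := stdCross_assoc_neg huv hux hvx
  have hwxv : stdCross v (stdCross u x) = stdCross w x := by
    rw [stdCross_anticomm (by rwa [real_inner_comm]) hvx hux, hwxu, neg_neg]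
  have hunit : (inner ℝ (stdCross w x) (stdCross w x) : ℝ) = 1 := by
    rw [inner_stdCross_stdCross, hww, hxx, hwx]; simp
  have hperp : ∀ {a b : E7}, (inner ℝ (stdCross a b) x : ℝ) = 0 →
      (inner ℝ a (stdCross b x) : ℝ) = 0 := by
    intro a b h
    rwa [real_inner_comm, inner_stdCross, stdForm_cyc, stdForm_cyc, ← inner_stdCross]
  have hvu : (inner ℝ v u : ℝ) = 0 := by rwa [real_inner_comm]
  have hwu : (inner ℝ w u : ℝ) = 0 := by rw [real_inner_comm]; exact inner_stdCross_left u v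
  have e1 := hprod hu (hperp hwx) hSu hSv'
  have e2 := hprod hvv (hperp (by rw [stdCross_swap, inner_neg_left, ← hw, hwx, neg_zero])) hSv hSu'
  have hwux : stdCross w (stdCross u x) = -stdCross v x := by
    rw [stdCross_anticomm hwu hwx hux, ← neg_eq_iff_eq_neg.mpr hwxu.symm.symm, stdCross_neg_right,
      stdCross_stdCross, hu, hperp hwx]
    simp
  have e3 := hprod hww (hperp (by
    rw [stdCross_swap, hw, stdCross_stdCross, hu, huv]
    simp [hvx])) hSw hSu'
  rw [hwxu, map_neg, smul_neg, neg_inj] at e1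
  rw [hwxv] at e2
  rw [hwux, map_neg, smul_neg, neg_inj] at e3
  have hvx1 : (inner ℝ (stdCross v x) (stdCross v x) : ℝ) = 1 := by
    rw [inner_stdCross_stdCross, hvv, hxx, hvx]; simp
  have f1 := hval hunit hSw' e1
  have f2 := hval hunit hSw' e2
  have f3 := hval hvx1 hSv' e3
  field_simp at f1 f2 f3
  have g1 : l = r := (pow_left_inj₀ hlpos.le hrpos.le two_ne_zero).mp (by linarith)
  have g2 : m = r := (pow_left_inj₀ hmpos.le hrpos.le two_ne_zero).mp (by linarith)
  subst g1 g2
  have : m ^ 6 = 1 := by linarith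
  exact (pow_eq_one_iff_of_nonneg hlpos.le (by norm_num)).mp this

/-- A linear map that preserves `φ₀` preserves the metric. -/
theorem inner_map_of_map_stdForm {A : E7 →ₗ[ℝ] E7}
    (hA : ∀ u v w, stdForm (A u) (A v) (A w) = stdForm u v w) (a b : E7) :
    (inner ℝ (A a) (A b) : ℝ) = inner ℝ a b := by
  have hsym : (LinearMap.adjoint A ∘ₗ A).IsSymmetric := fun a b => by
    rw [LinearMap.comp_apply, LinearMap.adjoint_inner_left, LinearMap.comp_apply,
      LinearMap.adjoint_inner_right]
  have hn : Module.finrank ℝ E7 = 7 := finrank_euclideanSpace_fin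
  have h : LinearMap.adjoint A ∘ₗ A = LinearMap.id := by
    refine (hsym.eigenvectorBasis hn).toBasis.ext fun i => ?_
    have h1 := hsym.apply_eigenvectorBasis hn i
    have h2 := eigenvalue_adjoint_comp_self hA (by
      rw [real_inner_self_eq_norm_sq, (hsym.eigenvectorBasis hn).norm_eq_one]; norm_num) h1
    rw [h2] at h1
    simpa using h1
  rw [← LinearMap.adjoint_inner_left, ← LinearMap.comp_apply, h, LinearMap.id_apply]

/-- A linear map that preserves `φ₀` preserves the cross product. -/
theorem stdCross_map_of_map_stdForm {A : E7 →ₗ[ℝ] E7}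
    (hA : ∀ u v w, stdForm (A u) (A v) (A w) = stdForm u v w) (a b : E7) :
    A (stdCross a b) = stdCross (A a) (A b) := by
  refine ext_inner_right ℝ fun w => ?_
  obtain ⟨w, rfl⟩ := LinearMap.injective_iff_surjective.mp (injective_of_map_stdForm hA) w
  rw [inner_map_of_map_stdForm hA, inner_stdCross, inner_stdCross, hA]

/-! ### Adapted frames of `ℝ⁷` -/

/-- The standard basis vectors of `ℝ⁷`. -/
def stdBasis (i : Fin 7) : E7 := EuclideanSpace.single i 1

theorem E7.eq_sum (a : E7) : a = a 0 • stdBasis 0 + a 1 • stdBasis 1 + a 2 • stdBasis 2 +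
    a 3 • stdBasis 3 + a 4 • stdBasis 4 + a 5 • stdBasis 5 + a 6 • stdBasis 6 := by
  ext k; fin_cases k <;> simp [stdBasis]

/-- The linear map with prescribed values on the standard basis. -/
def ofFrame (f : Fin 7 → E7) : E7 →ₗ[ℝ] E7 where
  toFun a := a 0 • f 0 + a 1 • f 1 + a 2 • f 2 + a 3 • f 3 + a 4 • f 4 + a 5 • f 5 + a 6 • f 6
  map_add' a b := by simp only [PiLp.add_apply]; module
  map_smul' r a := by simp only [PiLp.smul_apply, smul_eq_mul, RingHom.id_apply]; module

theorem ofFrame_stdBasis (f : Fin 7 → E7) (i : Fin 7) : ofFrame f (stdBasis i) = f i := by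
  fin_cases i <;> simp [ofFrame, stdBasis]

/-- The adapted frame generated by an orthonormal triple `u, v, x` with `x ⊥ u × v`. It has the same
multiplication table as the standard basis, in which `e₂ × e₃ = e₆`, and so on. -/
def adaptedFrame (u v x : E7) : Fin 7 → E7 :=
  ![u, v, x, stdCross (stdCross u v) x, stdCross u x, -stdCross v x, stdCross u v]

theorem stdCross_ofFrame (f : Fin 7 → E7) (a b : E7) :
    stdCross (ofFrame f a) (ofFrame f b) = ∑ i, ∑ j, (a i * b j) • stdCross (f i) (f j) := by
  have h : ∀ c, ofFrame f c = ∑ i, c i • f i := fun c => by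
    simp only [Fin.sum_univ_seven]; rfl
  have h2 : ∀ x y, stdCross x y = stdCrossₗ x y := fun x y => rfl
  simp only [h, h2, map_sum, map_smul, LinearMap.sum_apply, LinearMap.smul_apply,
    Finset.smul_sum, smul_smul]
  rw [Finset.sum_comm]
  simp only [mul_comm]

/-- The adapted frame of an orthonormal triple defines a linear map that preserves the cross
product: its multiplication table, computed below from the identities of the cross product, is that
of the standard basis. -/
theorem ofFrame_adaptedFrame_stdCross {u v x : E7} (hu : inner ℝ u u = (1 : ℝ))
    (hv : inner ℝ v v = (1 : ℝ)) (hx : inner ℝ x x = (1 : ℝ)) (huv : inner ℝ u v = (0 : ℝ))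
    (hux : inner ℝ u x = (0 : ℝ)) (hvx : inner ℝ v x = (0 : ℝ))
    (hwx : inner ℝ (stdCross u v) x = (0 : ℝ)) (a b : E7) :
    ofFrame (adaptedFrame u v x) (stdCross a b) =
      stdCross (ofFrame (adaptedFrame u v x) a) (ofFrame (adaptedFrame u v x) b) := by
  set w := stdCross u v with hw
  have hww : (inner ℝ w w : ℝ) = 1 := by rw [hw, inner_stdCross_stdCross, hu, hv, huv]; simp
  have hvu : (inner ℝ v u : ℝ) = 0 := by rwa [real_inner_comm]
  have hwu : (inner ℝ w u : ℝ) = 0 := by rw [real_inner_comm]; exact inner_stdCross_left u v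
  have huw : (inner ℝ u w : ℝ) = 0 := inner_stdCross_left u v
  have hwv : (inner ℝ w v : ℝ) = 0 := by rw [real_inner_comm]; exact inner_stdCross_right u v
  have hvw : (inner ℝ v w : ℝ) = 0 := inner_stdCross_right u v
  -- the products of the imaginary quaternion units `u, v, w`
  have vu : stdCross v u = -w := stdCross_swap u v
  have uw : stdCross u w = -v := by rw [hw, stdCross_stdCross, hu, huv]; simp
  have wu : stdCross w u = v := by rw [stdCross_swap u w, uw, neg_neg]
  have wv : stdCross w v = -u := by
    rw [hw, stdCross_swap v, stdCross_swap v u, stdCross_neg_right, neg_neg, stdCross_stdCross, hv,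
      hvu]
    simp
  have vw : stdCross v w = u := by rw [stdCross_swap w v, wv, neg_neg]
  -- `c × (c × x) = -x` and `x × (c × x) = c` for each unit `c`
  have cc : ∀ {c : E7}, (inner ℝ c c : ℝ) = 1 → (inner ℝ c x : ℝ) = 0 →
      stdCross c (stdCross c x) = -x := by
    intro c h1 h2; rw [stdCross_stdCross, h1, h2]; simp
  have xc : ∀ {c : E7}, (inner ℝ c x : ℝ) = 0 → stdCross x (stdCross c x) = c := by
    intro c h
    rw [stdCross_swap x c, stdCross_neg_right, stdCross_stdCross, hx, real_inner_comm, h]; simp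
  -- the products `c × (d × x)` and `(c × x) × (d × x)` for distinct units `c, d`
  have cd : ∀ {c d : E7}, (inner ℝ c d : ℝ) = 0 → (inner ℝ c x : ℝ) = 0 → (inner ℝ d x : ℝ) = 0 →
      stdCross c (stdCross d x) = -stdCross (stdCross c d) x := stdCross_assoc_neg
  have perp : ∀ {a b : E7}, (inner ℝ (stdCross a b) x : ℝ) = 0 →
      (inner ℝ a (stdCross b x) : ℝ) = 0 := by
    intro a b h
    rwa [real_inner_comm, inner_stdCross, stdForm_cyc, stdForm_cyc, ← inner_stdCross]
  have cxdx : ∀ {c d : E7}, (inner ℝ c d : ℝ) = 0 → (inner ℝ c x : ℝ) = 0 → (inner ℝ d x : ℝ) = 0 →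
      (inner ℝ (stdCross c d) x : ℝ) = 0 →
      stdCross (stdCross c x) (stdCross d x) = -stdCross c d := by
    intro c d h1 h2 h3 h4
    have h5 : (inner ℝ x (stdCross d x) : ℝ) = 0 := inner_stdCross_right d x
    rw [← neg_eq_iff_eq_neg.mpr (stdCross_assoc_neg h2 (perp h4) h5), xc h3]
  have uvx := cd huv hux hvx
  have vux := cd hvu hvx hux
  have uwx := cd huw hux hwx
  have wux := cd hwu hwx hux
  have vwx := cd hvw hvx hwx
  have wvx := cd hwv hwx hvx
  have uxvx := cxdx huv hux hvx hwx
  have uxwx := cxdx huw hux hwx (by rw [uw, inner_neg_left, hvx, neg_zero])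
  have vxwx := cxdx hvw hvx hwx (by rw [vw, hux])
  rw [← hw] at uvx uxvx
  rw [vu, stdCross_neg_left, neg_neg] at vux
  rw [uw, stdCross_neg_left, neg_neg] at uwx
  rw [wu] at wux
  rw [vw] at vwx vxwx
  rw [wv, stdCross_neg_left, neg_neg] at wvx
  rw [uw, neg_neg] at uxwx
  have xu : stdCross x u = -stdCross u x := stdCross_swap u x
  have xv : stdCross x v = -stdCross v x := stdCross_swap v x
  have xw : stdCross x w = -stdCross w x := stdCross_swap w x
  have swap : ∀ {p q r : E7}, stdCross p q = r → stdCross q p = -r := fun {p q r} h => by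
    rw [stdCross_swap p q, h]
  rw [stdCross_ofFrame]
  simp only [Fin.sum_univ_seven, adaptedFrame, ofFrame, LinearMap.coe_mk, AddHom.coe_mk,
    stdCross_apply, Matrix.cons_val, stdCross_neg_left, stdCross_neg_right, stdCross_self, ← hw,
    vu, uw, wu, wv, vw, cc hu hux, cc hv hvx, cc hww hwx, xc hux, xc hvx, xc hwx, uvx, vux, uwx,
    wux, vwx, wvx, uxvx, uxwx, vxwx, xu, xv, xw, swap (cc hu hux), swap (cc hv hvx),
    swap (cc hww hwx), swap (xc hux), swap (xc hvx), swap (xc hwx), swap uvx, swap vux, swap uwx,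
    swap wux, swap vwx, swap wvx, swap uxvx, swap uxwx, swap vxwx]
  module

/-! ### Elements of `G₂` -/

namespace G2

theorem toLin_stdForm (A : G2) (u v w : E7) :
    stdForm (toLin A u) (toLin A v) (toLin A w) = stdForm u v w := A.2 u v w

theorem toLin_inner (A : G2) (u v : E7) : (inner ℝ (toLin A u) (toLin A v) : ℝ) = inner ℝ u v :=
  inner_map_of_map_stdForm (toLin_stdForm A) u v

theorem toLin_stdCross (A : G2) (u v : E7) :
    toLin A (stdCross u v) = stdCross (toLin A u) (toLin A v) :=
  stdCross_map_of_map_stdForm (toLin_stdForm A) u v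

theorem toLin_mul (A B : G2) (u : E7) : toLin (A * B) u = toLin A (toLin B u) := rfl

theorem toLin_one (u : E7) : toLin 1 u = u := rfl

theorem toLin_toLin_inv (A : G2) (u : E7) : toLin A (toLin A⁻¹ u) = u := by
  rw [← toLin_mul, mul_inv_cancel, toLin_one]

theorem toLin_inj {A B : G2} (h : ∀ u, toLin A u = toLin B u) : A = B :=
  Subtype.ext (Units.ext (ContinuousLinearMap.ext h))

/-- A linear map that preserves `φ₀` is an element of `G₂`. -/
def ofLin (F : E7 →ₗ[ℝ] E7) (hF : ∀ u v w, stdForm (F u) (F v) (F w) = stdForm u v w) : G2 :=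
  let e := (LinearEquiv.ofInjectiveEndo F (injective_of_map_stdForm hF)).toContinuousLinearEquiv
  ⟨ContinuousLinearEquiv.toUnit e, fun u v w => hF u v w⟩

theorem toLin_ofLin (F : E7 →ₗ[ℝ] E7) (hF : ∀ u v w, stdForm (F u) (F v) (F w) = stdForm u v w)
    (u : E7) : toLin (ofLin F hF) u = F u := rfl

/-- `G₂` acts transitively on the orthonormal triples `u, v, x` with `x ⊥ u × v`. -/
theorem exists_toLin_eq {u v x : E7} (hu : inner ℝ u u = (1 : ℝ))
    (hv : inner ℝ v v = (1 : ℝ)) (hx : inner ℝ x x = (1 : ℝ)) (huv : inner ℝ u v = (0 : ℝ))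
    (hux : inner ℝ u x = (0 : ℝ)) (hvx : inner ℝ v x = (0 : ℝ))
    (hwx : inner ℝ (stdCross u v) x = (0 : ℝ)) :
    ∃ A : G2, toLin A (stdBasis 0) = u ∧ toLin A (stdBasis 1) = v ∧ toLin A (stdBasis 2) = x := by
  have h := ofFrame_adaptedFrame_stdCross hu hv hx huv hux hvx hwx
  have h0 : ofFrame (adaptedFrame u v x) ≠ 0 := by
    intro h0
    have h1 := ofFrame_stdBasis (adaptedFrame u v x) 0
    rw [h0] at h1
    have h2 : u = 0 := h1.symm
    simp [h2] at hu
  refine ⟨ofLin _ (stdForm_map_of_map_stdCross h h0), ?_, ?_, ?_⟩ <;>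
    rw [toLin_ofLin, ofFrame_stdBasis] <;> rfl

theorem stdCross_stdBasis_zero_one : stdCross (stdBasis 0) (stdBasis 1) = stdBasis 6 := by
  ext k; rw [stdCross_apply]; fin_cases k <;> simp [stdBasis]

theorem stdCross_stdBasis_six_two : stdCross (stdBasis 6) (stdBasis 2) = stdBasis 3 := by
  ext k; rw [stdCross_apply]; fin_cases k <;> simp [stdBasis]

theorem stdCross_stdBasis_zero_two : stdCross (stdBasis 0) (stdBasis 2) = stdBasis 4 := by
  ext k; rw [stdCross_apply]; fin_cases k <;> simp [stdBasis]

theorem stdCross_stdBasis_one_two : stdCross (stdBasis 1) (stdBasis 2) = -stdBasis 5 := by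
  ext k; rw [stdCross_apply]; fin_cases k <;> simp [stdBasis]

/-- An element of `G₂` takes the standard basis to the adapted frame generated by the images of
`e₀, e₁, e₂`. -/
theorem toLin_eq_ofFrame (A : G2) (a : E7) : toLin A a =
    ofFrame (adaptedFrame (toLin A (stdBasis 0)) (toLin A (stdBasis 1)) (toLin A (stdBasis 2))) a := by
  conv_lhs => rw [E7.eq_sum a]
  simp only [map_add, map_smul, ofFrame, adaptedFrame, LinearMap.coe_mk, AddHom.coe_mk,
    Matrix.cons_val, ← toLin_stdCross, stdCross_stdBasis_zero_one, stdCross_stdBasis_zero_two,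
    stdCross_stdBasis_one_two, stdCross_stdBasis_six_two, map_neg, neg_neg]

/-- An element of `G₂` is determined by its values on `e₀, e₁, e₂`. -/
theorem ext_of_stdBasis {A B : G2} (h0 : toLin A (stdBasis 0) = toLin B (stdBasis 0))
    (h1 : toLin A (stdBasis 1) = toLin B (stdBasis 1))
    (h2 : toLin A (stdBasis 2) = toLin B (stdBasis 2)) : A = B :=
  toLin_inj fun u => by rw [toLin_eq_ofFrame, toLin_eq_ofFrame B, h0, h1, h2]

end G2

/-! ### `G₂` as a compact group and its orbits -/

theorem continuous_stdForm : Continuous fun p : E7 × E7 × E7 => stdForm p.1 p.2.1 p.2.2 := by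
  unfold stdForm e3
  fun_prop

theorem continuous_stdCross : Continuous fun p : E7 × E7 => stdCross p.1 p.2 := by
  unfold stdCross stdForm e3
  fun_prop

namespace G2

theorem isInducing_coe : Topology.IsInducing fun A : G2 => ((A : (E7 →L[ℝ] E7)ˣ) : E7 →L[ℝ] E7) :=
  Units.isOpenEmbedding_val.isInducing.comp Topology.IsInducing.subtypeVal

theorem continuous_toLin (u : E7) : Continuous fun A : G2 => toLin A u :=
  continuous_clm_apply.mp isInducing_coe.continuous u

/-- `G₂` is a closed and bounded set of linear maps, as it consists of isometries. -/
instance : CompactSpace G2 := by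
  rw [← isCompact_univ_iff, isInducing_coe.isCompact_iff, Set.image_univ]
  have hr : Set.range (fun A : G2 => ((A : (E7 →L[ℝ] E7)ˣ) : E7 →L[ℝ] E7)) =
      {F : E7 →L[ℝ] E7 | ∀ u v w, stdForm (F u) (F v) (F w) = stdForm u v w} := by
    ext F
    constructor
    · rintro ⟨A, rfl⟩
      exact A.2
    · intro hF
      exact ⟨ofLin F hF, ContinuousLinearMap.ext fun u => toLin_ofLin F hF u⟩
  rw [hr]
  refine (isCompact_closedBall (0 : E7 →L[ℝ] E7) 1).of_isClosed_subset ?_ ?_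
  · simp only [Set.ofPred_forall]
    refine isClosed_iInter fun u => isClosed_iInter fun v => isClosed_iInter fun w => ?_
    refine isClosed_eq (continuous_stdForm.comp (f := fun F : E7 →L[ℝ] E7 => (F u, F v, F w)) ?_)
      continuous_const
    fun_prop
  · intro F hF
    rw [mem_closedBall_zero_iff]
    refine F.opNorm_le_bound zero_le_one fun u => ?_
    have h := inner_map_of_map_stdForm (A := (F : E7 →ₗ[ℝ] E7)) hF u u
    rw [real_inner_self_eq_norm_sq, real_inner_self_eq_norm_sq] at h
    rw [one_mul]
    exact ((pow_left_inj₀ (norm_nonneg _) (norm_nonneg _) two_ne_zero).mp h).le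

end G2

theorem inner_stdBasis (i j : Fin 7) : (inner ℝ (stdBasis i) (stdBasis j) : ℝ) =
    if i = j then 1 else 0 := by
  rw [stdBasis, EuclideanSpace.inner_single_left]
  simp [stdBasis]

/-- The orthonormal pair `(e₀, e₁)`. -/
def basePair : StdStiefel :=
  ⟨(stdBasis 0, stdBasis 1), by rw [inner_stdBasis, if_pos rfl], by rw [inner_stdBasis, if_pos rfl],
    by rw [inner_stdBasis, if_neg (by decide)]⟩

namespace StdStiefel

/-- The image of an orthonormal pair under an element of `G₂`. -/
def map (A : G2) (p : StdStiefel) : StdStiefel :=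
  ⟨(G2.toLin A p.1.1, G2.toLin A p.1.2), by simpa only [G2.toLin_inner] using p.2⟩

/-- `G₂` acts transitively on orthonormal pairs: a pair is completed by a unit vector orthogonal to
its associative plane. -/
theorem exists_map_basePair (p : StdStiefel) : ∃ A, map A basePair = p := by
  obtain ⟨⟨u, v⟩, hu, hv, huv⟩ := p
  have hne : Submodule.span ℝ {u, v, stdCross u v} ≠ ⊤ := by
    intro h
    have h1 := (stdSpan_assoc u v hu hv huv).1
    rw [h, finrank_top] at h1
    simp at h1
  rw [Ne, ← Submodule.orthogonal_eq_bot_iff] at hne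
  obtain ⟨x, hx, hx0⟩ := Submodule.exists_mem_ne_zero_of_ne_bot hne
  have hn : ‖x‖ ≠ 0 := norm_ne_zero_iff.mpr hx0
  have h (y) (hy : y ∈ ({u, v, stdCross u v} : Set E7)) : (inner ℝ y (‖x‖⁻¹ • x) : ℝ) = 0 := by
    rw [inner_smul_right, hx y (Submodule.subset_span hy), mul_zero]
  obtain ⟨A, h0, h1, -⟩ := G2.exists_toLin_eq hu hv (x := ‖x‖⁻¹ • x)
    (by rw [real_inner_self_eq_norm_sq, norm_smul, norm_inv, norm_norm, inv_mul_cancel₀ hn, one_pow])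
    huv (h _ (by simp)) (h _ (by simp)) (h _ (by simp))
  exact ⟨A, Subtype.ext (Prod.ext h0 h1)⟩

theorem map_mul (A B : G2) (p : StdStiefel) : map (A * B) p = map A (map B p) := rfl

theorem map_one (p : StdStiefel) : map 1 p = p := rfl

theorem exists_map_eq (p q : StdStiefel) : ∃ A, map A p = q := by
  obtain ⟨A, hA⟩ := exists_map_basePair p
  obtain ⟨B, hB⟩ := exists_map_basePair q
  exact ⟨B * A⁻¹, by rw [map_mul, ← hA, ← map_mul A⁻¹, inv_mul_cancel, map_one, hB]⟩

theorem continuous_map (p : StdStiefel) : Continuous fun A => map A p :=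
  ((G2.continuous_toLin _).prodMk (G2.continuous_toLin _)).subtype_mk _

/-- The orbit map is a quotient map, since `G₂` is compact. -/
theorem isQuotientMap_map (p : StdStiefel) : Topology.IsQuotientMap fun A => map A p :=
  (continuous_map p).isClosedMap.isQuotientMap (continuous_map p) (exists_map_eq p)

theorem mem_stabPair {p : StdStiefel} {A : G2} : A ∈ stabPair p ↔ map A p = p := by
  rw [Subtype.ext_iff, Prod.ext_iff]; rfl

end StdStiefel

namespace StdAssoc

/-- The image of an associative plane under an element of `G₂`. -/
def map (A : G2) (T : StdAssoc) : StdAssoc :=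
  ⟨T.1.map (G2.toLin A), by
    constructor
    · exact (Submodule.equivMapOfInjective _ (injective_of_map_stdForm (G2.toLin_stdForm A))
        T.1).finrank_eq.symm.trans T.2.1
    · rintro _ ⟨u, hu, rfl⟩ _ ⟨v, hv, rfl⟩
      exact ⟨_, T.2.2 u hu v hv, G2.toLin_stdCross A u v⟩⟩

theorem map_mul (A B : G2) (T : StdAssoc) : map (A * B) T = map A (map B T) :=
  Subtype.ext (Submodule.map_comp (G2.toLin B) (G2.toLin A) T.1)

theorem map_one (T : StdAssoc) : map 1 T = T := Subtype.ext (Submodule.map_id T.1)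

theorem mem_stabPlane {T : StdAssoc} {A : G2} : A ∈ stabPlane T ↔ map A T = T :=
  ⟨fun h => Subtype.ext h, fun h => congrArg Subtype.val h⟩

theorem map_span (A : G2) (p : StdStiefel) : map A p.span = (p.map A).span := by
  refine Subtype.ext ?_
  change Submodule.map _ (Submodule.span ℝ _) = Submodule.span ℝ _
  rw [Submodule.map_span, Set.image_insert_eq, Set.image_insert_eq, Set.image_singleton,
    G2.toLin_stdCross]
  rfl

end StdAssoc

theorem StdAssoc.eq_of_le {T T' : StdAssoc} (h : T.1 ≤ T'.1) : T = T' :=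
  Subtype.ext (Submodule.eq_of_le_of_finrank_eq h (T.2.1.trans T'.2.1.symm))

/-- An associative plane is spanned by `u, v, u × v` for any orthonormal pair `u, v` in it. -/
theorem StdStiefel.span_surjective : Function.Surjective StdStiefel.span := by
  intro T
  let b := (stdOrthonormalBasis ℝ T.1).reindex (finCongr T.2.1)
  have hb : ∀ i j, (inner ℝ (b i : E7) (b j : E7) : ℝ) = if i = j then 1 else 0 := fun i j => by
    simpa using (orthonormal_iff_ite.mp b.orthonormal) i j
  refine ⟨⟨((b 0 : E7), (b 1 : E7)), ?_, ?_, ?_⟩, StdAssoc.eq_of_le ?_⟩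
  · rw [hb, if_pos rfl]
  · rw [hb, if_pos rfl]
  · rw [hb, if_neg (by decide)]
  · change Submodule.span ℝ _ ≤ _
    rw [Submodule.span_le]
    rintro x (rfl | rfl | rfl)
    · exact (b 0).2
    · exact (b 1).2
    · exact T.2.2 _ (b 0).2 _ (b 1).2

theorem StdStiefel.isQuotientMap_span : Topology.IsQuotientMap StdStiefel.span :=
  ⟨⟨rfl⟩, StdStiefel.span_surjective⟩

theorem StdAssoc.isQuotientMap_map (T : StdAssoc) : Topology.IsQuotientMap fun A => map A T := by
  obtain ⟨p, rfl⟩ := StdStiefel.span_surjective T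
  simp only [map_span]
  exact StdStiefel.isQuotientMap_span.comp (StdStiefel.isQuotientMap_map p)

/-- A quotient map from a group whose fibres are the left cosets of a subgroup induces a
homeomorphism from the space of cosets. -/
theorem exists_homeomorph_quotient {G Z : Type*} [Group G] [TopologicalSpace G] [TopologicalSpace Z]
    (K : Subgroup G) {f : G → Z} (hq : Topology.IsQuotientMap f)
    (hf : ∀ A B, f A = f B ↔ A⁻¹ * B ∈ K) : ∃ F : (G ⧸ K) ≃ₜ Z, ∀ A : G, F A = f A := by
  let g : G ⧸ K → Z := Quotient.lift f fun A B h => (hf A B).mpr (QuotientGroup.leftRel_apply.mp h)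
  have hg : Topology.IsQuotientMap g :=
    .of_comp QuotientGroup.continuous_mk (hq.continuous.quotient_lift _) hq
  have hinj : Function.Injective g := by
    intro a b
    induction a using QuotientGroup.induction_on
    induction b using QuotientGroup.induction_on
    intro h
    exact QuotientGroup.eq.mpr ((hf _ _).mp h)
  exact ⟨(isHomeomorph_iff_isQuotientMap_injective.mpr ⟨hg, hinj⟩).homeomorph, fun A => rfl⟩

/-- `V₂(ℝ⁷)` is a homogeneous space of `G₂`. -/
theorem stabPair_homeomorph (p : StdStiefel) : ∃ F : (G2 ⧸ stabPair p) ≃ₜ StdStiefel,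
    ∀ A : G2, F A = p.map A := by
  refine exists_homeomorph_quotient _ (StdStiefel.isQuotientMap_map p) fun A B => ?_
  rw [StdStiefel.mem_stabPair, StdStiefel.map_mul]
  constructor
  · intro h
    rw [← h, ← StdStiefel.map_mul, inv_mul_cancel, StdStiefel.map_one]
  · intro h
    rw [← congrArg (StdStiefel.map A) h, ← StdStiefel.map_mul, mul_inv_cancel, StdStiefel.map_one]

/-- `G(φ₀)` is a homogeneous space of `G₂`. -/
theorem stabPlane_homeomorph (T : StdAssoc) : ∃ F : (G2 ⧸ stabPlane T) ≃ₜ StdAssoc,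
    ∀ A : G2, F A = T.map A := by
  refine exists_homeomorph_quotient _ (StdAssoc.isQuotientMap_map T) fun A B => ?_
  rw [StdAssoc.mem_stabPlane, StdAssoc.map_mul]
  constructor
  · intro h
    rw [← h, ← StdAssoc.map_mul, inv_mul_cancel, StdAssoc.map_one]
  · intro h
    rw [← congrArg (StdAssoc.map A) h, ← StdAssoc.map_mul, mul_inv_cancel, StdAssoc.map_one]

/-! ### The stabilisers are `SU(2)` and `SO(4)` -/

/-- A continuous bijective homomorphism from a compact group to a Hausdorff group is an isomorphism
of topological groups. -/
theorem nonempty_continuousMulEquiv_of_bijective {G M : Type*} [Group G] [TopologicalSpace G]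
    [CompactSpace G] [Monoid M] [TopologicalSpace M] [T2Space M] (f : G → M)
    (hmul : ∀ a b, f (a * b) = f a * f b) (hf : Continuous f) (hb : Function.Bijective f) :
    Nonempty (G ≃ₜ* M) :=
  have hh : Continuous (Equiv.ofBijective f hb) := hf
  ⟨{ Equiv.ofBijective f hb with
      map_mul' := hmul
      continuous_toFun := hf
      continuous_invFun := hh.continuous_symm_of_equiv_compact_to_t2 }⟩

/-- Conjugation by `g` identifies two subgroups that it exchanges. -/
theorem nonempty_continuousMulEquiv_conj {G : Type*} [Group G] [TopologicalSpace G]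
    [IsTopologicalGroup G] {K L : Subgroup G} (g : G) (h : ∀ A, A ∈ K ↔ g⁻¹ * A * g ∈ L) :
    Nonempty (K ≃ₜ* L) :=
  ⟨{ toFun := fun A => ⟨g⁻¹ * A * g, (h A).mp A.2⟩
     invFun := fun B => ⟨g * B * g⁻¹, (h _).mpr (by simp [mul_assoc])⟩
     left_inv := fun A => Subtype.ext (by simp [mul_assoc])
     right_inv := fun B => Subtype.ext (by simp [mul_assoc])
     map_mul' := fun A B => Subtype.ext (by simp [mul_assoc])
     continuous_toFun := by fun_prop
     continuous_invFun := by fun_prop }⟩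

instance (p : StdStiefel) : CompactSpace (stabPair p) := by
  refine isCompact_iff_compactSpace.mp (IsClosed.isCompact ?_)
  have h : (stabPair p : Set G2) = (fun A => p.map A) ⁻¹' {p} := by
    ext A; exact StdStiefel.mem_stabPair
  rw [h]
  exact isClosed_singleton.preimage (StdStiefel.continuous_map p)

theorem StdAssoc.mem_stabPlane_iff_forall {T : StdAssoc} {A : G2} :
    A ∈ stabPlane T ↔ ∀ u ∈ T.1, G2.toLin A u ∈ T.1 := by
  rw [mem_stabPlane]
  constructor
  · intro h u hu
    rw [← h]
    exact ⟨u, hu, rfl⟩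
  · intro h
    apply StdAssoc.eq_of_le
    rintro _ ⟨u, hu, rfl⟩
    exact h u hu

instance (T : StdAssoc) : CompactSpace (stabPlane T) := by
  refine isCompact_iff_compactSpace.mp (IsClosed.isCompact ?_)
  have h : (stabPlane T : Set G2) = ⋂ u ∈ T.1, (fun A => G2.toLin A u) ⁻¹' (T.1 : Set E7) := by
    ext A
    simp only [SetLike.mem_coe, StdAssoc.mem_stabPlane_iff_forall, Set.mem_iInter, Set.mem_preimage]
  rw [h]
  exact isClosed_biInter fun u _ => T.1.closed_of_finiteDimensional.preimage (G2.continuous_toLin u)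

/-- The associative plane spanned by `e₀, e₁, e₆`. -/
def basePlane : StdAssoc := basePair.span

theorem inner_stdBasis_left (k : Fin 7) (v : E7) : (inner ℝ (stdBasis k) v : ℝ) = v k := by
  simp [stdBasis, EuclideanSpace.inner_single_left]

theorem stdBasis_apply (i k : Fin 7) : stdBasis i k = if k = i then 1 else 0 := by
  simp [stdBasis]

theorem mem_basePlane {v : E7} :
    v ∈ basePlane.1 ↔ v 2 = 0 ∧ v 3 = 0 ∧ v 4 = 0 ∧ v 5 = 0 := by
  change v ∈ Submodule.span ℝ {stdBasis 0, stdBasis 1, stdCross (stdBasis 0) (stdBasis 1)} ↔ _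
  rw [G2.stdCross_stdBasis_zero_one]
  constructor
  · intro h
    induction h using Submodule.span_induction with
    | mem x hx => rcases hx with rfl | rfl | rfl <;> simp [stdBasis]
    | zero => simp
    | add x y _ _ hx hy => simp [hx, hy]
    | smul r x _ hx => simp [hx]
  · rintro ⟨h2, h3, h4, h5⟩
    rw [E7.eq_sum v, h2, h3, h4, h5]
    simp only [zero_smul, add_zero]
    refine add_mem (add_mem ?_ ?_) ?_ <;>
      exact Submodule.smul_mem _ _ (Submodule.subset_span (by simp))

theorem stdBasis_mem_basePlane {k : Fin 7} (hk : k = 0 ∨ k = 1 ∨ k = 6) :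
    stdBasis k ∈ basePlane.1 := by
  rcases hk with rfl | rfl | rfl <;> simp [mem_basePlane, stdBasis]

/-- Elements of the stabiliser of a plane preserve its orthogonal complement. -/
theorem toLin_mem_orthogonal {T : StdAssoc} {A : G2} (hA : A ∈ stabPlane T) {v : E7}
    (hv : v ∈ T.1ᗮ) : G2.toLin A v ∈ T.1ᗮ := by
  intro u hu
  have h := StdAssoc.mem_stabPlane_iff_forall.mp (inv_mem hA) u hu
  rw [← G2.toLin_toLin_inv A u, G2.toLin_inner]
  exact hv _ h

theorem mem_basePlane_orthogonal {v : E7} : v ∈ basePlane.1ᗮ ↔ v 0 = 0 ∧ v 1 = 0 ∧ v 6 = 0 := by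
  constructor
  · intro h
    have h' : ∀ k : Fin 7, (k = 0 ∨ k = 1 ∨ k = 6) → v k = 0 := fun k hk => by
      rw [← inner_stdBasis_left]; exact h _ (stdBasis_mem_basePlane hk)
    exact ⟨h' 0 (by simp), h' 1 (by simp), h' 6 (by simp)⟩
  · rintro ⟨h0, h1, h6⟩ u hu
    obtain ⟨h2, h3, h4, h5⟩ := mem_basePlane.mp hu
    rw [inner_E7, h0, h1, h2, h3, h4, h5, h6]
    simp

/-- The coordinates on the orthogonal complement of the plane spanned by `e₀, e₁, e₆`. -/
def complIdx : Fin 4 → Fin 7 := ![2, 3, 4, 5]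

theorem stdBasis_complIdx_mem (j : Fin 4) : stdBasis (complIdx j) ∈ basePlane.1ᗮ := by
  rw [mem_basePlane_orthogonal]
  fin_cases j <;> simp [stdBasis, complIdx]

/-- The matrix of the action of `A` on the orthogonal complement of the base plane. -/
def complMatrix (A : G2) : Matrix (Fin 4) (Fin 4) ℝ :=
  .of fun i j => G2.toLin A (stdBasis (complIdx j)) (complIdx i)

theorem complMatrix_mul (A : G2) {B : G2} (hB : B ∈ stabPlane basePlane) :
    complMatrix (A * B) = complMatrix A * complMatrix B := by
  ext i j
  obtain ⟨h0, h1, h6⟩ := mem_basePlane_orthogonal.mp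
    (toLin_mem_orthogonal hB (stdBasis_complIdx_mem j))
  rw [Matrix.mul_apply, complMatrix, Matrix.of_apply, G2.toLin_mul,
    E7.eq_sum (G2.toLin B (stdBasis (complIdx j))), h0, h1, h6]
  simp [Fin.sum_univ_four, complMatrix, complIdx]
  ring

theorem inner_of_mem_orthogonal {u v : E7} (hu : u ∈ basePlane.1ᗮ) :
    (inner ℝ u v : ℝ) = ∑ i, u (complIdx i) * v (complIdx i) := by
  obtain ⟨h0, h1, h6⟩ := mem_basePlane_orthogonal.mp hu
  rw [inner_E7, h0, h1, h6]
  simp [Fin.sum_univ_four, complIdx]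

/-- The square of the two-form `φ₀(t, ·, ·)` on the orthogonal complement of the base plane is
`|t|²` times the volume form. -/
theorem stdForm_pfaffian {t a b c d : E7} (ht : t ∈ basePlane.1) (ha : a ∈ basePlane.1ᗮ)
    (hb : b ∈ basePlane.1ᗮ) (hc : c ∈ basePlane.1ᗮ) (hd : d ∈ basePlane.1ᗮ) :
    stdForm t a b * stdForm t c d - stdForm t a c * stdForm t b d + stdForm t a d * stdForm t b c =
      (inner ℝ t t : ℝ) * Matrix.det (.of fun i j => ![a, b, c, d] j (complIdx i)) := by
  obtain ⟨t2, t3, t4, t5⟩ := mem_basePlane.mp ht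
  obtain ⟨a0, a1, a6⟩ := mem_basePlane_orthogonal.mp ha
  obtain ⟨b0, b1, b6⟩ := mem_basePlane_orthogonal.mp hb
  obtain ⟨c0, c1, c6⟩ := mem_basePlane_orthogonal.mp hc
  obtain ⟨d0, d1, d6⟩ := mem_basePlane_orthogonal.mp hd
  rw [inner_E7]
  simp only [stdForm, e3, Matrix.det_succ_row_zero (n := 3), Fin.sum_univ_four, Matrix.det_fin_three,
    Matrix.submatrix_apply, Matrix.of_apply, complIdx, t2, t3, t4, t5, a0, a1, a6, b0, b1, b6, c0,
    c1, c6, d0, d1, d6]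
  simp [Fin.succAbove]
  ring

/-- The stabiliser of the base plane acts on the orthogonal complement by rotations; the
determinant is one by `stdForm_pfaffian`. -/
theorem complMatrix_mem {A : G2} (hA : A ∈ stabPlane basePlane) :
    complMatrix A ∈ Matrix.specialOrthogonalGroup (Fin 4) ℝ := by
  have hmem := fun j => toLin_mem_orthogonal hA (stdBasis_complIdx_mem j)
  rw [Matrix.mem_specialOrthogonalGroup_iff, Matrix.mem_orthogonalGroup_iff']
  constructor
  · ext j k
    rw [Matrix.mul_apply]
    have h := inner_of_mem_orthogonal (v := G2.toLin A (stdBasis (complIdx k))) (hmem j)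
    rw [G2.toLin_inner, inner_stdBasis] at h
    simp only [Matrix.transpose_apply, complMatrix, Matrix.of_apply]
    rw [← h, Matrix.one_apply]
    have hi : Function.Injective complIdx := by decide
    simp only [hi.eq_iff]
  · have h := stdForm_pfaffian (StdAssoc.mem_stabPlane_iff_forall.mp hA _
      (stdBasis_mem_basePlane (k := 6) (by simp))) (hmem 0) (hmem 1) (hmem 2) (hmem 3)
    simp only [G2.toLin_stdForm, G2.toLin_inner, inner_stdBasis, if_true, one_mul] at h
    have h2 : complMatrix A = .of fun i j => ![G2.toLin A (stdBasis (complIdx 0)),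
        G2.toLin A (stdBasis (complIdx 1)), G2.toLin A (stdBasis (complIdx 2)),
        G2.toLin A (stdBasis (complIdx 3))] j (complIdx i) := by
      ext i j; fin_cases j <;> rfl
    rw [h2, ← h]
    simp [stdForm, e3, complIdx, stdBasis]

/-- Two matrices in `SO(4)` that agree on three columns are equal. -/
theorem specialOrthogonalGroup_four_ext {M N : Matrix (Fin 4) (Fin 4) ℝ}
    (hM : M ∈ Matrix.specialOrthogonalGroup (Fin 4) ℝ)
    (hN : N ∈ Matrix.specialOrthogonalGroup (Fin 4) ℝ)
    (h : ∀ i, ∀ j ≠ 1, M i j = N i j) : M = N := by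
  rw [Matrix.mem_specialOrthogonalGroup_iff] at hM hN
  -- the matrix `Mᵀ N` fixes three basis vectors, is orthogonal, and has determinant one
  set C := M.transpose * N with hC
  have hMM := (Matrix.mem_orthogonalGroup_iff' _ _).mp hM.1
  have hCorth : C * C.transpose = 1 := by
    rw [hC, Matrix.transpose_mul, Matrix.transpose_transpose, Matrix.mul_assoc,
      ← Matrix.mul_assoc N, (Matrix.mem_orthogonalGroup_iff _ _).mp hN.1, Matrix.one_mul, hMM]
  have hcol : ∀ i, ∀ j ≠ 1, C i j = (1 : Matrix (Fin 4) (Fin 4) ℝ) i j := fun i j hj => by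
    rw [← hMM, hC, Matrix.mul_apply, Matrix.mul_apply]
    exact Finset.sum_congr rfl fun k _ => by rw [h k j hj]
  have hrow : ∀ i j, i ≠ 1 → C i j = (1 : Matrix (Fin 4) (Fin 4) ℝ) i j := by
    intro i j hi
    by_cases hj : j = 1
    · subst hj
      have h1 := congrFun (congrFun hCorth i) i
      rw [Matrix.mul_apply, Fin.sum_univ_four] at h1
      simp only [Matrix.transpose_apply, hcol _ _ (show (0 : Fin 4) ≠ 1 by decide),
        hcol _ _ (show (2 : Fin 4) ≠ 1 by decide), hcol _ _ (show (3 : Fin 4) ≠ 1 by decide)] at h1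
      rw [Matrix.one_apply_ne hi]
      have hi' : i = 0 ∨ i = 2 ∨ i = 3 := by omega
      rcases hi' with rfl | rfl | rfl <;> simpa using h1
    · exact hcol i j hj
  have hdet : C.det = C 1 1 := by
    rw [Matrix.det_succ_row_zero]
    simp [hrow, Matrix.det_fin_three, Fin.succAbove, Matrix.one_apply]
  have h11 : C 1 1 = 1 := by
    rw [← hdet, hC, Matrix.det_mul, Matrix.det_transpose, hM.2, hN.2, mul_one]
  have hC1 : C = 1 := by
    ext i j
    by_cases hj : j = 1
    · subst hj
      by_cases hi : i = 1
      · subst hi; rw [h11, Matrix.one_apply_eq]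
      · exact hrow i 1 hi
    · exact hcol i j hj
  calc M = M * C := by rw [hC1, Matrix.mul_one]
    _ = N := by rw [hC, ← Matrix.mul_assoc, (Matrix.mem_orthogonalGroup_iff _ _).mp hM.1,
      Matrix.one_mul]

theorem stdCross_mem_basePlane {u v : E7} (hu : u ∈ basePlane.1ᗮ) (hv : v ∈ basePlane.1ᗮ) :
    stdCross u v ∈ basePlane.1 := by
  obtain ⟨u0, u1, u6⟩ := mem_basePlane_orthogonal.mp hu
  obtain ⟨v0, v1, v6⟩ := mem_basePlane_orthogonal.mp hv
  rw [mem_basePlane]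
  simp [stdCross_apply, u0, u1, u6, v0, v1, v6]

/-- Every rotation of the orthogonal complement of an associative plane extends to `G₂`: as the
cross product maps pairs in the complement to the plane, it dictates the action on the plane. -/
theorem exists_complMatrix_eq {M : Matrix (Fin 4) (Fin 4) ℝ}
    (hM : M ∈ Matrix.specialOrthogonalGroup (Fin 4) ℝ) :
    ∃ A ∈ stabPlane basePlane, complMatrix A = M := by
  have hM' := (Matrix.mem_orthogonalGroup_iff' _ _).mp (Matrix.mem_specialOrthogonalGroup_iff.mp hM).1
  let c : Fin 4 → E7 := fun j => WithLp.toLp 2 ![0, 0, M 0 j, M 1 j, M 2 j, M 3 j, 0]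
  have hc : ∀ j, c j ∈ basePlane.1ᗮ := fun j => by
    rw [mem_basePlane_orthogonal]; simp [c]
  have hcc : ∀ j k, (inner ℝ (c j) (c k) : ℝ) = if j = k then 1 else 0 := fun j k => by
    rw [inner_of_mem_orthogonal (hc j)]
    have := congrFun (congrFun hM' j) k
    rw [Matrix.mul_apply, Matrix.one_apply, Fin.sum_univ_four] at this
    rw [← this]
    simp [Fin.sum_univ_four, c, complIdx]
  have hx := hcc 0 0
  have hy := hcc 2 2
  have hz := hcc 3 3
  have hxy := hcc 0 2
  have hxz := hcc 0 3
  have hyz := hcc 2 3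
  simp only [if_true, Fin.reduceEq, if_false] at hx hy hz hxy hxz hyz
  -- as `e₀ = e₂ × e₄` and `e₁ = -e₂ × e₅`, an extension must map `e₀, e₁` to the following vectors
  have hu := stdCross_mem_basePlane (hc 0) (hc 2)
  have hv := basePlane.1.neg_mem (stdCross_mem_basePlane (hc 0) (hc 3))
  obtain ⟨A, hA0, hA1, hA2⟩ := G2.exists_toLin_eq (u := stdCross (c 0) (c 2))
    (v := -stdCross (c 0) (c 3)) (x := c 0)
    (by rw [inner_stdCross_stdCross, hx, hy, hxy]; simp)
    (by rw [inner_neg_neg, inner_stdCross_stdCross, hx, hz, hxz]; simp) hx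
    (by rw [inner_neg_right, inner_stdCross_stdCross, hyz, hxz]; simp)
    (by exact hc 0 _ hu) (by exact hc 0 _ hv) (by exact hc 0 _ (basePlane.2.2 _ hu _ hv))
  have hA : A ∈ stabPlane basePlane := by
    rw [StdAssoc.mem_stabPlane_iff_forall]
    intro a ha
    obtain ⟨a2, a3, a4, a5⟩ := mem_basePlane.mp ha
    rw [E7.eq_sum a, a2, a3, a4, a5]
    simp only [map_add, map_smul, zero_smul, add_zero]
    rw [← G2.stdCross_stdBasis_zero_one, G2.toLin_stdCross, hA0, hA1]
    exact add_mem (add_mem (Submodule.smul_mem _ _ hu) (Submodule.smul_mem _ _ hv))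
      (Submodule.smul_mem _ _ (basePlane.2.2 _ hu _ hv))
  have hA4 : G2.toLin A (stdBasis 4) = c 2 := by
    rw [← G2.stdCross_stdBasis_zero_two, G2.toLin_stdCross, hA0, hA2, stdCross_swap,
      stdCross_stdCross, hxy, hx]
    simp
  have hA5 : G2.toLin A (stdBasis 5) = c 3 := by
    rw [← neg_neg (stdBasis 5), ← G2.stdCross_stdBasis_one_two, map_neg, G2.toLin_stdCross, hA1, hA2,
      stdCross_neg_left, stdCross_swap (c 0) (stdCross (c 0) (c 3)), stdCross_stdCross, hxz, hx]
    simp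
  refine ⟨A, hA, specialOrthogonalGroup_four_ext (complMatrix_mem hA) hM fun i j hj => ?_⟩
  have hci : ∀ j i, c j (complIdx i) = M i j := fun j i => by fin_cases i <;> rfl
  have hj' : G2.toLin A (stdBasis (complIdx j)) = c j := by
    fin_cases j
    · exact hA2
    · exact absurd rfl hj
    · exact hA4
    · exact hA5
  rw [complMatrix, Matrix.of_apply, hj', hci]

/-- The action on the complement determines the action on the plane, since `e₀` and `e₁` are cross
products of vectors in the complement. -/
theorem complMatrix_injOn {A B : G2} (hA : A ∈ stabPlane basePlane) (hB : B ∈ stabPlane basePlane)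
    (h : complMatrix A = complMatrix B) : A = B := by
  have hj : ∀ j, G2.toLin A (stdBasis (complIdx j)) = G2.toLin B (stdBasis (complIdx j)) := by
    intro j
    obtain ⟨a0, a1, a6⟩ := mem_basePlane_orthogonal.mp
      (toLin_mem_orthogonal hA (stdBasis_complIdx_mem j))
    obtain ⟨b0, b1, b6⟩ := mem_basePlane_orthogonal.mp
      (toLin_mem_orthogonal hB (stdBasis_complIdx_mem j))
    have hi := fun i => congrFun (congrFun h i) j
    ext k
    fin_cases k
    · exact a0.trans b0.symm
    · exact a1.trans b1.symm
    · exact hi 0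
    · exact hi 1
    · exact hi 2
    · exact hi 3
    · exact a6.trans b6.symm
  have h0 : stdBasis 0 = stdCross (stdBasis 2) (stdBasis 4) := by
    ext k; rw [stdCross_apply]; fin_cases k <;> simp [stdBasis]
  have h1 : stdBasis 1 = -stdCross (stdBasis 2) (stdBasis 5) := by
    ext k; rw [PiLp.neg_apply, stdCross_apply]; fin_cases k <;> simp [stdBasis]
  have e2 : G2.toLin A (stdBasis 2) = G2.toLin B (stdBasis 2) := hj 0
  have e4 : G2.toLin A (stdBasis 4) = G2.toLin B (stdBasis 4) := hj 2
  have e5 : G2.toLin A (stdBasis 5) = G2.toLin B (stdBasis 5) := hj 3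
  refine G2.ext_of_stdBasis ?_ ?_ e2
  · rw [h0, G2.toLin_stdCross, G2.toLin_stdCross, e2, e4]
  · rw [h1, map_neg, map_neg, G2.toLin_stdCross, G2.toLin_stdCross, e2, e5]

/-- The stabiliser of an associative plane is `SO(4)`. -/
theorem stabPlane_mulEquiv (T : StdAssoc) :
    Nonempty (stabPlane T ≃ₜ* Matrix.specialOrthogonalGroup (Fin 4) ℝ) := by
  have hbase : Nonempty (stabPlane basePlane ≃ₜ* Matrix.specialOrthogonalGroup (Fin 4) ℝ) := by
    refine nonempty_continuousMulEquiv_of_bijective (fun A => ⟨complMatrix A.1, complMatrix_mem A.2⟩)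
      (fun A B => Subtype.ext (complMatrix_mul A.1 B.2)) ?_ ⟨fun A B h => ?_, fun M => ?_⟩
    · refine Continuous.subtype_mk (continuous_matrix fun i j => ?_) _
      exact (PiLp.continuous_apply 2 _ _).comp ((G2.continuous_toLin _).comp continuous_subtype_val)
    · exact Subtype.ext (complMatrix_injOn A.2 B.2 (congrArg Subtype.val h))
    · obtain ⟨A, hA, h⟩ := exists_complMatrix_eq M.2
      exact ⟨⟨A, hA⟩, Subtype.ext h⟩
  obtain ⟨g, hg : StdAssoc.map g basePlane = T⟩ := (StdAssoc.isQuotientMap_map basePlane).surjective T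
  obtain ⟨e⟩ := nonempty_continuousMulEquiv_conj (K := stabPlane T) (L := stabPlane basePlane) g
    (fun A => by
      rw [StdAssoc.mem_stabPlane, StdAssoc.mem_stabPlane, ← hg, StdAssoc.map_mul, StdAssoc.map_mul]
      constructor
      · intro h
        rw [h, ← StdAssoc.map_mul, inv_mul_cancel, StdAssoc.map_one]
      · intro h
        conv_rhs => rw [← h, ← StdAssoc.map_mul, mul_inv_cancel, StdAssoc.map_one])
  exact ⟨e.trans hbase.some⟩

/-- For an element of `G₂` that fixes `e₀, e₁`, the matrix of its action on the span of `e₂, …,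
e₅`, identified with `ℂ²` by the complex structure `e₆ ×`. The columns are the images of `e₂` and
of `e₄ = e₀ × e₂`. -/
def complexMatrix (A : G2) : Matrix (Fin 2) (Fin 2) ℂ :=
  let x := G2.toLin A (stdBasis 2)
  !![⟨x 2, x 3⟩, ⟨-x 4, x 5⟩; ⟨x 4, x 5⟩, ⟨x 2, -x 3⟩]

theorem toLin_two_of_mem_stabPair {A : G2} (hA : A ∈ stabPair basePair) :
    G2.toLin A (stdBasis 2) ∈ basePlane.1ᗮ := by
  obtain ⟨h0, h1⟩ : G2.toLin A (stdBasis 0) = stdBasis 0 ∧ G2.toLin A (stdBasis 1) = stdBasis 1 := hA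
  have h6 : G2.toLin A (stdBasis 6) = stdBasis 6 := by
    rw [← G2.stdCross_stdBasis_zero_one, G2.toLin_stdCross, h0, h1]
  rw [mem_basePlane_orthogonal]
  refine ⟨?_, ?_, ?_⟩ <;> rw [← inner_stdBasis_left]
  · rw [← congrArg (inner ℝ · _) h0, G2.toLin_inner, inner_stdBasis, if_neg (by decide)]
  · rw [← congrArg (inner ℝ · _) h1, G2.toLin_inner, inner_stdBasis, if_neg (by decide)]
  · rw [← congrArg (inner ℝ · _) h6, G2.toLin_inner, inner_stdBasis, if_neg (by decide)]

theorem complexMatrix_mem {A : G2} (hA : A ∈ stabPair basePair) :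
    complexMatrix A ∈ Matrix.specialUnitaryGroup (Fin 2) ℂ := by
  obtain ⟨x0, x1, x6⟩ := mem_basePlane_orthogonal.mp (toLin_two_of_mem_stabPair hA)
  have h : (inner ℝ (G2.toLin A (stdBasis 2)) (G2.toLin A (stdBasis 2)) : ℝ) = 1 := by
    rw [G2.toLin_inner, inner_stdBasis, if_pos rfl]
  rw [inner_E7, x0, x1, x6] at h
  rw [Matrix.mem_specialUnitaryGroup_iff, Matrix.mem_unitaryGroup_iff]
  constructor
  · ext i j
    rw [Matrix.mul_apply, Fin.sum_univ_two, Matrix.star_apply, Matrix.star_apply]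
    fin_cases i <;> fin_cases j <;> apply Complex.ext <;> simp [complexMatrix] <;> linarith
  · rw [Matrix.det_fin_two]
    apply Complex.ext <;> simp [complexMatrix] <;> linarith

theorem complexMatrix_mul {A B : G2} (hA : A ∈ stabPair basePair) (hB : B ∈ stabPair basePair) :
    complexMatrix (A * B) = complexMatrix A * complexMatrix B := by
  obtain ⟨x0, x1, x6⟩ := mem_basePlane_orthogonal.mp (toLin_two_of_mem_stabPair hA)
  obtain ⟨y0, y1, y6⟩ := mem_basePlane_orthogonal.mp (toLin_two_of_mem_stabPair hB)
  obtain ⟨h0, h1⟩ : G2.toLin A (stdBasis 0) = stdBasis 0 ∧ G2.toLin A (stdBasis 1) = stdBasis 1 := hA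
  have h : G2.toLin (A * B) (stdBasis 2) = ofFrame (adaptedFrame (stdBasis 0) (stdBasis 1)
      (G2.toLin A (stdBasis 2))) (G2.toLin B (stdBasis 2)) := by
    rw [G2.toLin_mul, G2.toLin_eq_ofFrame A, h0, h1]
  simp only [complexMatrix, h, ofFrame, adaptedFrame, G2.stdCross_stdBasis_zero_one]
  ext i j
  rw [Matrix.mul_apply, Fin.sum_univ_two]
  fin_cases i <;> fin_cases j <;> apply Complex.ext <;>
    simp [y0, y1, y6, stdCross_apply, stdBasis_apply] <;> ring

theorem exists_complexMatrix_eq {M : Matrix (Fin 2) (Fin 2) ℂ}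
    (hM : M ∈ Matrix.specialUnitaryGroup (Fin 2) ℂ) :
    ∃ A ∈ stabPair basePair, complexMatrix A = M := by
  rw [Matrix.mem_specialUnitaryGroup_iff, Matrix.mem_unitaryGroup_iff] at hM
  obtain ⟨hM, hdet⟩ := hM
  have hadj : star M = M.adjugate := by
    have h1 : M.adjugate * M = 1 := by rw [Matrix.adjugate_mul, hdet, one_smul]
    calc star M = M.adjugate * M * star M := by rw [h1, Matrix.one_mul]
      _ = M.adjugate := by rw [Matrix.mul_assoc, hM, Matrix.mul_one]
  rw [Matrix.adjugate_fin_two] at hadj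
  have h00 : star (M 0 0) = M 1 1 := by simpa using congrFun (congrFun hadj 0) 0
  have h10 : star (M 0 1) = -M 1 0 := by simpa using congrFun (congrFun hadj 1) 0
  have hnorm := hdet
  rw [Matrix.det_fin_two, ← h00, ← neg_eq_iff_eq_neg.mpr h10] at hnorm
  have hre := congrArg Complex.re hnorm
  have h00r := congrArg Complex.re h00
  have h00i := congrArg Complex.im h00
  have h10r := congrArg Complex.re h10
  have h10i := congrArg Complex.im h10
  simp at hre h00r h00i h10r h10i
  let x : E7 := WithLp.toLp 2 ![0, 0, (M 0 0).re, (M 0 0).im, (M 1 0).re, (M 1 0).im, 0]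
  obtain ⟨A, hA0, hA1, hA2⟩ := G2.exists_toLin_eq (u := stdBasis 0) (v := stdBasis 1) (x := x)
    (by rw [inner_stdBasis, if_pos rfl]) (by rw [inner_stdBasis, if_pos rfl])
    (by rw [inner_E7]; simp [x]; rw [h10r, h10i] at hre; linarith)
    (by rw [inner_stdBasis, if_neg (by decide)]) (by rw [inner_stdBasis_left]; rfl)
    (by rw [inner_stdBasis_left]; rfl)
    (by rw [G2.stdCross_stdBasis_zero_one, inner_stdBasis_left]; rfl)
  refine ⟨A, ⟨hA0, hA1⟩, ?_⟩
  rw [complexMatrix, hA2]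
  ext i j
  fin_cases i <;> fin_cases j <;> apply Complex.ext <;> simp [x] <;> linarith

theorem complexMatrix_injOn {A B : G2} (hA : A ∈ stabPair basePair) (hB : B ∈ stabPair basePair)
    (h : complexMatrix A = complexMatrix B) : A = B := by
  obtain ⟨a0, a1, a6⟩ := mem_basePlane_orthogonal.mp (toLin_two_of_mem_stabPair hA)
  obtain ⟨b0, b1, b6⟩ := mem_basePlane_orthogonal.mp (toLin_two_of_mem_stabPair hB)
  have h0 := congrFun (congrFun h 0) 0
  have h1 := congrFun (congrFun h 1) 0
  simp only [complexMatrix, Matrix.of_apply, Matrix.cons_val, Complex.mk.injEq] at h0 h1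
  refine G2.ext_of_stdBasis (hA.1.trans hB.1.symm) (hA.2.trans hB.2.symm) ?_
  ext k
  fin_cases k
  · exact a0.trans b0.symm
  · exact a1.trans b1.symm
  · exact h0.1
  · exact h0.2
  · exact h1.1
  · exact h1.2
  · exact a6.trans b6.symm

/-- The stabiliser of an orthonormal pair is `SU(2)`. -/
theorem stabPair_mulEquiv (p : StdStiefel) :
    Nonempty (stabPair p ≃ₜ* Matrix.specialUnitaryGroup (Fin 2) ℂ) := by
  have hbase : Nonempty (stabPair basePair ≃ₜ* Matrix.specialUnitaryGroup (Fin 2) ℂ) := by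
    refine nonempty_continuousMulEquiv_of_bijective
      (fun A => ⟨complexMatrix A.1, complexMatrix_mem A.2⟩)
      (fun A B => Subtype.ext (complexMatrix_mul A.2 B.2)) ?_ ⟨fun A B h => ?_, fun M => ?_⟩
    · have hx : ∀ k, Continuous fun A : stabPair basePair => G2.toLin A.1 (stdBasis 2) k := fun k =>
        (PiLp.continuous_apply 2 _ _).comp ((G2.continuous_toLin _).comp continuous_subtype_val)
      have hmk : ∀ f g : stabPair basePair → ℝ, Continuous f → Continuous g →
          Continuous fun A => (⟨f A, g A⟩ : ℂ) := fun f g hf hg =>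
        Complex.equivRealProdCLM.symm.continuous.comp (hf.prodMk hg)
      refine Continuous.subtype_mk (continuous_matrix fun i j => ?_) _
      fin_cases i <;> fin_cases j
      · exact hmk _ _ (hx 2) (hx 3)
      · exact hmk _ _ (hx 4).neg (hx 5)
      · exact hmk _ _ (hx 4) (hx 5)
      · exact hmk _ _ (hx 2) (hx 3).neg
    · exact Subtype.ext (complexMatrix_injOn A.2 B.2 (congrArg Subtype.val h))
    · obtain ⟨A, hA, h⟩ := exists_complexMatrix_eq M.2
      exact ⟨⟨A, hA⟩, Subtype.ext h⟩
  obtain ⟨g, hg⟩ := StdStiefel.exists_map_eq basePair p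
  obtain ⟨e⟩ := nonempty_continuousMulEquiv_conj (K := stabPair p) (L := stabPair basePair) g
    (fun A => by
      rw [StdStiefel.mem_stabPair, StdStiefel.mem_stabPair, ← hg, StdStiefel.map_mul,
        StdStiefel.map_mul]
      constructor
      · intro h
        rw [h, ← StdStiefel.map_mul, inv_mul_cancel, StdStiefel.map_one]
      · intro h
        conv_rhs => rw [← h, ← StdStiefel.map_mul, mul_inv_cancel,
          StdStiefel.map_one])
  exact ⟨e.trans hbase.some⟩

/-! ### The action of `SO(3)` on orthonormal pairs -/

/-- The rotation group of `ℝ³`. -/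
abbrev SO3 : Type := Matrix.specialOrthogonalGroup (Fin 3) ℝ

theorem SO3.mul_transpose (Θ : SO3) : Θ.1 * Θ.1.transpose = 1 :=
  (Matrix.mem_orthogonalGroup_iff _ _).mp (Matrix.mem_specialOrthogonalGroup_iff.mp Θ.2).1

theorem SO3.det_eq (Θ : SO3) : Θ.1.det = 1 := (Matrix.mem_specialOrthogonalGroup_iff.mp Θ.2).2

/-- The last row of a rotation is determined, since the transpose is the adjugate. -/
theorem SO3.row_two (Θ : SO3) : Θ.1 2 = crossProduct (Θ.1 0) (Θ.1 1) := by
  have hadj : Θ.1.transpose = Θ.1.adjugate := by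
    have h1 : Θ.1.adjugate * Θ.1 = 1 := by rw [Matrix.adjugate_mul, Θ.det_eq, one_smul]
    calc Θ.1.transpose = Θ.1.adjugate * Θ.1 * Θ.1.transpose := by rw [h1, Matrix.one_mul]
      _ = Θ.1.adjugate := by rw [Matrix.mul_assoc, Θ.mul_transpose, Matrix.mul_one]
  rw [Matrix.adjugate_fin_three] at hadj
  rw [cross_apply]
  ext β
  have := congrFun (congrFun hadj β) 2
  rw [Matrix.transpose_apply] at this
  rw [this]
  fin_cases β <;> simp <;> ring

theorem SO3.dotProduct_row (Θ : SO3) (α β : Fin 3) :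
    Θ.1 α ⬝ᵥ Θ.1 β = if α = β then 1 else 0 := by
  have := congrFun (congrFun Θ.mul_transpose α) β
  rwa [Matrix.mul_apply', Matrix.one_apply] at this

theorem SO3.ext_rows {Θ Θ' : SO3} (h0 : Θ.1 0 = Θ'.1 0) (h1 : Θ.1 1 = Θ'.1 1) : Θ = Θ' := by
  refine Subtype.ext (funext fun α => ?_)
  fin_cases α
  · exact h0
  · exact h1
  · refine Θ.row_two.trans (Eq.trans ?_ Θ'.row_two.symm)
    rw [h0, h1]

/-- The rotation whose first two rows are a given orthonormal pair. -/
def SO3.ofRows (a b : Fin 3 → ℝ) (ha : a ⬝ᵥ a = 1) (hb : b ⬝ᵥ b = 1) (hab : a ⬝ᵥ b = 0) : SO3 :=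
  ⟨.of ![a, b, crossProduct a b], by
    have hba : b ⬝ᵥ a = 0 := by rwa [dotProduct_comm]
    have h1 : crossProduct a b ⬝ᵥ crossProduct a b = 1 := by
      rw [cross_dot_cross, ha, hb, hab, hba]; norm_num
    rw [Matrix.mem_specialOrthogonalGroup_iff, Matrix.mem_orthogonalGroup_iff]
    constructor
    · ext i j
      rw [Matrix.mul_apply']
      change (![a, b, crossProduct a b] i) ⬝ᵥ (![a, b, crossProduct a b] j) = _
      have h2 := dotProduct_comm (crossProduct a b) a
      have h3 := dotProduct_comm (crossProduct a b) b
      rw [dot_self_cross] at h2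
      rw [dot_cross_self] at h3
      fin_cases i <;> fin_cases j <;> simp [ha, hb, hab, hba, h1, h2, h3]
    · have h2 := h1
      rw [cross_apply] at h1 ⊢
      rw [Matrix.det_fin_three]
      simp [dotProduct, Fin.sum_univ_three] at h1 ⊢
      linarith⟩

namespace StdStiefel

/-- The three-frame `(u, v, u × v)` of an orthonormal pair. -/
def frame (p : StdStiefel) : Fin 3 → E7 := ![p.1.1, p.1.2, stdCross p.1.1 p.1.2]

theorem inner_frame (p : StdStiefel) (α β : Fin 3) :
    (inner ℝ (p.frame α) (p.frame β) : ℝ) = if α = β then 1 else 0 := by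
  obtain ⟨⟨u, v⟩, hu, hv, huv⟩ := p
  simp only at hu hv huv
  have hvu : (inner ℝ v u : ℝ) = 0 := by rwa [real_inner_comm]
  have h1 := inner_stdCross_left u v
  have h2 := inner_stdCross_right u v
  have h3 : (inner ℝ (stdCross u v) (stdCross u v) : ℝ) = 1 := by
    rw [inner_stdCross_stdCross, hu, hv, huv]; simp
  have h4 : (inner ℝ (stdCross u v) u : ℝ) = 0 := by rwa [real_inner_comm]
  have h5 : (inner ℝ (stdCross u v) v : ℝ) = 0 := by rwa [real_inner_comm]
  fin_cases α <;> fin_cases β <;>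
    simp [frame, -inner_self_eq_norm_sq_to_K, hu, hv, huv, hvu, h1, h2, h3, h4, h5]

theorem inner_sum_frame (p : StdStiefel) (a b : Fin 3 → ℝ) :
    (inner ℝ (∑ β, a β • p.frame β) (∑ β, b β • p.frame β) : ℝ) = a ⬝ᵥ b := by
  simp [sum_inner, inner_sum, inner_smul_left, inner_smul_right, inner_frame, dotProduct, mul_comm,
    -inner_self_eq_norm_sq_to_K]

/-- The cross product of `ℝ⁷` restricts to the one of `ℝ³` on an associative plane. -/
theorem stdCross_sum_frame (p : StdStiefel) (a b : Fin 3 → ℝ) :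
    stdCross (∑ β, a β • p.frame β) (∑ β, b β • p.frame β) =
      ∑ β, crossProduct a b β • p.frame β := by
  obtain ⟨⟨u, v⟩, hu, hv, huv⟩ := p
  simp only at hu hv huv
  have huw : stdCross u (stdCross u v) = -v := by rw [stdCross_stdCross, hu, huv]; simp
  have hvw : stdCross v (stdCross u v) = u := by
    rw [stdCross_swap v u, stdCross_neg_right, stdCross_stdCross, real_inner_comm, huv, hv]; simp
  rw [cross_apply]
  simp only [Fin.sum_univ_three, frame, Matrix.cons_val, stdCross_add_left, stdCross_add_right,
    stdCross_smul_left, stdCross_smul_right, stdCross_self, huw, hvw, stdCross_swap u v,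
    stdCross_swap u (stdCross u v), stdCross_swap v (stdCross u v)]
  module

theorem span_frame (p : StdStiefel) : Submodule.span ℝ (Set.range p.frame) = p.span.1 := by
  change _ = Submodule.span ℝ _
  rw [frame, Matrix.range_cons, Matrix.range_cons, Matrix.range_cons, Matrix.range_empty,
    Set.union_empty, Set.singleton_union, Set.singleton_union]

theorem frame_mem (p : StdStiefel) (α : Fin 3) : p.frame α ∈ p.span.1 := by
  rw [← span_frame]; exact Submodule.subset_span ⟨α, rfl⟩

theorem eq_sum_of_mem {p : StdStiefel} {x : E7} (hx : x ∈ p.span.1) :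
    x = ∑ β, (inner ℝ x (p.frame β) : ℝ) • p.frame β := by
  rw [← span_frame, Submodule.mem_span_range_iff_exists_fun] at hx
  obtain ⟨c, rfl⟩ := hx
  refine Finset.sum_congr rfl fun β _ => ?_
  simp [sum_inner, inner_smul_left, inner_frame]

/-- The action of a rotation on the frame of an orthonormal pair. -/
def act (Θ : SO3) (p : StdStiefel) : StdStiefel :=
  ⟨(∑ β, Θ.1 0 β • p.frame β, ∑ β, Θ.1 1 β • p.frame β), by
    simp only [inner_sum_frame]
    exact ⟨Θ.dotProduct_row 0 0, Θ.dotProduct_row 1 1, Θ.dotProduct_row 0 1⟩⟩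

theorem frame_act (Θ : SO3) (p : StdStiefel) (α : Fin 3) :
    (act Θ p).frame α = ∑ β, Θ.1 α β • p.frame β := by
  fin_cases α
  · rfl
  · rfl
  · change stdCross _ _ = _
    rw [act, stdCross_sum_frame, ← Θ.row_two]
    rfl

theorem span_act (Θ : SO3) (p : StdStiefel) : (act Θ p).span = p.span := by
  apply StdAssoc.eq_of_le
  rw [← span_frame, Submodule.span_le]
  rintro _ ⟨α, rfl⟩
  rw [frame_act]
  exact sum_mem fun β _ => Submodule.smul_mem _ _ (frame_mem p β)

/-- The fibres of the span are the orbits of `SO(3)`. -/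
theorem exists_act_eq {p q : StdStiefel} (h : q.span = p.span) : ∃ Θ, act Θ p = q := by
  let M : Fin 3 → Fin 3 → ℝ := fun α β => inner ℝ (q.frame α) (p.frame β)
  have hq : ∀ α, q.frame α = ∑ β, M α β • p.frame β := fun α =>
    eq_sum_of_mem (h ▸ frame_mem q α)
  have hM : ∀ α β, M α ⬝ᵥ M β = if α = β then 1 else 0 := fun α β => by
    rw [← inner_sum_frame p, ← hq, ← hq, inner_frame]
  refine ⟨SO3.ofRows (M 0) (M 1) (hM 0 0) (hM 1 1) (hM 0 1), Subtype.ext (Prod.ext ?_ ?_)⟩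
  · exact (hq 0).symm
  · exact (hq 1).symm

theorem continuous_frame (α : Fin 3) : Continuous fun p : StdStiefel => p.frame α := by
  fin_cases α
  · exact continuous_fst.comp continuous_subtype_val
  · exact continuous_snd.comp continuous_subtype_val
  · exact continuous_stdCross.comp continuous_subtype_val

theorem continuous_act : Continuous fun x : SO3 × StdStiefel => act x.1 x.2 := by
  have h : ∀ α, Continuous fun x : SO3 × StdStiefel => ∑ β, x.1.1 α β • x.2.frame β := fun α =>
    continuous_finsetSum _ fun β _ => Continuous.smul
      ((continuous_subtype_val.comp continuous_fst).matrix_elem α β)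
      ((continuous_frame β).comp continuous_snd)
  exact ((h 0).prodMk (h 1)).subtype_mk _

/-- The span is an open map, as the quotient map of a group action. -/
theorem isOpenMap_span : IsOpenMap StdStiefel.span := by
  intro O hO
  rw [← isQuotientMap_span.isOpen_preimage]
  have h : StdStiefel.span ⁻¹' (StdStiefel.span '' O) = ⋃ Θ, act Θ ⁻¹' O := by
    ext p
    simp only [Set.mem_preimage, Set.mem_image, Set.mem_iUnion]
    constructor
    · rintro ⟨q, hq, h⟩
      obtain ⟨Θ, hΘ⟩ := exists_act_eq h
      exact ⟨Θ, hΘ ▸ hq⟩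
    · rintro ⟨Θ, h⟩
      exact ⟨_, h, span_act Θ p⟩
  rw [h]
  exact isOpen_iUnion fun Θ => hO.preimage (continuous_act.comp (Continuous.prodMk_right Θ))

end StdStiefel

/-! ### The Gram–Schmidt rotation of a matrix -/

/-- The first row of the Gram–Schmidt orthonormalisation of the rows. -/
def gramRow₀ (M : Matrix (Fin 3) (Fin 3) ℝ) : Fin 3 → ℝ := (√(M 0 ⬝ᵥ M 0))⁻¹ • M 0

/-- The part of the second row orthogonal to the first one. -/
def gramPerp (M : Matrix (Fin 3) (Fin 3) ℝ) : Fin 3 → ℝ := M 1 - (gramRow₀ M ⬝ᵥ M 1) • gramRow₀ M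

/-- The second row of the Gram–Schmidt orthonormalisation of the rows. -/
def gramRow₁ (M : Matrix (Fin 3) (Fin 3) ℝ) : Fin 3 → ℝ :=
  (√(gramPerp M ⬝ᵥ gramPerp M))⁻¹ • gramPerp M

theorem dotProduct_self_pos_of_ne_zero {a : Fin 3 → ℝ} (h : a ≠ 0) : 0 < a ⬝ᵥ a :=
  lt_of_le_of_ne (Finset.sum_nonneg fun _ _ => mul_self_nonneg _)
    (fun h0 => h (dotProduct_self_eq_zero.mp h0.symm))

theorem row_zero_pos_of_det_ne_zero {M : Matrix (Fin 3) (Fin 3) ℝ} (h : M.det ≠ 0) :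
    0 < M 0 ⬝ᵥ M 0 :=
  dotProduct_self_pos_of_ne_zero fun h0 =>
    h (Matrix.det_eq_zero_of_row_eq_zero 0 fun j => congrFun h0 j)

theorem gramPerp_pos_of_det_ne_zero {M : Matrix (Fin 3) (Fin 3) ℝ} (h : M.det ≠ 0) :
    0 < gramPerp M ⬝ᵥ gramPerp M := by
  refine dotProduct_self_pos_of_ne_zero fun h0 => h ?_
  rw [gramPerp, sub_eq_zero, gramRow₀, smul_smul] at h0
  rw [Matrix.det_fin_three, h0]
  simp only [Pi.smul_apply, smul_eq_mul]
  ring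

theorem inv_sqrt_smul_dotProduct {a : Fin 3 → ℝ} (h : 0 < a ⬝ᵥ a) :
    ((√(a ⬝ᵥ a))⁻¹ • a) ⬝ᵥ ((√(a ⬝ᵥ a))⁻¹ • a) = 1 := by
  rw [smul_dotProduct, dotProduct_smul, smul_smul, smul_eq_mul, ← mul_inv, Real.mul_self_sqrt h.le,
    inv_mul_cancel₀ h.ne']

theorem gramRow₀_dotProduct_gramRow₁ {M : Matrix (Fin 3) (Fin 3) ℝ} (h : M.det ≠ 0) :
    gramRow₀ M ⬝ᵥ gramRow₁ M = 0 := by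
  have h1 : gramRow₀ M ⬝ᵥ gramRow₀ M = 1 := inv_sqrt_smul_dotProduct (row_zero_pos_of_det_ne_zero h)
  have h2 : gramRow₀ M ⬝ᵥ gramPerp M = 0 := by
    rw [gramPerp, dotProduct_sub, dotProduct_smul, h1]
    simp
  rw [gramRow₁, dotProduct_smul, h2, smul_zero]

open Classical in
/-- The rotation whose first two rows are the Gram–Schmidt orthonormalisation of the first two rows
of an invertible matrix (and `1` for a singular matrix). -/
def gramSchmidtRotation (M : Matrix (Fin 3) (Fin 3) ℝ) : SO3 :=
  if h : M.det ≠ 0 then SO3.ofRows (gramRow₀ M) (gramRow₁ M)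
    (inv_sqrt_smul_dotProduct (row_zero_pos_of_det_ne_zero h))
    (inv_sqrt_smul_dotProduct (gramPerp_pos_of_det_ne_zero h)) (gramRow₀_dotProduct_gramRow₁ h)
  else 1

theorem gramSchmidtRotation_val {M : Matrix (Fin 3) (Fin 3) ℝ} (h : M.det ≠ 0) :
    (gramSchmidtRotation M).1 =
      .of ![gramRow₀ M, gramRow₁ M, crossProduct (gramRow₀ M) (gramRow₁ M)] := by
  rw [gramSchmidtRotation, dif_pos h]; rfl

theorem vecMul_dotProduct_vecMul (Θ : SO3) (a b : Fin 3 → ℝ) :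
    Matrix.vecMul a Θ.1 ⬝ᵥ Matrix.vecMul b Θ.1 = a ⬝ᵥ b := by
  rw [← Matrix.dotProduct_mulVec, ← Matrix.vecMul_transpose, Matrix.vecMul_vecMul, Θ.mul_transpose,
    Matrix.vecMul_one]

theorem gramRow₀_mul (M : Matrix (Fin 3) (Fin 3) ℝ) (Θ : SO3) :
    gramRow₀ (M * Θ.1) = Matrix.vecMul (gramRow₀ M) Θ.1 := by
  rw [gramRow₀, gramRow₀, Matrix.mul_apply_eq_vecMul, vecMul_dotProduct_vecMul, Matrix.smul_vecMul]

theorem gramPerp_mul (M : Matrix (Fin 3) (Fin 3) ℝ) (Θ : SO3) :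
    gramPerp (M * Θ.1) = Matrix.vecMul (gramPerp M) Θ.1 := by
  rw [gramPerp, gramPerp, gramRow₀_mul, Matrix.mul_apply_eq_vecMul, vecMul_dotProduct_vecMul,
    Matrix.sub_vecMul, Matrix.smul_vecMul]

theorem gramRow₁_mul (M : Matrix (Fin 3) (Fin 3) ℝ) (Θ : SO3) :
    gramRow₁ (M * Θ.1) = Matrix.vecMul (gramRow₁ M) Θ.1 := by
  rw [gramRow₁, gramRow₁, gramPerp_mul, vecMul_dotProduct_vecMul, Matrix.smul_vecMul]

/-- The Gram–Schmidt process is equivariant for rotations of `ℝ³`. -/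
theorem gramSchmidtRotation_mul {M : Matrix (Fin 3) (Fin 3) ℝ} (h : M.det ≠ 0) (Θ : SO3) :
    gramSchmidtRotation (M * Θ.1) = gramSchmidtRotation M * Θ := by
  have h' : (M * Θ.1).det ≠ 0 := by rwa [Matrix.det_mul, Θ.det_eq, mul_one]
  apply SO3.ext_rows
  · rw [gramSchmidtRotation_val h']
    change gramRow₀ _ = _
    rw [gramRow₀_mul, Submonoid.coe_mul, Matrix.mul_apply_eq_vecMul, gramSchmidtRotation_val h]
    rfl
  · rw [gramSchmidtRotation_val h']
    change gramRow₁ _ = _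
    rw [gramRow₁_mul, Submonoid.coe_mul, Matrix.mul_apply_eq_vecMul, gramSchmidtRotation_val h]
    rfl

theorem gramSchmidtRotation_smul {c : ℝ} (hc : 0 < c) (Θ : SO3) :
    gramSchmidtRotation (c • Θ.1) = Θ := by
  have hdet : (c • (1 : Matrix (Fin 3) (Fin 3) ℝ)).det ≠ 0 := by
    rw [Matrix.det_smul, Matrix.det_one]; simp [hc.ne']
  have h1 : gramSchmidtRotation (c • 1) = 1 := by
    have h0 : gramRow₀ (c • 1) = (1 : Matrix (Fin 3) (Fin 3) ℝ) 0 := by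
      have : (c • (1 : Matrix (Fin 3) (Fin 3) ℝ)) 0 ⬝ᵥ
          (c • (1 : Matrix (Fin 3) (Fin 3) ℝ)) 0 = c * c := by
        simp [dotProduct, Fin.sum_univ_three]
      rw [gramRow₀, this, Real.sqrt_mul_self hc.le]
      ext β
      simp [hc.ne']
    have hp : gramPerp (c • 1) = c • (1 : Matrix (Fin 3) (Fin 3) ℝ) 1 := by
      rw [gramPerp, h0]
      ext β
      simp [dotProduct, Fin.sum_univ_three]
    apply SO3.ext_rows
    · rw [gramSchmidtRotation_val hdet]
      exact h0
    · rw [gramSchmidtRotation_val hdet]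
      change gramRow₁ _ = _
      have : gramPerp (c • 1) ⬝ᵥ gramPerp (c • 1) = c * c := by
        rw [hp]
        simp [dotProduct, Fin.sum_univ_three]
      rw [gramRow₁, this, Real.sqrt_mul_self hc.le, hp, smul_smul, inv_mul_cancel₀ hc.ne', one_smul]
      rfl
  have h2 : c • Θ.1 = (c • 1) * Θ.1 := by rw [Matrix.smul_mul, Matrix.one_mul]
  rw [h2, gramSchmidtRotation_mul hdet, h1, one_mul]

theorem continuousAt_gramSchmidtRotation {M : Matrix (Fin 3) (Fin 3) ℝ} (h : M.det ≠ 0) :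
    ContinuousAt gramSchmidtRotation M := by
  rw [Topology.IsInducing.subtypeVal.continuousAt_iff]
  have hdet : Continuous fun M : Matrix (Fin 3) (Fin 3) ℝ => M.det := continuous_id.matrix_det
  have hrow : ∀ i, Continuous fun M : Matrix (Fin 3) (Fin 3) ℝ => M i := fun i => continuous_apply i
  have hdot : Continuous fun x : (Fin 3 → ℝ) × (Fin 3 → ℝ) => x.1 ⬝ᵥ x.2 :=
    continuous_fst.dotProduct continuous_snd
  have hnorm : ∀ {f : Matrix (Fin 3) (Fin 3) ℝ → Fin 3 → ℝ}, ContinuousAt f M → 0 < f M ⬝ᵥ f M →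
      ContinuousAt (fun N => (√(f N ⬝ᵥ f N))⁻¹ • f N) M := fun {f} hf hpos =>
    (((Real.continuous_sqrt.comp hdot).continuousAt.comp (f := fun N => (f N, f N))
      (hf.prodMk hf)).inv₀ (Real.sqrt_pos.mpr hpos).ne').smul hf
  have h0 : ContinuousAt gramRow₀ M :=
    hnorm (hrow 0).continuousAt (row_zero_pos_of_det_ne_zero h)
  have hp : ContinuousAt gramPerp M :=
    (hrow 1).continuousAt.sub ((hdot.continuousAt.comp (f := fun M => (gramRow₀ M, M 1))
      (h0.prodMk (hrow 1).continuousAt)).smul h0)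
  have h1 : ContinuousAt gramRow₁ M := hnorm hp (gramPerp_pos_of_det_ne_zero h)
  have hc : Continuous fun x : (Fin 3 → ℝ) × (Fin 3 → ℝ) => crossProduct x.1 x.2 := by
    simp only [cross_apply]
    fun_prop
  have h2 : ContinuousAt (fun M => crossProduct (gramRow₀ M) (gramRow₁ M)) M :=
    hc.continuousAt.comp (f := fun M => (gramRow₀ M, gramRow₁ M)) (h0.prodMk h1)
  have hall : ContinuousAt (fun M => (Matrix.of ![gramRow₀ M, gramRow₁ M,
      crossProduct (gramRow₀ M) (gramRow₁ M)] : Matrix (Fin 3) (Fin 3) ℝ)) M := by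
    refine continuousAt_pi.mpr fun i => ?_
    fin_cases i
    · exact h0
    · exact h1
    · exact h2
  refine hall.congr ?_
  filter_upwards [hdet.continuousAt.eventually_ne h] with N hN
  exact (gramSchmidtRotation_val hN).symm

/-! ### Lifting homotopies by a transport map -/

/-- Lifting of homotopies. Let `τ e b` transport a point `e` over `prj e` to the fibre over `b`
whenever `0 < D (prj e) b`, continuously and without moving `e` when `b = prj e`. A homotopy is
lifted by transporting in steps whose length `ε x` is so small that each step is admissible; the
length varies continuously with the parameter `x`, as the minimum over `t, t'` of a positive
function. -/
theorem exists_lift_of_transport {E B X : Type*} [TopologicalSpace E] [TopologicalSpace B]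
    [TopologicalSpace X] {prj : E → B} {τ : E → B → E} {D : B → B → ℝ}
    (hD : Continuous fun p : B × B => D p.1 p.2) (hD0 : ∀ b, 0 < D b b)
    (hτ : ∀ e b, 0 < D (prj e) b → ContinuousAt (fun p : E × B => τ p.1 p.2) (e, b))
    (hprj : ∀ e b, 0 < D (prj e) b → prj (τ e b) = b) (hid : ∀ e, τ e (prj e) = e)
    {H : X → ℝ → B} (hH : Continuous fun p : X × ℝ => H p.1 p.2) {f : X → E} (hf : Continuous f)
    (hf0 : ∀ x, prj (f x) = H x 0) :
    ∃ g : X → E, Continuous g ∧ ∀ x, prj (g x) = H x 1 := by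
  set K : Set (ℝ × ℝ) := Set.Icc 0 1 ×ˢ Set.Icc 0 1 with hK
  have hKc : IsCompact K := isCompact_Icc.prod isCompact_Icc
  -- positive everywhere, and equal to `|t - t'|` where transport between `t, t'` is not admissible
  let m : X → ℝ × ℝ → ℝ := fun x p => |p.1 - p.2| + max 0 (D (H x p.1) (H x p.2))
  have hm : Continuous fun q : X × (ℝ × ℝ) => m q.1 q.2 := by
    have h1 : Continuous fun q : X × (ℝ × ℝ) => (H q.1 q.2.1, H q.1 q.2.2) :=
      (hH.comp (f := fun q : X × (ℝ × ℝ) => (q.1, q.2.1)) (by fun_prop)).prodMk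
        (hH.comp (f := fun q : X × (ℝ × ℝ) => (q.1, q.2.2)) (by fun_prop))
    have h2 := hD.comp h1
    exact (by fun_prop : Continuous fun q : X × (ℝ × ℝ) => |q.2.1 - q.2.2|).add
      (continuous_const.max h2)
  have hmx : ∀ x, Continuous (m x) := fun x => hm.comp (Continuous.prodMk_right x)
  have hmpos : ∀ x p, 0 < m x p := by
    intro x p
    by_cases h : p.1 = p.2
    · have := hD0 (H x p.2)
      simp only [m, h, sub_self, abs_zero, zero_add]
      exact lt_max_of_lt_right this
    · exact add_pos_of_pos_of_nonneg (abs_pos.mpr (sub_ne_zero.mpr h)) (le_max_left _ _)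
  let ε : X → ℝ := fun x => sInf (m x '' K) / 2
  have hεc : Continuous ε := (hKc.continuous_sInf hm).div_const 2
  have hlow : ∀ x, ∀ p ∈ K, 2 * ε x ≤ m x p := by
    intro x p hp
    have : sInf (m x '' K) ≤ m x p :=
      csInf_le (hKc.image (hmx x)).bddBelow (Set.mem_image_of_mem _ hp)
    simp only [ε]
    linarith
  have hεpos : ∀ x, 0 < ε x := by
    intro x
    have hne : K.Nonempty := ⟨(0, 0), by simp [hK]⟩
    obtain ⟨p, -, h⟩ := hKc.exists_sInf_image_eq hne (hmx x).continuousOn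
    simp only [ε]
    rw [h]
    exact half_pos (hmpos x p)
  have hstep : ∀ x, ∀ t ∈ Set.Icc (0 : ℝ) 1, ∀ t' ∈ Set.Icc (0 : ℝ) 1, |t - t'| ≤ ε x →
      0 < D (H x t) (H x t') := by
    intro x t ht t' ht' h
    by_contra hneg
    have h1 := hlow x (t, t') ⟨ht, ht'⟩
    simp only [m, max_eq_left (not_lt.mp hneg), add_zero] at h1
    linarith [hεpos x]
  -- the lift `F k x` over the time `T k x` is obtained after `k` steps
  let T : ℕ → X → ℝ := fun k x => min (k * ε x) 1
  have hT : ∀ k x, T k x ∈ Set.Icc (0 : ℝ) 1 := fun k x =>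
    ⟨le_min (mul_nonneg k.cast_nonneg (hεpos x).le) zero_le_one, min_le_right _ _⟩
  have hTc : ∀ k, Continuous (T k) := fun k => (continuous_const.mul hεc).min continuous_const
  have hTT : ∀ k x, |T k x - T (k + 1) x| ≤ ε x := by
    intro k x
    refine (abs_min_sub_min_le_max _ _ _ _).trans (max_le ?_ ?_)
    · rw [← sub_mul, abs_mul, abs_of_pos (hεpos x)]
      simp
    · simpa using (hεpos x).le
  let F : ℕ → X → E := fun k => Nat.rec f (fun k g x => τ (g x) (H x (T (k + 1) x))) k
  have hFs : ∀ k x, F (k + 1) x = τ (F k x) (H x (T (k + 1) x)) := fun k x => rfl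
  have hFp : ∀ k x, prj (F k x) = H x (T k x) := by
    intro k
    induction k with
    | zero => intro x; simpa [F, T] using hf0 x
    | succ k ih =>
      intro x
      rw [hFs]
      apply hprj
      rw [ih]
      exact hstep x _ (hT k x) _ (hT (k + 1) x) (hTT k x)
  have hFc : ∀ k, Continuous (F k) := by
    intro k
    induction k with
    | zero => exact hf
    | succ k ih =>
      rw [continuous_iff_continuousAt]
      intro x
      have h1 : Continuous fun x => (F k x, H x (T (k + 1) x)) :=
        ih.prodMk (hH.comp (continuous_id.prodMk (hTc (k + 1))))
      refine ContinuousAt.comp (f := fun x => (F k x, H x (T (k + 1) x))) (hτ _ _ ?_)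
        h1.continuousAt
      rw [hFp]
      exact hstep x _ (hT k x) _ (hT (k + 1) x) (hTT k x)
  have hT1 : ∀ (k : ℕ) x, (ε x)⁻¹ ≤ k → T k x = 1 := by
    intro k x h
    refine min_eq_right ?_
    rwa [inv_le_iff_one_le_mul₀ (hεpos x)] at h
  have hstat : ∀ x (k l : ℕ), (ε x)⁻¹ ≤ k → k ≤ l → F l x = F k x := by
    intro x k l hk hkl
    induction l, hkl using Nat.le_induction with
    | base => rfl
    | succ l hkl ih =>
      have h1 : (ε x)⁻¹ ≤ (l : ℝ) := hk.trans (by exact_mod_cast hkl)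
      rw [hFs, hT1 (l + 1) x (h1.trans (by push_cast; linarith)), ← hT1 l x h1, ← hFp, hid, ih]
  -- the lifts are eventually constant in `k`, locally uniformly in `x`, so that the number of steps
  -- may depend on `x` discontinuously
  refine ⟨fun x => F ⌈(ε x)⁻¹⌉₊ x, ?_, fun x => ?_⟩
  · rw [continuous_iff_continuousAt]
    intro x₀
    obtain ⟨k, hk⟩ := exists_nat_gt (ε x₀)⁻¹
    have hev : ∀ᶠ x in 𝓝 x₀, (ε x)⁻¹ < k :=
      (hεc.continuousAt.inv₀ (hεpos x₀).ne').eventually (gt_mem_nhds hk)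
    refine (hFc k).continuousAt.congr (hev.mono fun x hx => ?_)
    exact hstat x _ k (Nat.le_ceil _) (Nat.ceil_le.mpr hx.le)
  · rw [hFp, hT1 _ _ (Nat.le_ceil _)]

section Manifold

variable {H : Type*} [TopologicalSpace H] {I : ModelWithCorners ℝ E7 H}
  {Y : Type*} [TopologicalSpace Y] [ChartedSpace H Y] [IsManifold I 1 Y]

namespace G2Structure

/-! ### Coframes -/

/-- A choice, not necessarily continuous, of an adapted coframe at each point of `Y`. -/
structure CoframeField (φ : G2Structure I Y) where
  /-- The coframe at a point. -/
  equiv : ∀ x : Y, TangentSpace I x ≃ₗ[ℝ] E7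
  form_eq : ∀ x u v w, φ.form x ![u, v, w] = stdForm (equiv x u) (equiv x v) (equiv x w)

variable {φ : G2Structure I Y}

variable (φ) in
/-- The coframes that define the metric and the cross product. -/
def coframeField : φ.CoframeField := ⟨φ.coframe, φ.coframe_spec⟩

/-- Two adapted coframes differ by a linear map that preserves `φ₀`. -/
theorem CoframeField.transition (C : φ.CoframeField) (x : Y) (a b c : E7) :
    stdForm (((φ.coframe x).symm.trans (C.equiv x)).toLinearMap a)
      (((φ.coframe x).symm.trans (C.equiv x)).toLinearMap b)
      (((φ.coframe x).symm.trans (C.equiv x)).toLinearMap c) = stdForm a b c := by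
  have h := (C.form_eq x ((φ.coframe x).symm a) ((φ.coframe x).symm b) ((φ.coframe x).symm c)).symm
  rw [coframe_spec] at h
  simpa using h

theorem CoframeField.metric_eq (C : φ.CoframeField) (x : Y) (u v : TangentSpace I x) :
    φ.metric x u v = inner ℝ (C.equiv x u) (C.equiv x v) := by
  have h := inner_map_of_map_stdForm (C.transition x) (φ.coframe x u) (φ.coframe x v)
  simp only [LinearEquiv.coe_coe, LinearEquiv.trans_apply, LinearEquiv.symm_apply_apply] at h
  rw [h, metric]

theorem CoframeField.equiv_cross (C : φ.CoframeField) (x : Y) (u v : TangentSpace I x) :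
    C.equiv x (φ.cross u v) = stdCross (C.equiv x u) (C.equiv x v) := by
  have h := stdCross_map_of_map_stdForm (C.transition x) (φ.coframe x u) (φ.coframe x v)
  simp only [LinearEquiv.coe_coe, LinearEquiv.trans_apply, LinearEquiv.symm_apply_apply] at h
  rw [← h, cross]

open Classical in
/-- An adapted trivialisation, extended by arbitrary adapted coframes outside of its base set. -/
def IsAdapted.coframeField {e : Trivialization E7 (TotalSpace.proj : TangentBundle I Y → Y)}
    (he : φ.IsAdapted e) : φ.CoframeField where
  equiv x := haveI := he.1
    if hx : x ∈ e.baseSet then e.linearEquivAt ℝ x hx else φ.coframe x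
  form_eq x u v w := by
    have := he.1
    by_cases hx : x ∈ e.baseSet
    · simp only [dif_pos hx]
      exact he.2 x hx u v w
    · simp only [dif_neg hx]
      exact φ.coframe_spec x u v w

theorem IsAdapted.coframeField_apply
    {e : Trivialization E7 (TotalSpace.proj : TangentBundle I Y → Y)} (he : φ.IsAdapted e) {x : Y}
    (hx : x ∈ e.baseSet) (v : TangentSpace I x) : he.coframeField.equiv x v = (e ⟨x, v⟩).2 := by
  simp only [IsAdapted.coframeField, dif_pos hx]
  rfl

/-- The components of an orthonormal pair with respect to adapted coframes. -/
def Stiefel.coord (C : φ.CoframeField) (q : φ.Stiefel) : StdStiefel :=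
  ⟨(C.equiv q.pt q.fst, C.equiv q.pt q.snd), by
    simp only [← C.metric_eq]
    exact ⟨q.fst_unit, q.snd_unit, q.orth⟩⟩

/-- The orthonormal pair at `x` with given components. -/
def Stiefel.ofCoord (C : φ.CoframeField) (x : Y) (p : StdStiefel) : φ.Stiefel where
  pt := x
  fst := (C.equiv x).symm p.1.1
  snd := (C.equiv x).symm p.1.2
  fst_unit := by rw [C.metric_eq, LinearEquiv.apply_symm_apply]; exact p.2.1
  snd_unit := by rw [C.metric_eq, LinearEquiv.apply_symm_apply]; exact p.2.2.1
  orth := by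
    rw [C.metric_eq, LinearEquiv.apply_symm_apply, LinearEquiv.apply_symm_apply]
    exact p.2.2.2

theorem Stiefel.coord_ofCoord (C : φ.CoframeField) (x : Y) (p : StdStiefel) :
    (ofCoord C x p).coord C = p :=
  Subtype.ext (Prod.ext ((C.equiv x).apply_symm_apply _) ((C.equiv x).apply_symm_apply _))

theorem Stiefel.ofCoord_coord (C : φ.CoframeField) (q : φ.Stiefel) :
    ofCoord C q.pt (q.coord C) = q := by
  simp [coord, ofCoord]

theorem Stiefel.ext_coord (C : φ.CoframeField) {q q' : φ.Stiefel} (h : q.pt = q'.pt)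
    (h' : q.coord C = q'.coord C) : q = q' := by
  rw [← ofCoord_coord C q, ← ofCoord_coord C q', h, h']

theorem Stiefel.frame_coord (C : φ.CoframeField) (q : φ.Stiefel) (α : Fin 3) :
    (q.coord C).frame α = C.equiv q.pt (q.frame α) := by
  fin_cases α
  · rfl
  · rfl
  · exact (C.equiv_cross _ _ _).symm

/-- The components of an associative plane with respect to adapted coframes. -/
def Assoc.coord (C : φ.CoframeField) (Q : φ.Assoc) : StdAssoc :=
  ⟨Q.plane.map (C.equiv Q.pt : TangentSpace I Q.pt →ₗ[ℝ] E7), by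
    rw [LinearEquiv.finrank_map_eq]
    exact Q.finrank_eq, by
    rintro _ ⟨u, hu, rfl⟩ _ ⟨v, hv, rfl⟩
    exact ⟨_, Q.cross_mem u hu v hv, C.equiv_cross _ u v⟩⟩

/-- The associative plane at `x` with given components. -/
def Assoc.ofCoord (C : φ.CoframeField) (x : Y) (T : StdAssoc) : φ.Assoc where
  pt := x
  plane := T.1.map ((C.equiv x).symm : E7 →ₗ[ℝ] TangentSpace I x)
  finrank_eq := by rw [LinearEquiv.finrank_map_eq]; exact T.2.1
  cross_mem := by
    rintro _ ⟨u, hu, rfl⟩ _ ⟨v, hv, rfl⟩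
    refine ⟨_, T.2.2 u hu v hv, (C.equiv x).injective ?_⟩
    simp [C.equiv_cross]

theorem Assoc.coord_ofCoord (C : φ.CoframeField) (x : Y) (T : StdAssoc) :
    (ofCoord C x T).coord C = T := by
  refine Subtype.ext ?_
  change Submodule.map (C.equiv x : TangentSpace I x →ₗ[ℝ] E7) (Submodule.map _ _) = _
  rw [← Submodule.map_comp]
  simp

theorem Assoc.ofCoord_coord (C : φ.CoframeField) (Q : φ.Assoc) :
    ofCoord C Q.pt (Q.coord C) = Q := by
  obtain ⟨x, P, h1, h2⟩ := Q
  simp only [ofCoord, coord, mk.injEq, true_and]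
  rw [← Submodule.map_comp]
  simp

theorem Assoc.ext_coord (C : φ.CoframeField) {Q Q' : φ.Assoc} (h : Q.pt = Q'.pt)
    (h' : Q.coord C = Q'.coord C) : Q = Q' := by
  rw [← ofCoord_coord C Q, ← ofCoord_coord C Q', h, h']

theorem Stiefel.coord_span (C : φ.CoframeField) (q : φ.Stiefel) :
    q.span.coord C = (q.coord C).span := by
  refine Subtype.ext ?_
  rw [← StdStiefel.span_frame]
  change Submodule.map (C.equiv q.pt : TangentSpace I q.pt →ₗ[ℝ] E7) (Submodule.span ℝ _) = _
  rw [Submodule.map_span, ← Set.range_comp]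
  congr 2
  ext1 α
  exact (frame_coord C q α).symm

theorem Stiefel.span_ofCoord (C : φ.CoframeField) (x : Y) (p : StdStiefel) :
    (ofCoord C x p).span = Assoc.ofCoord C x p.span :=
  Assoc.ext_coord C rfl (by rw [coord_span, coord_ofCoord, Assoc.coord_ofCoord])

theorem Stiefel.span_surjective : Function.Surjective (Stiefel.span : φ.Stiefel → φ.Assoc) := by
  intro Q
  obtain ⟨p, hp⟩ := StdStiefel.span_surjective (Q.coord φ.coframeField)
  exact ⟨ofCoord φ.coframeField Q.pt p, by rw [span_ofCoord, hp, Assoc.ofCoord_coord]⟩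

/-- The action of a rotation on the frame of an orthonormal pair. -/
def Stiefel.act (Θ : SO3) (q : φ.Stiefel) : φ.Stiefel :=
  ofCoord φ.coframeField q.pt (StdStiefel.act Θ (q.coord φ.coframeField))

theorem Stiefel.frame_act (Θ : SO3) (q : φ.Stiefel) (α : Fin 3) :
    (act Θ q).frame α = ∑ β, Θ.1 α β • q.frame β := by
  apply (φ.coframeField.equiv q.pt).injective
  refine (frame_coord φ.coframeField (act Θ q) α).symm.trans ?_
  rw [act, coord_ofCoord, StdStiefel.frame_act, map_sum]
  exact Finset.sum_congr rfl fun β _ => by rw [map_smul, frame_coord]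

theorem Stiefel.coord_act (C : φ.CoframeField) (Θ : SO3) (q : φ.Stiefel) :
    (act Θ q).coord C = StdStiefel.act Θ (q.coord C) := by
  have h : ∀ α, ((act Θ q).coord C).frame α = (StdStiefel.act Θ (q.coord C)).frame α := by
    intro α
    rw [frame_coord, frame_act, StdStiefel.frame_act]
    refine (map_sum (C.equiv q.pt) _ _).trans ?_
    exact Finset.sum_congr rfl fun β _ => by rw [map_smul, frame_coord]
  exact Subtype.ext (Prod.ext (h 0) (h 1))

theorem Stiefel.span_act (Θ : SO3) (q : φ.Stiefel) : (act Θ q).span = q.span := by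
  rw [act, span_ofCoord, StdStiefel.span_act, ← span_ofCoord, ofCoord_coord]

/-- The fibres of the fibrewise span are the orbits of `SO(3)`. -/
theorem Stiefel.exists_act_eq {q q' : φ.Stiefel} (h : q'.span = q.span) : ∃ Θ, act Θ q = q' := by
  have h' : (q'.coord φ.coframeField).span = (q.coord φ.coframeField).span := by
    rw [← coord_span, h, coord_span]
  obtain ⟨Θ, hΘ⟩ := StdStiefel.exists_act_eq h'
  refine ⟨Θ, ext_coord φ.coframeField (congrArg Assoc.pt h).symm ?_⟩
  rw [coord_act, hΘ]

end G2Structure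

theorem StdStiefel.act_mul (Θ Θ' : SO3) (p : StdStiefel) : act (Θ * Θ') p = act Θ (act Θ' p) := by
  have h : ∀ α, (act (Θ * Θ') p).frame α = (act Θ (act Θ' p)).frame α := by
    intro α
    simp only [frame_act, Submonoid.coe_mul, Matrix.mul_apply, Finset.sum_smul, Finset.smul_sum,
      smul_smul]
    exact Finset.sum_comm
  exact Subtype.ext (Prod.ext (h 0) (h 1))

namespace G2Structure

variable {φ : G2Structure I Y}

theorem Stiefel.act_mul (Θ Θ' : SO3) (q : φ.Stiefel) : act (Θ * Θ') q = act Θ (act Θ' q) :=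
  ext_coord φ.coframeField rfl (by rw [coord_act, coord_act, coord_act, StdStiefel.act_mul])

/-! ### Local triviality -/

/-- Continuity of a map to a bundle can be tested in the base and in a local trivialisation. -/
theorem _root_.Bundle.Trivialization.continuousAt_of_comp {Z X F : Type*} [TopologicalSpace Z]
    [TopologicalSpace X] [TopologicalSpace F] {E : Type*} [TopologicalSpace E] {prj : E → Z}
    (e : Trivialization F prj) {a : X → E} {x₀ : X} (h0 : prj (a x₀) ∈ e.baseSet)
    (h1 : ContinuousAt (fun x => prj (a x)) x₀) (h2 : ContinuousAt (fun x => (e (a x)).2) x₀) :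
    ContinuousAt a x₀ := by
  have hev : ∀ᶠ x in 𝓝 x₀, prj (a x) ∈ e.baseSet := h1.eventually (e.open_baseSet.mem_nhds h0)
  rw [e.toOpenPartialHomeomorph.continuousAt_iff_continuousAt_comp_left
    (hev.mono fun x hx => e.mem_source.mpr hx)]
  refine (h1.prodMk h2).congr (hev.mono fun x hx => ?_)
  exact Prod.ext (e.coe_fst' hx).symm rfl

theorem _root_.Bundle.Trivialization.continuousAt_snd {Z F : Type*} [TopologicalSpace Z]
    [TopologicalSpace F] {E : Type*} [TopologicalSpace E] {prj : E → Z}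
    (e : Trivialization F prj) {a : E} (h : prj a ∈ e.baseSet) :
    ContinuousAt (fun x => (e x).2) a :=
  continuous_snd.continuousAt.comp (e.continuousAt (e.mem_source.mpr h))

theorem Stiefel.isInducing : Topology.IsInducing (fun q : φ.Stiefel =>
    ((⟨q.pt, q.fst⟩ : TangentBundle I Y), (⟨q.pt, q.snd⟩ : TangentBundle I Y))) := ⟨rfl⟩

theorem Stiefel.continuous_fst : Continuous fun q : φ.Stiefel =>
    (⟨q.pt, q.fst⟩ : TangentBundle I Y) :=
  _root_.continuous_fst.comp isInducing.continuous

theorem Stiefel.continuous_snd : Continuous fun q : φ.Stiefel =>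
    (⟨q.pt, q.snd⟩ : TangentBundle I Y) :=
  _root_.continuous_snd.comp isInducing.continuous

theorem Stiefel.continuous_pt : Continuous (Stiefel.pt : φ.Stiefel → Y) :=
  (FiberBundle.continuous_proj E7 (TangentSpace I : Y → Type _)).comp Stiefel.continuous_fst

section

variable {e : Trivialization E7 (TotalSpace.proj : TangentBundle I Y → Y)} (he : φ.IsAdapted e)

theorem IsAdapted.continuousAt_coord {q : φ.Stiefel} (hq : q.pt ∈ e.baseSet) :
    ContinuousAt (Stiefel.coord he.coframeField) q := by
  refine (Topology.IsInducing.subtypeVal (Y := E7 × E7)).continuousAt_iff.mpr ?_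
  have h1 : ContinuousAt (fun q : φ.Stiefel => (e ⟨q.pt, q.fst⟩).2) q :=
    ContinuousAt.comp (f := fun q : φ.Stiefel => (⟨q.pt, q.fst⟩ : TangentBundle I Y))
      (e.continuousAt_snd (a := ⟨q.pt, q.fst⟩) hq) Stiefel.continuous_fst.continuousAt
  have h2 : ContinuousAt (fun q : φ.Stiefel => (e ⟨q.pt, q.snd⟩).2) q :=
    ContinuousAt.comp (f := fun q : φ.Stiefel => (⟨q.pt, q.snd⟩ : TangentBundle I Y))
      (e.continuousAt_snd (a := ⟨q.pt, q.snd⟩) hq) Stiefel.continuous_snd.continuousAt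
  refine (h1.prodMk h2).congr ?_
  filter_upwards [Stiefel.continuous_pt.continuousAt.eventually
    (e.open_baseSet.mem_nhds hq)] with r hr
  exact Prod.ext (he.coframeField_apply hr _).symm (he.coframeField_apply hr _).symm

theorem IsAdapted.continuousAt_of_coord {X : Type*} [TopologicalSpace X] {f : X → φ.Stiefel}
    {x₀ : X} (h0 : (f x₀).pt ∈ e.baseSet) (h1 : ContinuousAt (fun x => (f x).pt) x₀)
    (h2 : ContinuousAt (fun x => (f x).coord he.coframeField) x₀) : ContinuousAt f x₀ := by
  rw [Stiefel.isInducing.continuousAt_iff]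
  have hev := h1.eventually (e.open_baseSet.mem_nhds h0)
  have h3 := continuous_subtype_val.continuousAt.comp h2
  refine ContinuousAt.prodMk (e.continuousAt_of_comp h0 h1 ?_) (e.continuousAt_of_comp h0 h1 ?_)
  · exact (_root_.continuous_fst.continuousAt.comp h3).congr
      (hev.mono fun x hx => he.coframeField_apply hx _)
  · exact (_root_.continuous_snd.continuousAt.comp h3).congr
      (hev.mono fun x hx => he.coframeField_apply hx _)

end

theorem exists_isAdapted (x : Y) : ∃ e, φ.IsAdapted e ∧ x ∈ e.baseSet := by
  obtain ⟨e, h1, h2, h3⟩ := φ.exists_adapted x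
  exact ⟨e, ⟨h1, h3⟩, h2⟩

theorem Stiefel.continuous_act : Continuous fun p : SO3 × φ.Stiefel => act p.1 p.2 := by
  rw [continuous_iff_continuousAt]
  rintro ⟨Θ, q⟩
  obtain ⟨e, he, hq⟩ := exists_isAdapted (φ := φ) q.pt
  refine he.continuousAt_of_coord hq (continuous_pt.comp _root_.continuous_snd).continuousAt ?_
  simp only [coord_act]
  exact StdStiefel.continuous_act.continuousAt.comp
    (f := fun p : SO3 × φ.Stiefel => (p.1, p.2.coord he.coframeField))
    (_root_.continuous_fst.continuousAt.prodMk
      ((he.continuousAt_coord hq).comp_of_eq _root_.continuous_snd.continuousAt rfl))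

theorem Stiefel.continuous_span : Continuous (Stiefel.span : φ.Stiefel → φ.Assoc) :=
  continuous_coinduced_rng

/-- The fibrewise span is an open map, as the quotient map of the action of `SO(3)`. -/
theorem Stiefel.isOpenMap_span : IsOpenMap (Stiefel.span : φ.Stiefel → φ.Assoc) := by
  intro O hO
  have hq : Topology.IsQuotientMap (Stiefel.span : φ.Stiefel → φ.Assoc) := ⟨⟨rfl⟩, span_surjective⟩
  rw [← hq.isOpen_preimage]
  have h : Stiefel.span ⁻¹' (Stiefel.span '' O) = ⋃ Θ, act Θ ⁻¹' O := by
    ext p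
    simp only [Set.mem_preimage, Set.mem_image, Set.mem_iUnion]
    constructor
    · rintro ⟨q, hq, h⟩
      obtain ⟨Θ, hΘ⟩ := exists_act_eq h
      exact ⟨Θ, hΘ ▸ hq⟩
    · rintro ⟨Θ, h⟩
      exact ⟨_, h, span_act Θ p⟩
  rw [h]
  exact isOpen_iUnion fun Θ => hO.preimage (continuous_act.comp (Continuous.prodMk_right Θ))

/-- Continuity can be tested after composition with an open map. -/
theorem _root_.IsOpenMap.continuousAt_of_comp {A B Z : Type*} [TopologicalSpace A]
    [TopologicalSpace B] [TopologicalSpace Z] {s : A → B} (hs : IsOpenMap s) {g : B → Z} {a : A}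
    (h : ContinuousAt (fun x => g (s x)) a) : ContinuousAt g (s a) :=
  Filter.Tendsto.mono_left (Filter.tendsto_map'_iff.mpr h) (hs.nhds_le a)

theorem Assoc.continuous_pt : Continuous (Assoc.pt : φ.Assoc → Y) :=
  continuous_coinduced_dom.mpr Stiefel.continuous_pt

/-- The local trivialisation of `𝒱₂(TY)` induced by an adapted one of `TY`. -/
def IsAdapted.stiefelTrivialization
    {e : Trivialization E7 (TotalSpace.proj : TangentBundle I Y → Y)} (he : φ.IsAdapted e) :
    Trivialization StdStiefel (Stiefel.pt : φ.Stiefel → Y) where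
  toFun q := (q.pt, q.coord he.coframeField)
  invFun p := Stiefel.ofCoord he.coframeField p.1 p.2
  source := Stiefel.pt ⁻¹' e.baseSet
  target := e.baseSet ×ˢ Set.univ
  map_source' q hq := ⟨hq, trivial⟩
  map_target' p hp := hp.1
  left_inv' q _ := Stiefel.ofCoord_coord _ q
  right_inv' p _ := Prod.ext rfl (Stiefel.coord_ofCoord _ _ _)
  open_source := e.open_baseSet.preimage Stiefel.continuous_pt
  open_target := e.open_baseSet.prod isOpen_univ
  continuousOn_toFun q hq :=
    (Stiefel.continuous_pt.continuousAt.prodMk (he.continuousAt_coord hq)).continuousWithinAt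
  continuousOn_invFun p hp := by
    refine ContinuousAt.continuousWithinAt (he.continuousAt_of_coord hp.1 continuous_fst.continuousAt ?_)
    simp only [Stiefel.coord_ofCoord]
    exact continuous_snd.continuousAt
  baseSet := e.baseSet
  open_baseSet := e.open_baseSet
  source_eq := rfl
  target_eq := rfl
  proj_toFun _ _ := rfl

/-- The local trivialisation of `𝒢(φ)` induced by an adapted one of `TY`. -/
def IsAdapted.assocTrivialization
    {e : Trivialization E7 (TotalSpace.proj : TangentBundle I Y → Y)} (he : φ.IsAdapted e) :
    Trivialization StdAssoc (Assoc.pt : φ.Assoc → Y) where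
  toFun Q := (Q.pt, Q.coord he.coframeField)
  invFun p := Assoc.ofCoord he.coframeField p.1 p.2
  source := Assoc.pt ⁻¹' e.baseSet
  target := e.baseSet ×ˢ Set.univ
  map_source' q hq := ⟨hq, trivial⟩
  map_target' p hp := hp.1
  left_inv' q _ := Assoc.ofCoord_coord _ q
  right_inv' p _ := Prod.ext rfl (Assoc.coord_ofCoord _ _ _)
  open_source := e.open_baseSet.preimage Assoc.continuous_pt
  open_target := e.open_baseSet.prod isOpen_univ
  continuousOn_toFun Q hQ := by
    obtain ⟨q, rfl⟩ := Stiefel.span_surjective Q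
    refine ContinuousAt.continuousWithinAt (Stiefel.isOpenMap_span.continuousAt_of_comp ?_)
    simp only [Stiefel.coord_span]
    exact Stiefel.continuous_pt.continuousAt.prodMk
      (StdStiefel.isQuotientMap_span.continuous.continuousAt.comp (he.continuousAt_coord hQ))
  continuousOn_invFun p hp := by
    obtain ⟨x, T⟩ := p
    obtain ⟨p, rfl⟩ := StdStiefel.span_surjective T
    refine ContinuousAt.continuousWithinAt
      ((IsOpenMap.id.prodMap StdStiefel.isOpenMap_span).continuousAt_of_comp (a := (x, p)) ?_)
    change ContinuousAt (fun r : Y × StdStiefel => Assoc.ofCoord he.coframeField r.1 r.2.span) (x, p)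
    simp only [← Stiefel.span_ofCoord]
    refine Stiefel.continuous_span.continuousAt.comp
      (he.continuousAt_of_coord hp.1 continuous_fst.continuousAt ?_)
    simp only [Stiefel.coord_ofCoord]
    exact continuous_snd.continuousAt
  baseSet := e.baseSet
  open_baseSet := e.open_baseSet
  source_eq := rfl
  target_eq := rfl
  proj_toFun _ _ := rfl

end G2Structure

end Manifold

/-! ### Inner products of two frames -/

theorem SO3.inv_val (Θ : SO3) : (Θ⁻¹).1 = Θ.1.transpose := rfl

/-- The matrix of inner products of the frames of two orthonormal pairs. -/
def StdStiefel.gram (p q : StdStiefel) : Matrix (Fin 3) (Fin 3) ℝ :=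
  .of fun α β => inner ℝ (p.frame α) (q.frame β)

namespace StdStiefel

theorem act_one (p : StdStiefel) : act 1 p = p := by
  have h : ∀ α, (act 1 p).frame α = p.frame α := fun α => by
    rw [frame_act]
    simp [Matrix.one_apply]
  exact Subtype.ext (Prod.ext (h 0) (h 1))

theorem gram_self (p : StdStiefel) : gram p p = 1 := by
  ext α β
  rw [gram, Matrix.of_apply, inner_frame, Matrix.one_apply]

theorem gram_act_left (Θ : SO3) (p q : StdStiefel) : gram (act Θ p) q = Θ.1 * gram p q := by
  ext α β
  simp [gram, frame_act, Matrix.mul_apply, sum_inner, inner_smul_left]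

theorem gram_act_right (Θ : SO3) (p q : StdStiefel) : gram p (act Θ q) = gram p q * (Θ⁻¹).1 := by
  ext α β
  simp [gram, frame_act, Matrix.mul_apply, inner_sum, inner_smul_right, SO3.inv_val, mul_comm]

theorem continuous_gram : Continuous fun x : StdStiefel × StdStiefel => gram x.1 x.2 :=
  continuous_matrix fun α β => ((continuous_frame α).comp continuous_fst).inner
    ((continuous_frame β).comp continuous_snd)

end StdStiefel

section Manifold

variable {H : Type*} [TopologicalSpace H] {I : ModelWithCorners ℝ E7 H}
  {Y : Type*} [TopologicalSpace Y] [ChartedSpace H Y] [IsManifold I 1 Y]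

namespace G2Structure

variable {φ : G2Structure I Y}

/-! ### Transport between fibres over different points -/

theorem paracompact_normal_of_manifold {H : Type*} [TopologicalSpace H]
    (I : ModelWithCorners ℝ E7 H) (Y : Type*) [TopologicalSpace Y] [ChartedSpace H Y] [T2Space Y]
    [SecondCountableTopology Y] : ParacompactSpace Y ∧ NormalSpace Y := by
  have := Manifold.locallyCompact_of_finiteDimensional (M := Y) I
  have : SigmaCompactSpace Y := inferInstance
  exact ⟨inferInstance, inferInstance⟩

/-- A continuous matrix `M q q'` that compares the frames of orthonormal pairs at possibly different
points of `Y` and is equivariant for the rotations of both. It is glued from the matrices of inner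
products in local trivialisations by a partition of unity. -/
theorem exists_gram [T2Space Y] [SecondCountableTopology Y] (φ : G2Structure I Y) :
    ∃ M : φ.Stiefel → φ.Stiefel → Matrix (Fin 3) (Fin 3) ℝ,
      Continuous (fun x : φ.Stiefel × φ.Stiefel => M x.1 x.2) ∧
      (∀ Θ q q', M (q.act Θ) q' = Θ.1 * M q q') ∧
      (∀ Θ q q', M q (q'.act Θ) = M q q' * (Θ⁻¹).1) ∧
      ∀ q, ∃ c : ℝ, 0 < c ∧ M q q = c • 1 := by
  obtain ⟨_, _⟩ := paracompact_normal_of_manifold I Y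
  choose e he hx using fun x : Y => exists_isAdapted (φ := φ) x
  obtain ⟨ρ, hρ⟩ := PartitionOfUnity.exists_isSubordinate isClosed_univ
    (fun x : Y => (e x).baseSet) (fun x => (e x).open_baseSet)
    (fun x _ => Set.mem_iUnion.mpr ⟨x, hx x⟩)
  let N : Y → φ.Stiefel → φ.Stiefel → Matrix (Fin 3) (Fin 3) ℝ := fun i q q' =>
    (q.coord (he i).coframeField).gram (q'.coord (he i).coframeField)
  let t : Y → φ.Stiefel → φ.Stiefel → Matrix (Fin 3) (Fin 3) ℝ := fun i q q' =>
    (ρ i q.pt * ρ i q'.pt) • N i q q'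
  have hfin : ∀ q q', (Function.support fun i => t i q q').Finite := fun q q' => by
    refine (ρ.locallyFinite.point_finite q.pt).subset fun i hi => ?_
    rw [Function.mem_support] at hi
    simp only [Set.mem_ofPred_eq, Function.mem_support]
    intro h0
    exact hi (by simp only [t, h0, zero_mul, zero_smul])
  have htc : ∀ i, Continuous fun x : φ.Stiefel × φ.Stiefel => t i x.1 x.2 := by
    intro i
    have hc : ∀ {f : φ.Stiefel × φ.Stiefel → φ.Stiefel}, Continuous f →
        Continuous fun x => ρ i (f x).pt := fun hf =>
      (ρ i).continuous.comp (Stiefel.continuous_pt.comp hf)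
    rw [continuous_iff_continuousAt]
    rintro ⟨q, q'⟩
    -- the term vanishes near `(q, q')` unless both points lie in the domain of the trivialisation
    have hz : ∀ {y : Y}, y ∉ tsupport (ρ i) → ∀ᶠ z in 𝓝 y, ρ i z = 0 := fun h =>
      notMem_tsupport_iff_eventuallyEq.mp h
    by_cases h : q.pt ∈ tsupport (ρ i)
    · by_cases h' : q'.pt ∈ tsupport (ρ i)
      · refine ContinuousAt.smul
          ((hc continuous_fst).continuousAt.mul (hc continuous_snd).continuousAt) ?_
        exact StdStiefel.continuous_gram.continuousAt.comp
          (f := fun x : φ.Stiefel × φ.Stiefel =>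
            (x.1.coord (he i).coframeField, x.2.coord (he i).coframeField))
          ((((he i).continuousAt_coord (hρ i h)).comp_of_eq continuous_fst.continuousAt rfl).prodMk
            (((he i).continuousAt_coord (hρ i h')).comp_of_eq continuous_snd.continuousAt rfl))
      · refine (continuousAt_const (y := 0)).congr ?_
        filter_upwards [((Stiefel.continuous_pt.comp continuous_snd).continuousAt
          (x := (q, q'))).eventually (hz h')] with x hx
        simp only [t]
        rw [show ρ i x.2.pt = 0 from hx, mul_zero, zero_smul]
    · refine (continuousAt_const (y := 0)).congr ?_
      filter_upwards [((Stiefel.continuous_pt.comp continuous_fst).continuousAt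
          (x := (q, q'))).eventually (hz h)] with x hx
      simp only [t]
      rw [show ρ i x.1.pt = 0 from hx, zero_mul, zero_smul]
  refine ⟨fun q q' => ∑ᶠ i, t i q q', ?_, ?_, ?_, ?_⟩
  · refine continuous_finsum htc ?_
    refine (ρ.locallyFinite.preimage_continuous
      (Stiefel.continuous_pt.comp (continuous_fst (X := φ.Stiefel) (Y := φ.Stiefel)))).subset ?_
    intro i x hx
    rw [Function.mem_support] at hx
    simp only [Set.mem_preimage, Function.mem_support, Function.comp]
    intro h0
    exact hx (by simp only [t, h0, zero_mul, zero_smul])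
  · intro Θ q q'
    refine Eq.trans ?_ (((AddMonoidHom.mulLeft Θ.1).map_finsum (hfin q q')).symm)
    refine finsum_congr fun i => ?_
    simp only [t, N, AddMonoidHom.coe_mulLeft, Stiefel.coord_act, StdStiefel.gram_act_left,
      Matrix.mul_smul]
    rfl
  · intro Θ q q'
    refine Eq.trans ?_ (((AddMonoidHom.mulRight (Θ⁻¹).1).map_finsum (hfin q q')).symm)
    refine finsum_congr fun i => ?_
    simp only [t, N, AddMonoidHom.coe_mulRight, Stiefel.coord_act, StdStiefel.gram_act_right,
      Matrix.smul_mul]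
    rfl
  · intro q
    have hs : (Function.support fun i => ρ i q.pt * ρ i q.pt).Finite :=
      (ρ.locallyFinite.point_finite q.pt).subset fun i hi h0 => hi (by
        change ρ i q.pt * ρ i q.pt = 0
        rw [show ρ i q.pt = 0 from h0, zero_mul])
    refine ⟨∑ᶠ i, ρ i q.pt * ρ i q.pt, ?_, ?_⟩
    · obtain ⟨i, hi⟩ := ρ.exists_pos (Set.mem_univ q.pt)
      exact finsum_pos (fun j => mul_self_nonneg _) ⟨i, mul_pos hi hi⟩ hs
    · rw [finsum_smul]
      exact finsum_congr fun i => by simp only [t, N, StdStiefel.gram_self]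

theorem Stiefel.act_one (q : φ.Stiefel) : q.act 1 = q :=
  ext_coord φ.coframeField rfl (by rw [coord_act, StdStiefel.act_one])

/-- The data that make `𝒱₂(TY) → 𝒢(φ)` a fibration: a rotation `δ q q'` that depends continuously on
two orthonormal pairs in the same plane and takes `q'` to `q`; and a transport `τ` of orthonormal
pairs to nearby planes, possibly at other points, where nearness is expressed by positivity of a
continuous function `D`. -/
theorem exists_transport [T2Space Y] [SecondCountableTopology Y] (φ : G2Structure I Y) :
    ∃ (D : φ.Assoc → φ.Assoc → ℝ) (τ : φ.Stiefel → φ.Assoc → φ.Stiefel)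
      (δ : φ.Stiefel → φ.Stiefel → SO3),
      Continuous (fun x : φ.Assoc × φ.Assoc => D x.1 x.2) ∧ (∀ Q, 0 < D Q Q) ∧
      (∀ q Q, 0 < D q.span Q → ContinuousAt (fun x : φ.Stiefel × φ.Assoc => τ x.1 x.2) (q, Q)) ∧
      (∀ q Q, 0 < D q.span Q → (τ q Q).span = Q) ∧ (∀ q, τ q q.span = q) ∧
      (∀ Θ q, δ (q.act Θ) q = Θ) ∧
      (∀ q q', q.span = q'.span →
        ContinuousAt (fun x : φ.Stiefel × φ.Stiefel => δ x.1 x.2) (q, q')) := by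
  obtain ⟨M, hMc, hMl, hMr, hM1⟩ := exists_gram φ
  -- `l` lifts planes to orthonormal pairs, without continuity; by equivariance, neither `D` nor `τ`
  -- below depends on this choice
  let l : φ.Assoc → φ.Stiefel := Function.surjInv Stiefel.span_surjective
  have hl : ∀ Q, (l Q).span = Q := Function.surjInv_eq Stiefel.span_surjective
  have hdet : ∀ Θ : SO3, (Θ.1).det = 1 := SO3.det_eq
  have hD : ∀ q q', (M (l q.span) (l q'.span)).det = (M q q').det := by
    intro q q'
    obtain ⟨Θ, h⟩ := Stiefel.exists_act_eq (hl q.span)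
    obtain ⟨Θ', h'⟩ := Stiefel.exists_act_eq (hl q'.span)
    rw [← h, ← h', hMl, hMr, Matrix.det_mul, Matrix.det_mul, hdet, hdet, one_mul, mul_one]
  have hτ : ∀ q q', (M q q').det ≠ 0 → (l q'.span).act (gramSchmidtRotation (M q (l q'.span))) =
      q'.act (gramSchmidtRotation (M q q')) := by
    intro q q' h
    obtain ⟨Θ, h'⟩ := Stiefel.exists_act_eq (hl q'.span)
    rw [← h', hMr, gramSchmidtRotation_mul h, ← Stiefel.act_mul, inv_mul_cancel_right]
  have hMdet : Continuous fun x : φ.Stiefel × φ.Stiefel => (M x.1 x.2).det := hMc.matrix_det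
  have hself : ∀ q, 0 < (M q q).det := fun q => by
    obtain ⟨c, hc, h⟩ := hM1 q
    rw [h, Matrix.det_smul, Matrix.det_one, mul_one]
    positivity
  refine ⟨fun Q Q' => (M (l Q) (l Q')).det, fun q Q => (l Q).act (gramSchmidtRotation (M q (l Q))),
    fun q q' => gramSchmidtRotation (M q q'), ?_, ?_, ?_, ?_, ?_, ?_, ?_⟩
  · rw [continuous_iff_continuousAt]
    rintro ⟨Q, Q'⟩
    rw [← hl Q, ← hl Q']
    refine (Stiefel.isOpenMap_span.prodMap Stiefel.isOpenMap_span).continuousAt_of_comp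
      (a := (l Q, l Q')) ?_
    refine hMdet.continuousAt.congr (Filter.Eventually.of_forall fun x => ?_)
    exact (hD x.1 x.2).symm
  · intro Q
    exact hself _
  · intro q Q hpos
    obtain ⟨q', rfl⟩ := Stiefel.span_surjective Q
    have hpos' : 0 < (M q q').det := by rw [← hD]; exact hpos
    refine (IsOpenMap.id.prodMap Stiefel.isOpenMap_span).continuousAt_of_comp (a := (q, q')) ?_
    have hc : ContinuousAt (fun x : φ.Stiefel × φ.Stiefel =>
        x.2.act (gramSchmidtRotation (M x.1 x.2))) (q, q') :=
      Stiefel.continuous_act.continuousAt.comp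
        (f := fun x : φ.Stiefel × φ.Stiefel => (gramSchmidtRotation (M x.1 x.2), x.2))
        (((continuousAt_gramSchmidtRotation hpos'.ne').comp
          (f := fun x : φ.Stiefel × φ.Stiefel => M x.1 x.2) (x := (q, q'))
          hMc.continuousAt).prodMk continuous_snd.continuousAt)
    refine hc.congr ?_
    filter_upwards [(hMdet.continuousAt (x := (q, q'))).eventually (lt_mem_nhds hpos')] with x hx
    exact (hτ x.1 x.2 hx.ne').symm
  · intro q Q _
    rw [Stiefel.span_act, hl]
  · intro q
    obtain ⟨c, hc, h⟩ := hM1 q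
    change (l q.span).act _ = q
    rw [hτ q q (hself q).ne', h, ← Submonoid.coe_one, gramSchmidtRotation_smul hc, Stiefel.act_one]
  · intro Θ q
    obtain ⟨c, hc, h⟩ := hM1 q
    change gramSchmidtRotation (M (q.act Θ) q) = Θ
    rw [hMl, h, Matrix.mul_smul, Matrix.mul_one, gramSchmidtRotation_smul hc]
  · intro q q' h
    have hne : (M q q').det ≠ 0 := by
      rw [← hD, h, hD]; exact (hself q').ne'
    exact (continuousAt_gramSchmidtRotation hne).comp
      (f := fun x : φ.Stiefel × φ.Stiefel => M x.1 x.2) (x := (q, q')) hMc.continuousAt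

end G2Structure

end Manifold

/-! ### Almost contact metric 3-structures and orthonormal pairs -/

namespace StdStiefel

/-- The endomorphisms `J¹ = u ×`, `J² = v ×`, `J³ = J¹ J² - u ⊗ ⟨v, ·⟩` of `ℝ⁷` attached to an
orthonormal pair `(u, v)`. The third one differs from `(u × v) ×`, as the cross product of `ℝ⁷` does
not come from an associative algebra. -/
def endo (p : StdStiefel) : Fin 3 → E7 →ₗ[ℝ] E7 :=
  ![stdCrossₗ p.1.1, stdCrossₗ p.1.2,
    stdCrossₗ p.1.1 ∘ₗ stdCrossₗ p.1.2 - (innerₗ E7 p.1.2).smulRight p.1.1]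

theorem endo_two_apply (p : StdStiefel) (u : E7) : p.endo 2 u =
    stdCross p.1.1 (stdCross p.1.2 u) - (inner ℝ p.1.2 u : ℝ) • p.1.1 := rfl

theorem frame_map (A : G2) (p : StdStiefel) (α : Fin 3) :
    (p.map A).frame α = G2.toLin A (p.frame α) := by
  fin_cases α
  · rfl
  · rfl
  · exact (G2.toLin_stdCross A _ _).symm

theorem endo_map (A : G2) (p : StdStiefel) (α : Fin 3) (u : E7) :
    (p.map A).endo α (G2.toLin A u) = G2.toLin A (p.endo α u) := by
  fin_cases α
  · exact (G2.toLin_stdCross A _ _).symm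
  · exact (G2.toLin_stdCross A _ _).symm
  · change (p.map A).endo 2 _ = G2.toLin A (p.endo 2 u)
    rw [endo_two_apply, endo_two_apply, map_sub, map_smul, G2.toLin_stdCross, G2.toLin_stdCross]
    simp only [map, G2.toLin_inner]

theorem frame_basePair (α : Fin 3) : basePair.frame α = stdBasis (![0, 1, 6] α) := by
  fin_cases α
  · rfl
  · rfl
  · exact G2.stdCross_stdBasis_zero_one

theorem endo_basePair (α : Fin 3) (u : E7) : basePair.endo α u = WithLp.toLp 2
    (![![0, -u 6, -u 4, u 5, u 2, -u 3, u 1], ![u 6, 0, u 5, u 4, -u 3, -u 2, -u 0],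
      ![-u 1, u 0, u 3, -u 2, u 5, -u 4, 0]] α) := by
  have h0 : ∀ w : E7, stdCross (stdBasis 0) w =
      WithLp.toLp 2 ![0, -w 6, -w 4, w 5, w 2, -w 3, w 1] := fun w => by
    ext k; rw [stdCross_apply]; fin_cases k <;> simp [stdBasis]
  have h1 : ∀ w : E7, stdCross (stdBasis 1) w =
      WithLp.toLp 2 ![w 6, 0, w 5, w 4, -w 3, -w 2, -w 0] := fun w => by
    ext k; rw [stdCross_apply]; fin_cases k <;> simp [stdBasis]
  fin_cases α
  · exact h0 u
  · exact h1 u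
  · change basePair.endo 2 u = _
    rw [endo_two_apply]
    simp only [basePair, h0, h1, inner_stdBasis_left]
    ext k
    fin_cases k <;> simp [stdBasis]

/-- An identity in the frame, the endomorphisms and two vectors that is invariant under `G₂` holds
for all orthonormal pairs as soon as it holds for `(e₀, e₁)`. -/
theorem induction_basePair {P : StdStiefel → E7 → E7 → Prop}
    (hP : ∀ A p u v, P p u v → P (p.map A) (G2.toLin A u) (G2.toLin A v))
    (h : ∀ u v, P basePair u v) (p : StdStiefel) (u v : E7) : P p u v := by
  obtain ⟨A, rfl⟩ := exists_map_basePair p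
  rw [← G2.toLin_toLin_inv A u, ← G2.toLin_toLin_inv A v]
  exact hP A _ _ _ (h _ _)

theorem endo_endo (p : StdStiefel) (α : Fin 3) (u : E7) : p.endo α (p.endo α u) =
    -u + (inner ℝ (p.frame α) u : ℝ) • p.frame α := by
  refine induction_basePair (P := fun p u _ => p.endo α (p.endo α u) =
    -u + (inner ℝ (p.frame α) u : ℝ) • p.frame α) (fun A p u _ h => ?_) (fun u _ => ?_) p u u
  · rw [endo_map, endo_map, h, frame_map, G2.toLin_inner, map_add, map_neg, map_smul]
  · ext k
    rw [endo_basePair, endo_basePair, frame_basePair, inner_stdBasis_left]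
    fin_cases α <;> fin_cases k <;> simp [stdBasis]

theorem inner_endo (p : StdStiefel) (α : Fin 3) (u v : E7) :
    (inner ℝ (p.endo α u) (p.endo α v) : ℝ) =
      inner ℝ u v - inner ℝ (p.frame α) u * inner ℝ (p.frame α) v := by
  refine induction_basePair (P := fun p u v => (inner ℝ (p.endo α u) (p.endo α v) : ℝ) =
      inner ℝ u v - inner ℝ (p.frame α) u * inner ℝ (p.frame α) v)
      (fun A p u v h => ?_) (fun u v => ?_) p u v
  · rw [endo_map, endo_map, frame_map, G2.toLin_inner, G2.toLin_inner, G2.toLin_inner,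
      G2.toLin_inner, h]
  · rw [endo_basePair, endo_basePair, frame_basePair, inner_stdBasis_left, inner_stdBasis_left,
      inner_E7, inner_E7]
    fin_cases α <;> simp <;> ring

theorem endo_mul (p : StdStiefel) (α : Fin 3) (u : E7) : p.endo (α + 2) u =
    p.endo α (p.endo (α + 1) u) - (inner ℝ (p.frame (α + 1)) u : ℝ) • p.frame α := by
  refine induction_basePair (P := fun p u _ => p.endo (α + 2) u =
    p.endo α (p.endo (α + 1) u) - (inner ℝ (p.frame (α + 1)) u : ℝ) • p.frame α)
    (fun A p u _ h => ?_) (fun u _ => ?_) p u u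
  · rw [endo_map, endo_map, endo_map, h, frame_map, frame_map, G2.toLin_inner, map_sub, map_smul]
  · ext k
    rw [endo_basePair, endo_basePair, endo_basePair, frame_basePair, frame_basePair,
      inner_stdBasis_left]
    fin_cases α <;> fin_cases k <;> simp [stdBasis]

theorem endo_mul' (p : StdStiefel) (α : Fin 3) (u : E7) : p.endo (α + 2) u =
    -p.endo (α + 1) (p.endo α u) + (inner ℝ (p.frame α) u : ℝ) • p.frame (α + 1) := by
  refine induction_basePair (P := fun p u _ => p.endo (α + 2) u =
    -p.endo (α + 1) (p.endo α u) + (inner ℝ (p.frame α) u : ℝ) • p.frame (α + 1))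
    (fun A p u _ h => ?_) (fun u _ => ?_) p u u
  · rw [endo_map, endo_map, endo_map, h, frame_map, frame_map, G2.toLin_inner, map_add, map_neg,
      map_smul]
  · ext k
    rw [endo_basePair, endo_basePair, endo_basePair, frame_basePair, frame_basePair,
      inner_stdBasis_left]
    fin_cases α <;> fin_cases k <;> simp [stdBasis]

theorem endo_frame (p : StdStiefel) (α : Fin 3) : p.endo α (p.frame (α + 1)) = p.frame (α + 2) := by
  refine induction_basePair (P := fun p _ _ => p.endo α (p.frame (α + 1)) = p.frame (α + 2))
    (fun A p _ _ h => ?_) (fun _ _ => ?_) p 0 0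
  · rw [frame_map, frame_map, endo_map, h]
  · ext k
    rw [endo_basePair, frame_basePair, frame_basePair]
    fin_cases α <;> fin_cases k <;> simp [stdBasis]

theorem endo_frame' (p : StdStiefel) (α : Fin 3) :
    p.endo (α + 1) (p.frame α) = -p.frame (α + 2) := by
  refine induction_basePair (P := fun p _ _ => p.endo (α + 1) (p.frame α) = -p.frame (α + 2))
    (fun A p _ _ h => ?_) (fun _ _ => ?_) p 0 0
  · rw [frame_map, frame_map, endo_map, h, map_neg]
  · ext k
    rw [endo_basePair, frame_basePair, frame_basePair]
    fin_cases α <;> fin_cases k <;> simp [stdBasis]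

theorem inner_frame_endo (p : StdStiefel) (α : Fin 3) (u : E7) :
    (inner ℝ (p.frame α) (p.endo (α + 1) u) : ℝ) = inner ℝ (p.frame (α + 2)) u := by
  refine induction_basePair (P := fun p u _ => (inner ℝ (p.frame α) (p.endo (α + 1) u) : ℝ) =
    inner ℝ (p.frame (α + 2)) u) (fun A p u _ h => ?_) (fun u _ => ?_) p u u
  · rw [frame_map, frame_map, endo_map, G2.toLin_inner, G2.toLin_inner, h]
  · rw [endo_basePair, frame_basePair, frame_basePair, inner_stdBasis_left, inner_stdBasis_left]
    fin_cases α <;> simp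

theorem inner_frame_endo' (p : StdStiefel) (α : Fin 3) (u : E7) :
    (inner ℝ (p.frame (α + 1)) (p.endo α u) : ℝ) = -inner ℝ (p.frame (α + 2)) u := by
  refine induction_basePair (P := fun p u _ => (inner ℝ (p.frame (α + 1)) (p.endo α u) : ℝ) =
    -inner ℝ (p.frame (α + 2)) u) (fun A p u _ h => ?_) (fun u _ => ?_) p u u
  · rw [frame_map, frame_map, endo_map, G2.toLin_inner, G2.toLin_inner, h]
  · rw [endo_basePair, frame_basePair, frame_basePair, inner_stdBasis_left, inner_stdBasis_left]
    fin_cases α <;> simp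

theorem continuous_endo (α : Fin 3) : Continuous fun x : StdStiefel × E7 => x.1.endo α x.2 := by
  have hu : Continuous fun x : StdStiefel × E7 => x.1.1.1 :=
    continuous_fst.comp (continuous_subtype_val.comp continuous_fst)
  have hv : Continuous fun x : StdStiefel × E7 => x.1.1.2 :=
    continuous_snd.comp (continuous_subtype_val.comp continuous_fst)
  have h0 := continuous_stdCross.comp (hu.prodMk continuous_snd)
  have h1 := continuous_stdCross.comp (hv.prodMk continuous_snd)
  fin_cases α
  · exact h0
  · exact h1
  · have h2 : Continuous fun x : StdStiefel × E7 => (inner ℝ x.1.1.2 x.2 : ℝ) • x.1.1.1 :=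
      (Continuous.inner (𝕜 := ℝ) hv continuous_snd).smul hu
    exact (continuous_stdCross.comp (hu.prodMk h1)).sub h2

end StdStiefel

section Manifold

variable {H : Type*} [TopologicalSpace H] {I : ModelWithCorners ℝ E7 H}
  {Y : Type*} [TopologicalSpace Y] [ChartedSpace H Y] [IsManifold I 1 Y]

namespace G2Structure

variable {φ : G2Structure I Y}

section

variable {e : Trivialization E7 (TotalSpace.proj : TangentBundle I Y → Y)} (he : φ.IsAdapted e)
  {X : Type*} [TopologicalSpace X] {b : X → Y} {v : ∀ x, TangentSpace I (b x)} {x₀ : X}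

theorem IsAdapted.continuousAt_tangent (h0 : b x₀ ∈ e.baseSet) (hb : ContinuousAt b x₀)
    (hv : ContinuousAt (fun x => he.coframeField.equiv (b x) (v x)) x₀) :
    ContinuousAt (fun x => (⟨b x, v x⟩ : TangentBundle I Y)) x₀ := by
  refine e.continuousAt_of_comp (a := fun x => (⟨b x, v x⟩ : TangentBundle I Y)) h0 hb (hv.congr ?_)
  filter_upwards [hb.eventually (e.open_baseSet.mem_nhds h0)] with x hx
  exact he.coframeField_apply hx _

theorem IsAdapted.continuousAt_equiv (h0 : b x₀ ∈ e.baseSet)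
    (h : ContinuousAt (fun x => (⟨b x, v x⟩ : TangentBundle I Y)) x₀) :
    ContinuousAt (fun x => he.coframeField.equiv (b x) (v x)) x₀ := by
  have hb : ContinuousAt b x₀ :=
    (FiberBundle.continuous_proj E7 (TangentSpace I : Y → Type _)).continuousAt.comp h
  have h1 := ContinuousAt.comp (f := fun x => (⟨b x, v x⟩ : TangentBundle I Y))
    (e.continuousAt_snd (a := ⟨b x₀, v x₀⟩) h0) h
  refine h1.congr ?_
  filter_upwards [hb.eventually (e.open_baseSet.mem_nhds h0)] with x hx
  exact (he.coframeField_apply hx _).symm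

end

theorem Stiefel.continuous_frame (α : Fin 3) : Continuous fun q : φ.Stiefel =>
    (⟨q.pt, q.frame α⟩ : TangentBundle I Y) := by
  rw [continuous_iff_continuousAt]
  intro q
  obtain ⟨e, he, hq⟩ := exists_isAdapted (φ := φ) q.pt
  refine he.continuousAt_tangent hq continuous_pt.continuousAt ?_
  simp only [← frame_coord]
  exact (StdStiefel.continuous_frame α).continuousAt.comp (he.continuousAt_coord hq)

theorem CoframeField.equiv_frameField (C : φ.CoframeField) (s : φ.StiefelSection) (α : Fin 3)
    (x : Y) : C.equiv x (frameField s α x) = ((s.1 x).coord C).frame α := by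
  have h : ∀ (q : φ.Stiefel) (x : Y) (hx : q.pt = x),
      C.equiv x (hx ▸ q.frame α) = (q.coord C).frame α := by
    rintro q x rfl
    exact (Stiefel.frame_coord C q α).symm
  exact h _ _ _

theorem mk_frameField (s : φ.StiefelSection) (α : Fin 3) (x : Y) :
    (⟨x, frameField s α x⟩ : TangentBundle I Y) = ⟨(s.1 x).pt, (s.1 x).frame α⟩ := by
  have h : ∀ (q : φ.Stiefel) (x : Y) (hx : q.pt = x),
      (⟨x, hx ▸ q.frame α⟩ : TangentBundle I Y) = ⟨q.pt, q.frame α⟩ := by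
    rintro q x rfl
    rfl
  exact h _ _ _

theorem continuous_frameField (s : φ.StiefelSection) (α : Fin 3) :
    Continuous fun x => (⟨x, frameField s α x⟩ : TangentBundle I Y) := by
  simp only [mk_frameField]
  exact (Stiefel.continuous_frame α).comp s.1.continuous

theorem stiefelSection_ext {s s' : φ.StiefelSection}
    (h : ∀ α x, frameField s α x = frameField s' α x) : s = s' := by
  refine Subtype.ext (ContinuousMap.ext fun x => ?_)
  refine Stiefel.ext_coord φ.coframeField ((s.2 x).trans (s'.2 x).symm) ?_
  have h1 : ∀ α, ((s.1 x).coord φ.coframeField).frame α =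
      ((s'.1 x).coord φ.coframeField).frame α := fun α => by
    rw [← CoframeField.equiv_frameField, ← CoframeField.equiv_frameField, h]
  exact Subtype.ext (Prod.ext (h1 0) (h1 1))

/-- Two vector fields that are orthonormal at each point form a section of `𝒱₂(TY)`. -/
def sectionOfFields (X Z : ∀ x : Y, TangentSpace I x)
    (hX : Continuous fun x => (⟨x, X x⟩ : TangentBundle I Y))
    (hZ : Continuous fun x => (⟨x, Z x⟩ : TangentBundle I Y))
    (hXX : ∀ x, φ.metric x (X x) (X x) = 1) (hZZ : ∀ x, φ.metric x (Z x) (Z x) = 1)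
    (hXZ : ∀ x, φ.metric x (X x) (Z x) = 0) : φ.StiefelSection :=
  ⟨⟨fun x => ⟨x, X x, Z x, hXX x, hZZ x, hXZ x⟩,
    Stiefel.isInducing.continuous_iff.mpr (hX.prodMk hZ)⟩, fun _ => rfl⟩

namespace ACM3S

variable (a : φ.ACM3S)

theorem J_R (α : Fin 3) (x : Y) : a.J α x (a.R α x) = 0 := by
  have h := a.metric_J α x (a.R α x) (a.R α x)
  rw [a.R_unit, a.σ_R_self, mul_one, sub_self, metric, inner_self_eq_zero] at h
  exact (φ.coframe x).map_eq_zero_iff.mp h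

/-- The one-forms of an almost contact metric structure are dual to its vector fields. -/
theorem σ_eq_metric (α : Fin 3) (x : Y) (u : TangentSpace I x) :
    a.σ α x u = φ.metric x (a.R α x) u := by
  have h := a.metric_J α x (a.R α x) u
  rw [J_R, a.σ_R_self, one_mul, metric, map_zero, inner_zero_left] at h
  linarith

theorem R_two (x : Y) : a.R 2 x = φ.cross (a.R 0 x) (a.R 1 x) :=
  (a.R_eq 0 x).trans (a.compatible₀ x _)

/-- The section of `𝒱₂(TY)` given by the first two vector fields. -/
def toSection : φ.StiefelSection :=
  sectionOfFields (a.R 0) (a.R 1) (a.continuous_R 0) (a.continuous_R 1) (a.R_unit 0) (a.R_unit 1)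
    fun x => by rw [← σ_eq_metric]; exact a.σ_R 0 x

theorem frameField_toSection (α : Fin 3) (x : Y) : frameField a.toSection α x = a.R α x := by
  fin_cases α
  · rfl
  · rfl
  · exact (a.R_two x).symm

/-- A compatible structure is determined by `R¹` and `R²`: these give `J¹`, `J²` by compatibility,
`R³ = J¹ R²`, all `σ^α` by duality, and `J³` by the relation among the endomorphisms. -/
theorem toSection_injective : Function.Injective (toSection : φ.ACM3S → φ.StiefelSection) := by
  intro a b h
  have hR : ∀ α x, a.R α x = b.R α x := fun α x => by
    rw [← frameField_toSection, h, frameField_toSection]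
  have hσ : ∀ α x u, a.σ α x u = b.σ α x u := fun α x u => by
    rw [σ_eq_metric, σ_eq_metric, hR]
  have h0 : ∀ x u, a.J 0 x u = b.J 0 x u := fun x u => by
    rw [a.compatible₀, b.compatible₀, hR]
  have h1 : ∀ x u, a.J 1 x u = b.J 1 x u := fun x u => by
    rw [a.compatible₁, b.compatible₁, hR]
  have h2 : ∀ x u, a.J 2 x u = b.J 2 x u := fun x u => by
    refine (a.J_mul 0 x u).trans (Eq.trans ?_ (b.J_mul 0 x u).symm)
    rw [h0, hR, hσ]
    exact congrArg (fun y => b.J 0 x y - _) (h1 x u)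
  refine ACM3S.ext (funext fun α => funext fun x => LinearMap.ext fun u => ?_)
    (funext fun α => funext fun x => hR α x)
    (funext fun α => funext fun x => LinearMap.ext fun u => hσ α x u)
  fin_cases α
  · exact h0 x u
  · exact h1 x u
  · exact h2 x u

end ACM3S

theorem CoframeField.exists_toLin (C : φ.CoframeField) (x : Y) :
    ∃ A : G2, ∀ v, C.equiv x v = G2.toLin A (φ.coframe x v) :=
  ⟨G2.ofLin _ (C.transition x), fun v => by rw [G2.toLin_ofLin]; simp⟩

variable (s : φ.StiefelSection)

/-- The endomorphism fields attached to a section of `𝒱₂(TY)`. -/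
def endoField (α : Fin 3) (x : Y) : TangentSpace I x →ₗ[ℝ] TangentSpace I x :=
  (φ.coframe x).symm.toLinearMap ∘ₗ ((s.1 x).coord φ.coframeField).endo α ∘ₗ
    (φ.coframe x).toLinearMap

/-- The one-forms dual to the frame of a section of `𝒱₂(TY)`. -/
def dualField (α : Fin 3) (x : Y) : TangentSpace I x →ₗ[ℝ] ℝ :=
  innerₗ E7 (((s.1 x).coord φ.coframeField).frame α) ∘ₗ (φ.coframe x).toLinearMap

theorem coframe_endoField (α : Fin 3) (x : Y) (u : TangentSpace I x) :
    φ.coframe x (endoField s α x u) =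
      ((s.1 x).coord φ.coframeField).endo α (φ.coframe x u) := by
  simp [endoField]

theorem coframe_frameField (α : Fin 3) (x : Y) :
    φ.coframe x (frameField s α x) = ((s.1 x).coord φ.coframeField).frame α :=
  φ.coframeField.equiv_frameField s α x

theorem dualField_apply (α : Fin 3) (x : Y) (u : TangentSpace I x) :
    dualField s α x u = inner ℝ (((s.1 x).coord φ.coframeField).frame α) (φ.coframe x u) := rfl

theorem exists_coord_eq (C : φ.CoframeField) (x : Y) :
    ∃ A : G2, (∀ v, C.equiv x v = G2.toLin A (φ.coframe x v)) ∧
      (s.1 x).coord C = ((s.1 x).coord φ.coframeField).map A := by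
  obtain ⟨A, hA⟩ := C.exists_toLin x
  refine ⟨A, hA, ?_⟩
  have h : ∀ α, ((s.1 x).coord C).frame α = (((s.1 x).coord φ.coframeField).map A).frame α :=
    fun α => by
      rw [StdStiefel.frame_map, ← coframe_frameField, ← C.equiv_frameField, hA]
  exact Subtype.ext (Prod.ext (h 0) (h 1))

/-- The endomorphism fields have the same expression in all adapted coframes. -/
theorem equiv_endoField (C : φ.CoframeField) (α : Fin 3) (x : Y) (u : TangentSpace I x) :
    C.equiv x (endoField s α x u) = ((s.1 x).coord C).endo α (C.equiv x u) := by
  obtain ⟨A, hA, h⟩ := exists_coord_eq s C x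
  rw [h, hA, hA, coframe_endoField, StdStiefel.endo_map]

/-- The dual one-forms have the same expression in all adapted coframes. -/
theorem dualField_eq (C : φ.CoframeField) (α : Fin 3) (x : Y) (u : TangentSpace I x) :
    dualField s α x u = inner ℝ (((s.1 x).coord C).frame α) (C.equiv x u) := by
  obtain ⟨A, hA, h⟩ := exists_coord_eq s C x
  rw [h, hA, StdStiefel.frame_map, G2.toLin_inner, dualField_apply]

theorem IsAdapted.continuousAt_coord_section
    {e : Trivialization E7 (TotalSpace.proj : TangentBundle I Y → Y)} (he : φ.IsAdapted e)
    {p : TangentBundle I Y} (hp : p.proj ∈ e.baseSet) :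
    ContinuousAt (fun p : TangentBundle I Y => (s.1 p.proj).coord he.coframeField) p :=
  ContinuousAt.comp (f := fun p : TangentBundle I Y => s.1 p.proj)
    (he.continuousAt_coord (by rwa [s.2]))
    (s.1.continuous.comp (FiberBundle.continuous_proj E7 (TangentSpace I))).continuousAt

/-- The almost contact metric 3-structure of a section of `𝒱₂(TY)`. -/
def ACM3S.ofSection : φ.ACM3S where
  J := endoField s
  R := frameField s
  σ := dualField s
  continuous_J α := by
    rw [continuous_iff_continuousAt]
    intro p
    obtain ⟨e, he, hp⟩ := exists_isAdapted (φ := φ) p.proj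
    have hproj := FiberBundle.continuous_proj E7 (TangentSpace I : Y → Type _)
    refine he.continuousAt_tangent hp hproj.continuousAt ?_
    simp only [equiv_endoField]
    exact (StdStiefel.continuous_endo α).continuousAt.comp
      (f := fun p : TangentBundle I Y => ((s.1 p.proj).coord he.coframeField,
        he.coframeField.equiv p.proj p.snd))
      ((he.continuousAt_coord_section s hp).prodMk
        (he.continuousAt_equiv (v := fun p : TangentBundle I Y => p.snd) hp continuousAt_id))
  continuous_R := continuous_frameField s
  continuous_σ α := by
    rw [continuous_iff_continuousAt]
    intro p
    obtain ⟨e, he, hp⟩ := exists_isAdapted (φ := φ) p.proj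
    simp only [dualField_eq s he.coframeField]
    exact ContinuousAt.inner
      ((StdStiefel.continuous_frame α).continuousAt.comp (he.continuousAt_coord_section s hp))
      (he.continuousAt_equiv (v := fun p : TangentBundle I Y => p.snd) hp continuousAt_id)
  J_J α x u := (φ.coframe x).injective (by
    rw [coframe_endoField, coframe_endoField, StdStiefel.endo_endo, map_add, map_neg, map_smul,
      coframe_frameField, dualField_apply])
  σ_R_self α x := by
    rw [dualField_apply, coframe_frameField, StdStiefel.inner_frame, if_pos rfl]
  R_unit α x := by rw [metric, coframe_frameField, StdStiefel.inner_frame, if_pos rfl]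
  metric_J α x u v := by
    rw [metric, coframe_endoField, coframe_endoField, StdStiefel.inner_endo]; rfl
  J_mul α x u := (φ.coframe x).injective (by
    rw [map_sub, map_smul, coframe_endoField, coframe_endoField, coframe_endoField,
      StdStiefel.endo_mul, coframe_frameField, dualField_apply])
  J_mul' α x u := (φ.coframe x).injective (by
    rw [map_add, map_neg, map_smul, coframe_endoField, coframe_endoField, coframe_endoField,
      StdStiefel.endo_mul', coframe_frameField, dualField_apply])
  R_eq α x := (φ.coframe x).injective (by
    rw [coframe_endoField, coframe_frameField, coframe_frameField, StdStiefel.endo_frame])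
  R_eq' α x := (φ.coframe x).injective (by
    rw [map_neg, coframe_endoField, coframe_frameField, coframe_frameField, StdStiefel.endo_frame',
      neg_neg])
  σ_eq α x u := by
    rw [dualField_apply, dualField_apply, coframe_endoField, StdStiefel.inner_frame_endo]
  σ_eq' α x u := by
    rw [dualField_apply, dualField_apply, coframe_endoField, StdStiefel.inner_frame_endo', neg_neg]
  σ_R α x := by
    rw [dualField_apply, coframe_frameField, StdStiefel.inner_frame, if_neg (by simp)]
  σ_R' α x := by
    rw [dualField_apply, coframe_frameField, StdStiefel.inner_frame, if_neg (by simp)]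
  compatible₀ x u := (φ.coframe x).injective (by
    rw [coframe_endoField]
    refine Eq.trans ?_ (φ.coframeField.equiv_cross x _ _).symm
    exact congrArg (stdCross · _) (coframe_frameField s 0 x).symm)
  compatible₁ x u := (φ.coframe x).injective (by
    rw [coframe_endoField]
    refine Eq.trans ?_ (φ.coframeField.equiv_cross x _ _).symm
    exact congrArg (stdCross · _) (coframe_frameField s 1 x).symm)

/-- Compatible almost contact metric 3-structures correspond to sections of `𝒱₂(TY)`. -/
def ACM3S.equivSection : φ.ACM3S ≃ φ.StiefelSection :=
  Equiv.ofBijective ACM3S.toSection ⟨ACM3S.toSection_injective, fun s =>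
    ⟨ACM3S.ofSection s, stiefelSection_ext fun α x => ACM3S.frameField_toSection _ α x⟩⟩

end G2Structure

end Manifold

section Manifold

variable {H : Type*} [TopologicalSpace H] {I : ModelWithCorners ℝ E7 H}
  {Y : Type*} [TopologicalSpace Y] [ChartedSpace H Y] [IsManifold I 1 Y]

namespace G2Structure

variable {φ : G2Structure I Y}

/-! ### Trivial associative subbundles -/

section Fields

variable {X Z : ∀ x : Y, TangentSpace I x}

theorem continuous_metric_fields (φ : G2Structure I Y)
    (hX : Continuous fun x => (⟨x, X x⟩ : TangentBundle I Y))
    (hZ : Continuous fun x => (⟨x, Z x⟩ : TangentBundle I Y)) :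
    Continuous fun x => φ.metric x (X x) (Z x) := by
  rw [continuous_iff_continuousAt]
  intro x
  obtain ⟨e, he, hx⟩ := exists_isAdapted (φ := φ) x
  simp only [he.coframeField.metric_eq]
  exact ContinuousAt.inner (he.continuousAt_equiv (b := fun x => x) hx hX.continuousAt)
    (he.continuousAt_equiv (b := fun x => x) hx hZ.continuousAt)

theorem continuous_smul_field (φ : G2Structure I Y) {f : Y → ℝ} (hf : Continuous f)
    (hX : Continuous fun x => (⟨x, X x⟩ : TangentBundle I Y)) :
    Continuous fun x => (⟨x, f x • X x⟩ : TangentBundle I Y) := by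
  rw [continuous_iff_continuousAt]
  intro x
  obtain ⟨e, he, hx⟩ := exists_isAdapted (φ := φ) x
  refine he.continuousAt_tangent (b := fun x => x) hx continuousAt_id ?_
  simp only [map_smul]
  exact hf.continuousAt.smul (he.continuousAt_equiv (b := fun x => x) hx hX.continuousAt)

theorem continuous_sub_field (φ : G2Structure I Y)
    (hX : Continuous fun x => (⟨x, X x⟩ : TangentBundle I Y))
    (hZ : Continuous fun x => (⟨x, Z x⟩ : TangentBundle I Y)) :
    Continuous fun x => (⟨x, X x - Z x⟩ : TangentBundle I Y) := by
  rw [continuous_iff_continuousAt]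
  intro x
  obtain ⟨e, he, hx⟩ := exists_isAdapted (φ := φ) x
  refine he.continuousAt_tangent (b := fun x => x) hx continuousAt_id ?_
  simp only [map_sub]
  exact (he.continuousAt_equiv (b := fun x => x) hx hX.continuousAt).sub
    (he.continuousAt_equiv (b := fun x => x) hx hZ.continuousAt)

theorem metric_self_pos (φ : G2Structure I Y) {x : Y} {u : TangentSpace I x} (hu : u ≠ 0) :
    0 < φ.metric x u u :=
  real_inner_self_pos.mpr fun h => hu ((φ.coframe x).map_eq_zero_iff.mp h)

theorem metric_smul_left (φ : G2Structure I Y) {x : Y} (c : ℝ) (u v : TangentSpace I x) :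
    φ.metric x (c • u) v = c * φ.metric x u v := by
  simp [metric, inner_smul_left]

theorem metric_smul_right (φ : G2Structure I Y) {x : Y} (c : ℝ) (u v : TangentSpace I x) :
    φ.metric x u (c • v) = c * φ.metric x u v := by
  simp [metric, inner_smul_right]

theorem metric_sub_right (φ : G2Structure I Y) {x : Y} (u v w : TangentSpace I x) :
    φ.metric x u (v - w) = φ.metric x u v - φ.metric x u w := by
  simp [metric, inner_sub_right]

/-- Normalisation of a nowhere vanishing vector field. -/
theorem exists_unit_field (φ : G2Structure I Y)
    (hX : Continuous fun x => (⟨x, X x⟩ : TangentBundle I Y)) (h0 : ∀ x, X x ≠ 0) :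
    ∃ f : Y → ℝ, (Continuous fun x => (⟨x, f x • X x⟩ : TangentBundle I Y)) ∧
      ∀ x, φ.metric x (f x • X x) (f x • X x) = 1 := by
  have hpos := fun x => φ.metric_self_pos (h0 x)
  refine ⟨fun x => (√(φ.metric x (X x) (X x)))⁻¹, ?_, fun x => ?_⟩
  · exact continuous_smul_field φ ((φ.continuous_metric_fields hX hX).sqrt.inv₀ fun x =>
      (Real.sqrt_pos.mpr (hpos x)).ne') hX
  · rw [metric_smul_left, metric_smul_right, ← mul_assoc, ← mul_inv,
      Real.mul_self_sqrt (hpos x).le, inv_mul_cancel₀ (hpos x).ne']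

end Fields

theorem Stiefel.span_eq_of_mem {q : φ.Stiefel} {Q : φ.Assoc} (h : q.pt = Q.pt)
    (h0 : h ▸ q.fst ∈ Q.plane) (h1 : h ▸ q.snd ∈ Q.plane) : q.span = Q := by
  obtain ⟨x, P, hP, hc⟩ := Q
  obtain ⟨y, u, v, hu, hv, huv⟩ := q
  simp only at h
  subst h
  refine Assoc.ext_coord φ.coframeField rfl (StdAssoc.eq_of_le (Submodule.map_mono ?_))
  change Submodule.span ℝ _ ≤ P
  rw [Submodule.span_le]
  rintro _ ⟨α, rfl⟩
  fin_cases α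
  · exact h0
  · exact h1
  · exact hc _ h0 _ h1

theorem frameField_pt (s : φ.StiefelSection) (α : Fin 3) (x : Y) :
    frameField s α (s.1 x).pt = (s.1 x).frame α := by
  apply (φ.coframe (s.1 x).pt).injective
  rw [coframe_frameField, congrArg s.1 (s.2 x)]
  exact Stiefel.frame_coord φ.coframeField (s.1 x) α

/-- A trivial associative subbundle has an orthonormal frame of the form `R¹, R², R¹ × R²`, by the
Gram–Schmidt process. -/
theorem isTrivialBundle_iff {s : φ.AssocSection} :
    IsTrivialBundle s ↔ ∃ R : φ.StiefelSection, ∀ x, (R.1 x).span = s.1 x := by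
  constructor
  · rintro ⟨X, hX, hspan⟩
    have hmem : ∀ i x, X i (s.1 x).pt ∈ (s.1 x).plane := fun i x => by
      rw [← hspan]; exact Submodule.subset_span ⟨i, rfl⟩
    have hli : ∀ x, LinearIndependent ℝ fun i => X i x := fun x => by
      have h : LinearIndependent ℝ fun i => X i (s.1 x).pt := by
        rw [linearIndependent_iff_card_eq_finrank_span, Set.finrank, hspan, (s.1 x).finrank_eq,
          Fintype.card_fin]
      rwa [s.2 x] at h
    obtain ⟨f, hf, hf1⟩ := exists_unit_field φ (hX 0) fun x => (hli x).ne_zero 0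
    have hZ : Continuous fun x => (⟨x, X 1 x - φ.metric x (f x • X 0 x) (X 1 x) • (f x • X 0 x)⟩ :
        TangentBundle I Y) :=
      continuous_sub_field φ (hX 1)
        (continuous_smul_field φ (φ.continuous_metric_fields hf (hX 1)) hf)
    obtain ⟨g, hg, hg1⟩ := exists_unit_field φ hZ fun x h => by
      rw [smul_smul, sub_eq_zero] at h
      have h2 := Fintype.linearIndependent_iff.mp (hli x)
        ![-(φ.metric x (f x • X 0 x) (X 1 x) * f x), 1, 0] (by
          rw [Fin.sum_univ_three]
          simp only [Matrix.cons_val, neg_smul, one_smul, zero_smul, add_zero]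
          exact neg_add_eq_zero.mpr h.symm) 1
      simp at h2
    let R : φ.StiefelSection := sectionOfFields _ _ hf hg hf1 hg1 fun x => by
      rw [metric_smul_right, metric_sub_right, metric_smul_right, hf1, mul_one, sub_self, mul_zero]
    refine ⟨R, fun x => ?_⟩
    rw [← s.2 x]
    refine (Stiefel.span_eq_of_mem (q := R.1 (s.1 x).pt) (Q := s.1 x) rfl ?_ ?_).trans ?_
    · exact Submodule.smul_mem _ _ (hmem 0 x)
    · exact Submodule.smul_mem _ _ (Submodule.sub_mem _ (hmem 1 x)
        (Submodule.smul_mem _ _ (Submodule.smul_mem _ _ (hmem 0 x))))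
    · rw [s.2 x]
  · rintro ⟨R, hR⟩
    refine ⟨frameField R, continuous_frameField R, fun x => ?_⟩
    rw [← hR]
    change Submodule.span ℝ (Set.range fun i => frameField R i (R.1 x).pt) =
      Submodule.span ℝ (Set.range (R.1 x).frame)
    simp only [frameField_pt]

/-- The section of `𝒱₂(TY)` with given values. -/
def StiefelSection.mk (g : Y → φ.Stiefel) (hg : Continuous g) (hpt : ∀ x, (g x).pt = x) :
    φ.StiefelSection := ⟨⟨g, hg⟩, hpt⟩

/-- Triviality is preserved along paths of associative subbundles, since homotopies lift from
`𝒢(φ)` to `𝒱₂(TY)`. -/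
theorem IsTrivialBundle.of_joined [T2Space Y] [SecondCountableTopology Y] {s s' : φ.AssocSection}
    (h : Joined s s') (hs : IsTrivialBundle s) : IsTrivialBundle s' := by
  have := Manifold.locallyCompact_of_finiteDimensional (M := Y) I
  obtain ⟨γ⟩ := h
  rw [isTrivialBundle_iff] at hs ⊢
  obtain ⟨R, hR⟩ := hs
  obtain ⟨D, τ, δ, hD, hD0, hτ, hτs, hτid, -, -⟩ := exists_transport φ
  have hH : Continuous fun p : Y × ℝ => (γ.extend p.2).1 p.1 :=
    (continuous_subtype_val.comp (γ.continuous_extend.comp continuous_snd)).eval continuous_fst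
  obtain ⟨g, hg, hgs⟩ := exists_lift_of_transport hD hD0 hτ hτs hτid
    (H := fun x t => (γ.extend t).1 x) hH R.1.continuous (fun x => by rw [hR, γ.extend_zero])
  simp only [γ.extend_one] at hgs
  exact ⟨StiefelSection.mk g hg fun x => (congrArg Assoc.pt (hgs x)).trans (s'.2 x), hgs⟩

/-! ### The fibration of sections -/

/-- The fibrewise span of a section. -/
def spanSection (R : φ.StiefelSection) : φ.TrivialSection :=
  ⟨⟨⟨fun x => (R.1 x).span, Stiefel.continuous_span.comp R.1.continuous⟩, R.2⟩,
    isTrivialBundle_iff.mpr ⟨R, fun _ => rfl⟩⟩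

theorem spanSection_eq_iff {R : φ.StiefelSection} {s : φ.TrivialSection} :
    spanSection R = s ↔ ∀ x, (R.1 x).span = s.1.1 x := by
  rw [Subtype.ext_iff, Subtype.ext_iff, ContinuousMap.ext_iff]
  rfl

theorem spanSection_surjective :
    Function.Surjective (spanSection : φ.StiefelSection → φ.TrivialSection) := fun s => by
  obtain ⟨R, hR⟩ := isTrivialBundle_iff.mp s.2
  exact ⟨R, spanSection_eq_iff.mpr hR⟩

theorem continuous_spanSection :
    Continuous (spanSection : φ.StiefelSection → φ.TrivialSection) :=
  (((ContinuousMap.continuous_postcomp ⟨_, Stiefel.continuous_span⟩).comp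
    continuous_subtype_val).subtype_mk _).subtype_mk _

/-- The pointwise action of maps to `SO(3)` on sections of `𝒱₂(TY)`. -/
def actSection (Θ : C(Y, SO3)) (R : φ.StiefelSection) : φ.StiefelSection :=
  StiefelSection.mk (fun x => (R.1 x).act (Θ x))
    (Stiefel.continuous_act.comp (Θ.continuous.prodMk R.1.continuous)) R.2

theorem spanSection_actSection (Θ : C(Y, SO3)) (R : φ.StiefelSection) :
    spanSection (actSection Θ R) = spanSection R :=
  spanSection_eq_iff.mpr fun x => Stiefel.span_act (Θ x) (R.1 x)

/-- The action is characterised by its effect on the three vector fields of a section. -/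
theorem frameField_eq_sum_iff (Θ : C(Y, SO3)) (R S : φ.StiefelSection) :
    (∀ α x, frameField S α x = ∑ β, (Θ x).1 α β • frameField R β x) ↔ S = actSection Θ R := by
  have key : ∀ α x, frameField (actSection Θ R) α x = ∑ β, (Θ x).1 α β • frameField R β x := by
    intro α x
    apply (φ.coframe x).injective
    rw [coframe_frameField, map_sum]
    change (((R.1 x).act (Θ x)).coord φ.coframeField).frame α = _
    rw [Stiefel.coord_act, StdStiefel.frame_act]
    exact Finset.sum_congr rfl fun β _ => by rw [map_smul, coframe_frameField]
  constructor
  · intro h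
    exact stiefelSection_ext fun α x => (h α x).trans (key α x).symm
  · rintro rfl
    exact key

/-- The fibres of the span of sections are free and transitive orbits of the group of maps to
`SO(3)`: the rotation between two frames of the same plane depends continuously on the frames. -/
theorem exists_unique_actSection [T2Space Y] [SecondCountableTopology Y] (R S : φ.StiefelSection) :
    spanSection R = spanSection S ↔ ∃! Θ : C(Y, SO3), S = actSection Θ R := by
  constructor
  · intro h
    obtain ⟨D, τ, δ, -, -, -, -, -, hδ, hδc⟩ := exists_transport φ
    have hs : ∀ x, (S.1 x).span = (R.1 x).span := fun x => (spanSection_eq_iff.mp h x).symm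
    have hΘ : ∀ x, (R.1 x).act (δ (S.1 x) (R.1 x)) = S.1 x := fun x => by
      obtain ⟨Θ, hΘ⟩ := Stiefel.exists_act_eq (hs x)
      rw [← hΘ, hδ]
    refine ⟨⟨fun x => δ (S.1 x) (R.1 x), continuous_iff_continuousAt.mpr fun x => ?_⟩, ?_, ?_⟩
    · exact (hδc _ _ (hs x)).comp (f := fun x => (S.1 x, R.1 x))
        (S.1.continuous.prodMk R.1.continuous).continuousAt
    · exact Subtype.ext (ContinuousMap.ext fun x => (hΘ x).symm)
    · rintro Θ rfl
      exact ContinuousMap.ext fun x => (hδ (Θ x) (R.1 x)).symm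
  · rintro ⟨Θ, rfl, -⟩
    exact (spanSection_actSection Θ R).symm

/-- Local sections of the fibration of sections. A section near `s` over a compact set containing
the image of `f` is lifted after composition with `f`, by transport; the lift is carried along the
homotopy from `f` to the identity. -/
theorem exists_local_section [T2Space Y] [SecondCountableTopology Y] {f : C(Y, Y)}
    (hf : (ContinuousMap.id Y).Homotopic f) {K : Set Y} (hK : IsCompact K)
    (hfK : Set.range f ⊆ K) (s : φ.TrivialSection) :
    ∃ U : Set φ.TrivialSection, IsOpen U ∧ s ∈ U ∧ ∃ σ : U → φ.StiefelSection,
      Continuous σ ∧ ∀ s', spanSection (σ s') = s' := by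
  have := Manifold.locallyCompact_of_finiteDimensional (M := Y) I
  obtain ⟨F⟩ := hf
  obtain ⟨D, τ, δ, hD, hD0, hτ, hτs, hτid, -, -⟩ := exists_transport φ
  obtain ⟨R, hR⟩ := spanSection_surjective s
  have hR := spanSection_eq_iff.mp hR
  have hev : Continuous fun p : φ.TrivialSection × Y => p.1.1.1 p.2 :=
    ((continuous_subtype_val.comp continuous_subtype_val).comp continuous_fst).eval continuous_snd
  have hDs : Continuous fun p : φ.TrivialSection × Y => D (s.1.1 p.2) (p.1.1.1 p.2) :=
    hD.comp ((s.1.1.continuous.comp continuous_snd).prodMk hev)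
  let Ψ : φ.TrivialSection → C(Y, ℝ) := fun s' =>
    ⟨fun x => D (s.1.1 x) (s'.1.1 x), hDs.comp (Continuous.prodMk_right s')⟩
  have hΨ : Continuous Ψ := ContinuousMap.continuous_of_continuous_uncurry _ hDs
  refine ⟨Ψ ⁻¹' {h | Set.MapsTo h K (Set.Ioi 0)},
    (ContinuousMap.isOpen_setOfPred_mapsTo hK isOpen_Ioi).preimage hΨ, fun x _ => hD0 _, ?_⟩
  set U := Ψ ⁻¹' {h | Set.MapsTo h K (Set.Ioi 0)} with hU
  have hpos : ∀ p : U × Y, 0 < D (R.1 (f p.2)).span (p.1.1.1.1 (f p.2)) := fun p => by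
    rw [hR]
    exact p.1.2 (hfK ⟨p.2, rfl⟩)
  have hevf : Continuous fun p : U × Y => p.1.1.1.1 (f p.2) :=
    hev.comp ((continuous_subtype_val.comp continuous_fst).prodMk
      (f.continuous.comp continuous_snd))
  have hF : Continuous fun p : (U × Y) × ℝ => p.1.1.1.1.1 (F.symm.extend p.2 p.1.2) :=
    hev.comp ((continuous_subtype_val.comp (continuous_fst.comp continuous_fst)).prodMk
      ((F.symm.extend.continuous.comp continuous_snd).eval (continuous_snd.comp continuous_fst)))
  obtain ⟨g, hg, hgs⟩ := exists_lift_of_transport (X := U × Y) hD hD0 hτ hτs hτid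
    (H := fun p t => p.1.1.1.1 (F.symm.extend t p.2)) hF
    (f := fun p => τ (R.1 (f p.2)) (p.1.1.1.1 (f p.2)))
    (continuous_iff_continuousAt.mpr fun p => (hτ _ _ (hpos p)).comp
      (f := fun p : U × Y => (R.1 (f p.2), p.1.1.1.1 (f p.2)))
      (((R.1.continuous.comp (f.continuous.comp continuous_snd)).prodMk hevf).continuousAt))
    (fun p => by rw [hτs _ _ (hpos p), F.symm.extend_zero])
  simp only [F.symm.extend_one, ContinuousMap.id_apply] at hgs
  refine ⟨fun s' => StiefelSection.mk (fun x => g (s', x)) (hg.comp (Continuous.prodMk_right s'))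
    fun x => (congrArg Assoc.pt (hgs (s', x))).trans (s'.1.1.2 x), ?_, fun s' => ?_⟩
  · exact (ContinuousMap.continuous_of_continuous_uncurry
      (fun s' : U => (⟨fun x => g (s', x), hg.comp (Continuous.prodMk_right s')⟩ :
        C(Y, φ.Stiefel))) hg).subtype_mk _
  · exact spanSection_eq_iff.mpr fun x => hgs (s', x)

/-- A local section of the fibration of sections, together with the action of `Maps(Y, SO(3))`,
yields a local trivialisation. -/
theorem exists_trivialization [T2Space Y] [SecondCountableTopology Y] {U : Set φ.TrivialSection}
    (hU : IsOpen U) {σ : U → φ.StiefelSection} (hσ : Continuous σ)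
    (hσs : ∀ s', spanSection (σ s') = s') :
    ∃ e : Trivialization C(Y, SO3) (spanSection : φ.StiefelSection → φ.TrivialSection),
      e.baseSet = U := by
  classical
  have := Manifold.locallyCompact_of_finiteDimensional (M := Y) I
  obtain ⟨D, τ, δ, -, -, -, -, -, hδ, hδc⟩ := exists_transport φ
  have hspan : ∀ (R : φ.StiefelSection) (h : spanSection R ∈ U) (x : Y),
      (R.1 x).span = ((σ ⟨_, h⟩).1 x).span := fun R h x =>
    (spanSection_eq_iff.mp (hσs ⟨_, h⟩) x).symm
  have hδx : ∀ (R : φ.StiefelSection) (h : spanSection R ∈ U),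
      Continuous fun x => δ (R.1 x) ((σ ⟨_, h⟩).1 x) := fun R h =>
    continuous_iff_continuousAt.mpr fun x => (hδc _ _ (hspan R h x)).comp
      (f := fun x => (R.1 x, (σ ⟨_, h⟩).1 x))
      (R.1.continuous.prodMk (σ ⟨_, h⟩).1.continuous).continuousAt
  -- `Δ R` rotates the local section to `R`; outside of the base set the values of `Δ` and of the
  -- extension `σ'` of the local section are irrelevant
  let Δ : φ.StiefelSection → C(Y, SO3) := fun R =>
    if h : spanSection R ∈ U then ⟨_, hδx R h⟩ else ContinuousMap.const Y 1
  have hΔ : ∀ R (h : spanSection R ∈ U) x, Δ R x = δ (R.1 x) ((σ ⟨_, h⟩).1 x) := fun R h x => by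
    simp only [Δ, dif_pos h, ContinuousMap.coe_mk]
  let σ' : φ.TrivialSection → φ.StiefelSection := fun s =>
    if h : s ∈ U then σ ⟨s, h⟩ else Function.surjInv spanSection_surjective s
  have hσ' : ∀ s (h : s ∈ U), σ' s = σ ⟨s, h⟩ := fun s h => by simp only [σ', dif_pos h]
  have hσs' : ∀ s, spanSection (σ' s) = s := fun s => by
    by_cases h : s ∈ U
    · rw [hσ' s h, hσs]
    · simp only [σ', dif_neg h]
      exact Function.surjInv_eq spanSection_surjective s
  have hact : ∀ (s : φ.TrivialSection) (Θ : C(Y, SO3)), spanSection (actSection Θ (σ' s)) = s :=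
    fun s Θ => by rw [spanSection_actSection, hσs']
  have hcΔ : ContinuousOn Δ (spanSection ⁻¹' U) := by
    rw [continuousOn_iff_continuous_domRestrict]
    refine ContinuousMap.continuous_of_continuous_uncurry _ (continuous_iff_continuousAt.mpr ?_)
    have hpair : Continuous fun p : (spanSection ⁻¹' U : Set φ.StiefelSection) × Y =>
        (p.1.1.1 p.2, (σ ⟨spanSection p.1.1, p.1.2⟩).1 p.2) := by
      refine Continuous.prodMk ?_ ?_
      · exact (continuous_subtype_val.comp
          (continuous_subtype_val.comp continuous_fst)).eval continuous_snd
      · exact (continuous_subtype_val.comp (hσ.comp (((continuous_spanSection.comp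
          continuous_subtype_val).subtype_mk _).comp continuous_fst))).eval continuous_snd
    intro p
    refine ((hδc _ _ (hspan p.1.1 p.1.2 p.2)).comp (x := p)
      (f := fun p : (spanSection ⁻¹' U : Set φ.StiefelSection) × Y =>
        (p.1.1.1 p.2, (σ ⟨spanSection p.1.1, p.1.2⟩).1 p.2)) hpair.continuousAt).congr ?_
    exact Filter.Eventually.of_forall fun p => (hΔ p.1.1 p.1.2 p.2).symm
  have hcinv : ContinuousOn (fun p : φ.TrivialSection × C(Y, SO3) => actSection p.2 (σ' p.1))
      (U ×ˢ Set.univ) := by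
    rw [continuousOn_iff_continuous_domRestrict]
    refine Continuous.subtype_mk (ContinuousMap.continuous_of_continuous_uncurry _ ?_) _
    refine Stiefel.continuous_act.comp (Continuous.prodMk ?_ ?_)
    · exact (continuous_snd.comp (continuous_subtype_val.comp continuous_fst)).eval continuous_snd
    · have hU : Continuous fun p : (U ×ˢ Set.univ : Set (φ.TrivialSection × C(Y, SO3))) × Y =>
          (⟨p.1.1.1, p.1.2.1⟩ : U) :=
        (continuous_fst.comp (continuous_subtype_val.comp continuous_fst)).subtype_mk _
      have h : Continuous fun p : (U ×ˢ Set.univ : Set (φ.TrivialSection × C(Y, SO3))) × Y =>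
          (σ ⟨p.1.1.1, p.1.2.1⟩).1 p.2 :=
        (continuous_subtype_val.comp (hσ.comp hU)).eval continuous_snd
      refine h.congr fun p => ?_
      rw [hσ' _ p.1.2.1]
  exact ⟨{
    toFun := fun R => (spanSection R, Δ R)
    invFun := fun p => actSection p.2 (σ' p.1)
    source := spanSection ⁻¹' U
    target := U ×ˢ Set.univ
    map_source' := fun R hR => ⟨hR, trivial⟩
    map_target' := fun p hp => by
      rw [Set.mem_preimage, hact]
      exact hp.1
    left_inv' := fun R hR => by
      refine Subtype.ext (ContinuousMap.ext fun x => ?_)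
      change ((σ' (spanSection R)).1 x).act (Δ R x) = R.1 x
      rw [hσ' _ hR, hΔ R hR]
      obtain ⟨Θ, hΘ⟩ := Stiefel.exists_act_eq (hspan R hR x)
      rw [← hΘ, hδ]
    right_inv' := fun p hp => by
      refine Prod.ext (hact p.1 p.2) (ContinuousMap.ext fun x => ?_)
      have h : spanSection (actSection p.2 (σ' p.1)) ∈ U := by rw [hact]; exact hp.1
      change Δ (actSection p.2 (σ' p.1)) x = p.2 x
      rw [hΔ _ h, ← hσ' _ h, hact]
      exact hδ _ _
    open_source := hU.preimage continuous_spanSection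
    open_target := hU.prod isOpen_univ
    continuousOn_toFun := continuous_spanSection.continuousOn.prodMk hcΔ
    continuousOn_invFun := hcinv
    baseSet := U
    open_baseSet := hU
    source_eq := rfl
    target_eq := rfl
    proj_toFun := fun _ _ => rfl }, rfl⟩

end G2Structure

end Manifold

end

theorem mainTheorem6 {H : Type*} [TopologicalSpace H] (I : ModelWithCorners ℝ E7 H)
    {Y : Type*} [TopologicalSpace Y] [ChartedSpace H Y] [IsManifold I ∞ Y]
    [T2Space Y] [SecondCountableTopology Y] (φ : G2Structure I Y) :
    -- compatible ACM3Ss are the same as sections of the bundle of orthonormal pairs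
    (∃ Φ : φ.ACM3S ≃ φ.StiefelSection,
      ∀ a α x, G2Structure.frameField (Φ a) α x = a.R α x) ∧
    -- the two bundles over `Y`, associated to the tangent bundle
    (∀ e, φ.IsAdapted e →
      ∃ e' : Trivialization StdStiefel (G2Structure.Stiefel.pt : φ.Stiefel → Y),
        e'.baseSet = e.baseSet ∧ ∀ q : φ.Stiefel, q.pt ∈ e.baseSet →
          (e' q).2.1 = ((e ⟨q.pt, q.fst⟩).2, (e ⟨q.pt, q.snd⟩).2)) ∧
    (∀ e, φ.IsAdapted e →
      ∃ e' : Trivialization StdAssoc (G2Structure.Assoc.pt : φ.Assoc → Y),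
        e'.baseSet = e.baseSet ∧ ∀ q : φ.Assoc, q.pt ∈ e.baseSet →
          ((e' q).2.1 : Set E7) = (fun u : TangentSpace I q.pt => (e ⟨q.pt, u⟩).2) '' q.plane) ∧
    -- the typical fibres are the homogeneous spaces `G₂ / SU(2)` and `G₂ / SO(4)`
    (∀ p : StdStiefel,
      Nonempty (stabPair p ≃ₜ* Matrix.specialUnitaryGroup (Fin 2) ℂ) ∧
      ∃ F : (G2 ⧸ stabPair p) ≃ₜ StdStiefel,
        ∀ A : G2, (F A).1 = (G2.toLin A p.1.1, G2.toLin A p.1.2)) ∧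
    (∀ T : StdAssoc,
      Nonempty (stabPlane T ≃ₜ* Matrix.specialOrthogonalGroup (Fin 4) ℝ) ∧
      ∃ F : (G2 ⧸ stabPlane T) ≃ₜ StdAssoc, ∀ A : G2, (F A).1 = T.1.map (G2.toLin A)) ∧
    -- the trivial associative subbundles form a union of path components
    (∀ s s' : φ.AssocSection, Joined s s' →
      G2Structure.IsTrivialBundle s → G2Structure.IsTrivialBundle s') ∧
    -- the fibration of the space of ACM3Ss
    ∃ p : φ.StiefelSection → φ.TrivialSection,
      (∀ R x, (p R).1.1 x = (R.1 x).span) ∧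
      Continuous p ∧ Function.Surjective p ∧
      (∀ R S : φ.StiefelSection, p R = p S ↔
        ∃! Θ : C(Y, Matrix.specialOrthogonalGroup (Fin 3) ℝ), ∀ α x,
          G2Structure.frameField S α x =
            ∑ β, (Θ x).1 α β • G2Structure.frameField R β x) ∧
      (∀ (R : φ.StiefelSection) (Θ : C(Y, Matrix.specialOrthogonalGroup (Fin 3) ℝ)),
        ∃! S : φ.StiefelSection, ∀ α x,
          G2Structure.frameField S α x =
            ∑ β, (Θ x).1 α β • G2Structure.frameField R β x) ∧
      -- local triviality, when `Y` can be deformed into a compact subset (e.g. `Y` compact)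
      ((∃ f : C(Y, Y), (ContinuousMap.id Y).Homotopic f ∧ ∃ K, IsCompact K ∧ Set.range f ⊆ K) →
        ∀ s : φ.TrivialSection,
          ∃ e : Trivialization C(Y, Matrix.specialOrthogonalGroup (Fin 3) ℝ) p,
            s ∈ e.baseSet) := by
  refine ⟨⟨G2Structure.ACM3S.equivSection, fun a α x =>
    G2Structure.ACM3S.frameField_toSection a α x⟩, fun e he => ⟨he.stiefelTrivialization, rfl,
    fun q hq => ?_⟩, fun e he => ⟨he.assocTrivialization, rfl, fun Q hQ => ?_⟩,
    fun p => ⟨stabPair_mulEquiv p, ?_⟩, fun T => ⟨stabPlane_mulEquiv T, ?_⟩,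
    fun s s' h hs => hs.of_joined h, G2Structure.spanSection, fun R x => rfl,
    G2Structure.continuous_spanSection, G2Structure.spanSection_surjective, fun R S => ?_,
    fun R Θ => ?_, ?_⟩
  · exact Prod.ext (he.coframeField_apply hq _) (he.coframeField_apply hq _)
  · ext v
    constructor
    · rintro ⟨u, hu, rfl⟩
      exact ⟨u, hu, (he.coframeField_apply hQ u).symm⟩
    · rintro ⟨u, hu, rfl⟩
      exact ⟨u, hu, he.coframeField_apply hQ u⟩
  · obtain ⟨F, hF⟩ := stabPair_homeomorph p
    exact ⟨F, fun A => by rw [hF]; rfl⟩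
  · obtain ⟨F, hF⟩ := stabPlane_homeomorph T
    exact ⟨F, fun A => by rw [hF]; rfl⟩
  · simp only [G2Structure.frameField_eq_sum_iff]
    exact G2Structure.exists_unique_actSection R S
  · simp only [G2Structure.frameField_eq_sum_iff]
    exact existsUnique_eq
  · rintro ⟨f, hf, K, hK, hfK⟩ s
    obtain ⟨U, hU, hs, σ, hσ, hσs⟩ := G2Structure.exists_local_section hf hK hfK s
    obtain ⟨e, he⟩ := G2Structure.exists_trivialization hU hσ hσs
    exact ⟨e, he ▸ hs⟩
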